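/- **Setting.** Let $\Gamma=(E,V,i,j)$ be a metric graph: $E$ and $V$ are countable; every edge $e\in E$ is an open interval $(0,l(e))$ with $0<l(e)\le\infty$; $i:E\to V$ gives the initial vertex of each edge and $j:\{e: l(e)<\infty\}\to V$ the terminal vertex of each edge of finite length. Loops and multiple edges are allowed, and connectedness is not assumed. For $v\in V$ let $E_v$ be the set of edge ends at $v$ (a loop at $v$ contributes two ends, any other edge at $v$ one). Let $X$ be the space obtained by gluing the closed edges at the vertices, $L^2(X)=\bigoplus_e L^2(0,l(e))$ and $W^{1,2}(X)=\bigoplus_e W^{1,2}(0,l(e))$. For $f$ with the appropriate regularity, $f(v)\in\mathbb C^{E_v}$ is the vector of the limits of $f_e$ at the edge ends at $v$, and $f'(v)\in\mathbb C^{E_v}$ the vector of the limits of the derivatives, taken in the direction pointing away from $v$. For each $v$ let $L_v$ be a self-adjoint operator and $P_v$ an orthogonal projection on $\mathbb C^{E_v}$. Assume * (F) every $E_v$ is finite; * (LB) there is $u>0$ with $l(e)\ge u$ for all $e$; * (UB) there is $S>0$ with $\|L_v^+\|\le S$ for all $v$, where $L_v^+$ is the positive part of $L_v$. Let $s_0(f,g)=\sum_e\int_0^{l(e)}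 f_e'\,\overline{g_e'}\,dt-\sum_v\langle L_vf(v),g(v)\rangle$ on the domain $D(s_0)$ of all $f\in W^{1,2}(X)$ with $P_vf(v)=0$ for all $v$ and $\sum_v|\langle L_vf(v),f(v)\rangle|<\infty$ (the last condition is automatic if $\sup_v\|L_v\|<\infty$), and let $H_0$ be the operator in $L^2(X)$ associated with the form $s_0$, that is, $f\in D(H_0)$ and $H_0f=h$ if and only if $f\in D(s_0)$ and $s_0(f,g)=\langle h,g\rangle$ for all $g\in D(s_0)$. A function is said to satisfy the boundary condition at $v$ if its boundary values $f(v)$, $f'(v)$ exist and $$P_vf(v)=0,\qquad (1-P_v)\bigl(L_vf(v)+f'(v)\bigr)=0$$ (if $L_v$ commutes with $P_v$, the second equation reads $L_vf(v)+(1-P_v)f'(v)=0$). Let $W=(W_e)_{e\in E}$ be a real-valued measurable potential on the edges that is uniformly locally $L^2$, i.e. the norms $\|W|_I\|_2$, where $I$ runs through all edge segments (subintervals of closed edges) of length between $u$ and $2u$, are bounded by a common constant. Let $H=H_0+W$. A function $\phi$ on the edges is a *generalized eigenfunction* of $H$ for $\lambda\in\mathbb C$ if it is square integrable on all compact subsets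 of $X$, is not almost everywhere zero, and satisfies $\langle Hf,\phi\rangle=\lambda\langle f,\phi\rangle$ for all $f\in D(H)$ with compact support in $X$, where $\langle f,\phi\rangle=\sum_e\int_0^{l(e)} f_e\overline{\phi_e}\,dt$. **Proposition.** 1. $W$ is infinitesimally small with respect to $H_0$: every $f\in D(H_0)$ satisfies $Wf\in L^2(X)$, and for every $a>0$ there is $b$ with $\|Wf\|\le a\|H_0f\|+b\|f\|$ for all $f\in D(H_0)$. Moreover $H_0$ is self-adjoint, and $H=H_0+W$ is self-adjoint with domain $D(H_0)$. 2. For all sufficiently large $C>0$, $(H_0+C)^{-1/2}$ and $(H+C)^{-1/2}$ exist as bounded operators on $L^2(X)$ and are continuous maps from $L^2(X)$ to $L^\infty(X)$. 3. $\{f\in D(H_0): \operatorname{supp} f\text{ compact}\}$ is a core for $H$. 4. If $\phi$ is a generalized eigenfunction of $H$, then $\phi$ is locally in $W^{2,2}$, i.e. its restriction to every compact edge segment belongs to $W^{2,2}$, and $\phi$ has a version, continuously differentiable on the open edges, that satisfies the boundary condition at every vertex. -/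

import Mathlib

open Set Filter Topology MeasureTheory
open scoped ENNReal ComplexConjugate InnerProductSpace

/-- A metric graph with edge set `E` and vertex set `V`. The edge `e` is the open interval
`(0, l e)`, possibly of infinite length; it starts at the vertex `i e` and, if its length is finite,
it ends at the vertex `j e`. Loops and multiple edges are allowed, connectedness is not assumed. -/
structure MetricGraph (E V : Type*) where
  l : E → ℝ≥0∞
  l_pos : ∀ e, 0 < l e
  i : E → V
  j : {e : E // l e ≠ ∞} → V

namespace MetricGraph

noncomputable section

variable {E V : Type*} (Γ : MetricGraph E V)

/-- The open interval `(0, l e)`. -/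
def interval (e : E) : Set ℝ := {t | 0 < t ∧ ENNReal.ofReal t < Γ.l e}

/-- The interval `[0, l e]` (or `[0, ∞)` for an edge of infinite length). -/
def closedInterval (e : E) : Set ℝ := {t | 0 ≤ t ∧ ENNReal.ofReal t ≤ Γ.l e}

/-- The space `X`: the disjoint union of the vertices and the open edges. -/
def Space : Type _ := V ⊕ (Σ e : E, Γ.interval e)

/-- The parametrization `[0, l e] → X` of the closed edge `e`: it sends `0` to `i e`, the end point
`l e` (if finite) to `j e`, and is the identity on the open edge. -/
def edgeMap (e : E) (t : Γ.closedInterval e) : Γ.Space :=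
  open Classical in
  if h0 : (t : ℝ) = 0 then Sum.inl (Γ.i e)
  else if h1 : ENNReal.ofReal t = Γ.l e then
    Sum.inl (Γ.j ⟨e, fun h => ENNReal.ofReal_ne_top (h1.trans h)⟩)
  else Sum.inr ⟨e, t, lt_of_le_of_ne t.2.1 (Ne.symm h0), lt_of_le_of_ne t.2.2 h1⟩

/-- The topology obtained by gluing the closed edges at the vertices. -/
instance : TopologicalSpace Γ.Space :=
  ⨆ e, TopologicalSpace.coinduced (Γ.edgeMap e) inferInstance

/-- The part of a subset `K` of `X` in the open edge `e`, as a subset of `(0, l e)`. -/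
def slice (K : Set Γ.Space) (e : E) : Set ℝ :=
  {t | ∃ ht : t ∈ Γ.interval e, (Sum.inr ⟨e, t, ht⟩ : V ⊕ (Σ e : E, Γ.interval e)) ∈ K}

/-! ### Edge ends at a vertex -/

/-- The edge ends: `inl e` is the initial end of `e` and `inr e` the terminal end of an edge `e` of
finite length. -/
def EdgeEnd : Type _ := E ⊕ {e : E // Γ.l e ≠ ∞}

variable {Γ} in
/-- The edge an edge end belongs to. -/
def EdgeEnd.edge : Γ.EdgeEnd → E := Sum.elim id Subtype.val

variable {Γ} in
/-- The vertex at an edge end. -/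
def EdgeEnd.vertex : Γ.EdgeEnd → V := Sum.elim Γ.i Γ.j

variable {Γ} in
/-- Points of the open edge approaching an edge end: `t → 0+` or `t → (l e)-`. -/
def EdgeEnd.approach : Γ.EdgeEnd → Filter ℝ :=
  Sum.elim (fun _ => 𝓝[>] 0) (fun e => 𝓝[<] (Γ.l e).toReal)

variable {Γ} in
/-- The sign that turns the derivative into the derivative pointing away from the vertex. -/
def EdgeEnd.sign : Γ.EdgeEnd → ℂ := Sum.elim (fun _ => 1) (fun _ => -1)

/-- The edge ends at `v`; a loop at `v` contributes two of them, any other edge at `v` one. -/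
def Ends (v : V) : Type _ := {h : Γ.EdgeEnd // h.vertex = v}

/-- The space `ℂ^{E_v}` of boundary values at `v`. -/
abbrev BdrySpace (v : V) : Type _ := EuclideanSpace ℂ (Γ.Ends v)

/-! ### Function spaces -/

/-- Lebesgue measure on the edge `e`. -/
abbrev vol (e : E) : Measure ℝ := volume.restrict (Γ.interval e)

/-- `L²(X) = ⨁ₑ L²(0, l e)`, the Hilbert space direct sum. -/
abbrev L2 : Type _ := lp (fun e : E => Lp ℂ 2 (Γ.vol e)) 2

/-- `g` is the weak derivative of `f` on the open set `U ⊆ ℝ`. -/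
def IsWeakDeriv (U : Set ℝ) (f g : ℝ → ℂ) : Prop :=
  ∀ ψ : ℝ → ℝ, ContDiff ℝ (⊤ : ℕ∞) ψ → HasCompactSupport ψ → tsupport ψ ⊆ U →
    ∫ t in U, deriv ψ t • f t = -∫ t in U, ψ t • g t

/-- `f' = g` weakly on every edge, for `f, g ∈ L²(X)`. -/
def HasDerivL2 (f g : Γ.L2) : Prop := ∀ e, IsWeakDeriv (Γ.interval e) (f e) (g e)

/-- `W^{1,2}(X) = ⨁ₑ W^{1,2}(0, l e)` as a subset of `L²(X)`. -/
def W12 : Set Γ.L2 := {f | ∃ g, Γ.HasDerivL2 f g}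

open Classical in
/-- The derivative of `f ∈ W^{1,2}(X)` (zero for other `f`). -/
def derivL2 (f : Γ.L2) : Γ.L2 := if h : ∃ g, Γ.HasDerivL2 f g then h.choose else 0

/-- The vector `f(v)` of the boundary values `f_e(v)`. They are limits of `f_e` along the edge
towards `v`, outside of null sets so as not to depend on the representative of `f_e`; for the
continuous representative of `f_e ∈ W^{1,2}(0, l e)` this is the usual limit. -/
def trace (f : Γ.L2) (v : V) : Γ.BdrySpace v :=
  WithLp.toLp 2 fun h : Γ.Ends v => limUnder (h.1.approach ⊓ ae volume) (f h.1.edge)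

/-- All boundary values of `f` exist. This is the case for every `f ∈ W^{1,2}(X)`. -/
def HasTraces (f : Γ.L2) : Prop :=
  ∀ h : Γ.EdgeEnd, ∃ c : ℂ, Tendsto (f h.edge) (h.approach ⊓ ae volume) (𝓝 c)

/-- `f ∈ L²(X)` has compact support: it vanishes outside a compact subset of `X`. -/
def HasCompactSupp (f : Γ.L2) : Prop :=
  ∃ K : Set Γ.Space, IsCompact K ∧ ∀ e, ∀ᵐ t ∂Γ.vol e, t ∉ Γ.slice K e → f e t = 0

/-! ### Auxiliary facts that make the form domain and the operators linear -/

lemma isOpen_interval (e : E) : IsOpen (Γ.interval e) :=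
  (isOpen_lt continuous_const continuous_id).inter
    (isOpen_lt ENNReal.continuous_ofReal continuous_const)

variable {Γ}

lemma coe_add_ae (f g : Γ.L2) (e : E) :
    ((f + g : Γ.L2) e : ℝ → ℂ) =ᵐ[Γ.vol e] fun t => f e t + g e t := by
  rw [lp.coeFn_add, Pi.add_apply]
  exact Lp.coeFn_add _ _

lemma coe_smul_ae (c : ℂ) (f : Γ.L2) (e : E) :
    ((c • f : Γ.L2) e : ℝ → ℂ) =ᵐ[Γ.vol e] fun t => c * f e t := by
  rw [lp.coeFn_smul, Pi.smul_apply]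
  exact Lp.coeFn_smul _ _

lemma integrable_test (f : Γ.L2) (e : E) {ψ : ℝ → ℝ} (hψ : Continuous ψ)
    (hc : HasCompactSupport ψ) : Integrable (fun t => ψ t • f e t) (Γ.vol e) := by
  have h1 : MemLp ψ 2 (Γ.vol e) := (hψ.memLp_of_hasCompactSupport hc).restrict _
  exact memLp_one_iff_integrable.1 ((Lp.memLp (f e)).smul h1)

lemma HasDerivL2.add {f₁ f₂ g₁ g₂ : Γ.L2} (h₁ : Γ.HasDerivL2 f₁ g₁) (h₂ : Γ.HasDerivL2 f₂ g₂) :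
    Γ.HasDerivL2 (f₁ + f₂) (g₁ + g₂) := by
  intro e ψ hψ hc hs
  have hd : Continuous (deriv ψ) := hψ.continuous_deriv (by simp)
  have e1 : ∫ t in Γ.interval e, deriv ψ t • (f₁ + f₂ : Γ.L2) e t
      = ∫ t in Γ.interval e, (deriv ψ t • f₁ e t + deriv ψ t • f₂ e t) := by
    refine integral_congr_ae ?_
    filter_upwards [coe_add_ae f₁ f₂ e] with t ht
    rw [ht, smul_add]
  have e2 : ∫ t in Γ.interval e, ψ t • (g₁ + g₂ : Γ.L2) e t
      = ∫ t in Γ.interval e, (ψ t • g₁ e t + ψ t • g₂ e t) := by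
    refine integral_congr_ae ?_
    filter_upwards [coe_add_ae g₁ g₂ e] with t ht
    rw [ht, smul_add]
  rw [e1, e2, integral_add (integrable_test _ _ hd hc.deriv) (integrable_test _ _ hd hc.deriv),
    integral_add (integrable_test _ _ hψ.continuous hc) (integrable_test _ _ hψ.continuous hc),
    h₁ e ψ hψ hc hs, h₂ e ψ hψ hc hs]
  ring

lemma HasDerivL2.smul {f g : Γ.L2} (c : ℂ) (h : Γ.HasDerivL2 f g) :
    Γ.HasDerivL2 (c • f) (c • g) := by
  intro e ψ hψ hc hs
  have e1 : ∫ t in Γ.interval e, deriv ψ t • (c • f : Γ.L2) e t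
      = ∫ t in Γ.interval e, c * (deriv ψ t • f e t) := by
    refine integral_congr_ae ?_
    filter_upwards [coe_smul_ae c f e] with t ht
    rw [ht, mul_smul_comm]
  have e2 : ∫ t in Γ.interval e, ψ t • (c • g : Γ.L2) e t
      = ∫ t in Γ.interval e, c * (ψ t • g e t) := by
    refine integral_congr_ae ?_
    filter_upwards [coe_smul_ae c g e] with t ht
    rw [ht, mul_smul_comm]
  rw [e1, e2, integral_const_mul, integral_const_mul, h e ψ hψ hc hs, mul_neg]

lemma HasDerivL2.unique {f g₁ g₂ : Γ.L2} (h₁ : Γ.HasDerivL2 f g₁) (h₂ : Γ.HasDerivL2 f g₂) :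
    g₁ = g₂ := by
  refine lp.ext (funext fun e => Lp.ext ?_)
  have hO := Γ.isOpen_interval e
  have hli : ∀ g : Γ.L2, LocallyIntegrableOn (g e : ℝ → ℂ) (Γ.interval e) volume := fun g =>
    LocallyIntegrableOn.mono_set
      (locallyIntegrableOn_of_locallyIntegrable_restrict
        ((Lp.memLp (g e)).locallyIntegrable (by norm_num))) subset_rfl
  have key := hO.ae_eq_zero_of_integral_contDiff_smul_eq_zero
    (f := fun t => g₁ e t - g₂ e t) ((hli g₁).sub (hli g₂)) ?_
  · rw [Filter.EventuallyEq, ae_restrict_iff' hO.measurableSet]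
    filter_upwards [key] with t ht hmem
    exact sub_eq_zero.mp (ht hmem)
  · intro ψ hψ hc hs
    have hz : ∀ t, t ∉ Γ.interval e → ψ t • (g₁ e t - g₂ e t) = 0 := by
      intro t ht
      rw [image_eq_zero_of_notMem_tsupport (fun h => ht (hs h)), zero_smul]
    rw [← setIntegral_eq_integral_of_forall_compl_eq_zero hz]
    simp only [smul_sub]
    rw [integral_sub (integrable_test _ _ hψ.continuous hc)
      (integrable_test _ _ hψ.continuous hc)]
    have a1 := h₁ e ψ hψ hc hs
    have a2 := h₂ e ψ hψ hc hs
    rw [a1, neg_inj] at a2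
    rw [a2, sub_self]

lemma HasDerivL2.derivL2_eq {f g : Γ.L2} (h : Γ.HasDerivL2 f g) : Γ.derivL2 f = g := by
  have hex : ∃ g, Γ.HasDerivL2 f g := ⟨g, h⟩
  rw [derivL2, dif_pos hex]
  exact hex.choose_spec.unique h

lemma hasDerivL2_derivL2 {f : Γ.L2} (h : f ∈ Γ.W12) : Γ.HasDerivL2 f (Γ.derivL2 f) := by
  obtain ⟨g, hg⟩ := h
  rwa [hg.derivL2_eq]

lemma interval_mem_approach (h : Γ.EdgeEnd) : Γ.interval h.edge ∈ h.approach := by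
  rcases h with e | e
  · have : ∀ᶠ t in 𝓝 (0 : ℝ), ENNReal.ofReal t < Γ.l e := by
      refine ENNReal.continuous_ofReal.continuousAt.eventually_lt continuousAt_const ?_
      simpa using Γ.l_pos e
    filter_upwards [mem_nhdsWithin_of_mem_nhds this, self_mem_nhdsWithin] with t ht h0
    exact ⟨h0, ht⟩
  · have hp : 0 < (Γ.l e).toReal := ENNReal.toReal_pos (Γ.l_pos e).ne' e.2
    have : ∀ᶠ t in 𝓝 (Γ.l e).toReal, 0 < t := lt_mem_nhds hp
    filter_upwards [mem_nhdsWithin_of_mem_nhds this, self_mem_nhdsWithin] with t ht h1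
    exact ⟨ht, (ENNReal.ofReal_lt_iff_lt_toReal ht.le e.2).2 h1⟩

lemma eventually_approach_of_ae {h : Γ.EdgeEnd} {p : ℝ → Prop}
    (hp : ∀ᵐ t ∂Γ.vol h.edge, p t) : ∀ᶠ t in h.approach ⊓ ae volume, p t := by
  rw [ae_restrict_iff' (Γ.isOpen_interval _).measurableSet] at hp
  have h1 : ∀ᶠ t in h.approach ⊓ ae volume, t ∈ Γ.interval h.edge :=
    Filter.mem_inf_of_left (interval_mem_approach h)
  have h2 : ∀ᶠ t in h.approach ⊓ ae volume, t ∈ Γ.interval h.edge → p t :=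
    Filter.mem_inf_of_right hp
  filter_upwards [h1, h2] with t a b using b a

instance approach_neBot (h : Γ.EdgeEnd) : (h.approach ⊓ ae (volume : Measure ℝ)).NeBot := by
  rcases h with e | e
  · change (𝓝[>] (0 : ℝ) ⊓ ae volume).NeBot
    refine Filter.inf_neBot_iff.2 fun {s} hs {s'} hs' => ?_
    obtain ⟨b, hb, hsub⟩ := mem_nhdsGT_iff_exists_Ioo_subset.1 hs
    by_contra hne
    have hsub' : Ioo (0 : ℝ) b ⊆ s'ᶜ := fun t ht h' => hne ⟨t, hsub ht, h'⟩
    have := measure_mono_null hsub' hs'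
    simp only [Real.volume_Ioo, sub_zero, ENNReal.ofReal_eq_zero] at this
    exact absurd hb (not_lt.2 this)
  · change (𝓝[<] (Γ.l e).toReal ⊓ ae volume).NeBot
    refine Filter.inf_neBot_iff.2 fun {s} hs {s'} hs' => ?_
    obtain ⟨b, hb, hsub⟩ := mem_nhdsLT_iff_exists_Ioo_subset.1 hs
    by_contra hne
    have hsub' : Ioo b (Γ.l e).toReal ⊆ s'ᶜ := fun t ht h' => hne ⟨t, hsub ht, h'⟩
    have := measure_mono_null hsub' hs'
    simp only [Real.volume_Ioo, ENNReal.ofReal_eq_zero, sub_nonpos] at this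
    exact absurd hb (not_lt.2 this)

lemma HasTraces.tendsto {f : Γ.L2} (hf : Γ.HasTraces f) (v : V) (h : Γ.Ends v) :
    Tendsto (f h.1.edge) (h.1.approach ⊓ ae volume) (𝓝 (Γ.trace f v h)) :=
  tendsto_nhds_limUnder (hf h.1)

lemma HasTraces.add {f g : Γ.L2} (hf : Γ.HasTraces f) (hg : Γ.HasTraces g) :
    Γ.HasTraces (f + g) := fun h => by
  obtain ⟨a, ha⟩ := hf h
  obtain ⟨b, hb⟩ := hg h
  exact ⟨a + b, (ha.add hb).congr'
    ((eventually_approach_of_ae (coe_add_ae f g h.edge)).mono fun _ ht => ht.symm)⟩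

lemma HasTraces.smul {f : Γ.L2} (c : ℂ) (hf : Γ.HasTraces f) : Γ.HasTraces (c • f) := fun h => by
  obtain ⟨a, ha⟩ := hf h
  exact ⟨c * a, (ha.const_mul c).congr'
    ((eventually_approach_of_ae (coe_smul_ae c f h.edge)).mono fun _ ht => ht.symm)⟩

lemma trace_add {f g : Γ.L2} (hf : Γ.HasTraces f) (hg : Γ.HasTraces g) (v : V) :
    Γ.trace (f + g) v = Γ.trace f v + Γ.trace g v := by
  ext h
  refine tendsto_nhds_unique ((hf.add hg).tendsto v h) ?_
  exact ((hf.tendsto v h).add (hg.tendsto v h)).congr'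
    ((eventually_approach_of_ae (coe_add_ae f g h.1.edge)).mono fun _ ht => ht.symm)

lemma trace_smul {f : Γ.L2} (c : ℂ) (hf : Γ.HasTraces f) (v : V) :
    Γ.trace (c • f) v = c • Γ.trace f v := by
  ext h
  refine tendsto_nhds_unique ((hf.smul c).tendsto v h) ?_
  exact ((hf.tendsto v h).const_mul c).congr'
    ((eventually_approach_of_ae (coe_smul_ae c f h.1.edge)).mono fun _ ht => ht.symm)

variable (Γ)

/-! ### Boundary conditions, the form and the operator -/

section Form

variable [∀ v, Fintype (Γ.Ends v)]

/-- A boundary condition `(L, P)`: self-adjoint operators `L_v` and orthogonal projections `P_v`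
on `ℂ^{E_v}`. -/
structure BoundaryCondition where
  L : ∀ v, Γ.BdrySpace v →L[ℂ] Γ.BdrySpace v
  P : ∀ v, Γ.BdrySpace v →L[ℂ] Γ.BdrySpace v
  isSelfAdjoint_L : ∀ v, IsSelfAdjoint (L v)
  isStarProjection_P : ∀ v, IsStarProjection (P v)

variable {Γ}

namespace BoundaryCondition

variable (B : Γ.BoundaryCondition)

/-- Boundary values `b` and derivatives `b'` (pointing away from the vertex) at `v` satisfy the
boundary condition: `P_v b = 0` and `(1 - P_v) (L_v b + b') = 0`. If `L_v` commutes with `P_v`, the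
second equation is `L_v b + (1 - P_v) b' = 0`. -/
def Holds (v : V) (b b' : Γ.BdrySpace v) : Prop :=
  B.P v b = 0 ∧ (1 - B.P v) (B.L v b + b') = 0

lemma summable_add {A : ∀ v, Γ.BdrySpace v →L[ℂ] Γ.BdrySpace v} (hA : ∀ v, 0 ≤ A v)
    {x y : ∀ v, Γ.BdrySpace v} (hx : Summable fun v => (⟪A v (x v), x v⟫_ℂ).re)
    (hy : Summable fun v => (⟪A v (y v), y v⟫_ℂ).re) :
    Summable fun v => (⟪A v (x v + y v), x v + y v⟫_ℂ).re := by
  have hpos : ∀ v z, 0 ≤ (⟪A v z, z⟫_ℂ).re := fun v z =>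
    ((ContinuousLinearMap.nonneg_iff_isPositive _).1 (hA v)).re_inner_nonneg_left z
  refine Summable.of_nonneg_of_le (fun v => hpos v _) (fun v => ?_)
    ((hx.mul_left 2).add (hy.mul_left 2))
  have h := hpos v (x v - y v)
  simp only [map_add, map_sub, inner_add_left, inner_add_right, inner_sub_left, inner_sub_right,
    Complex.add_re, Complex.sub_re] at h ⊢
  linarith

lemma summable_smul {A : ∀ v, Γ.BdrySpace v →L[ℂ] Γ.BdrySpace v} (c : ℂ)
    {x : ∀ v, Γ.BdrySpace v} (hx : Summable fun v => (⟪A v (x v), x v⟫_ℂ).re) :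
    Summable fun v => (⟪A v (c • x v), c • x v⟫_ℂ).re := by
  refine (hx.mul_left (‖c‖ ^ 2)).congr fun v => ?_
  rw [map_smul, inner_smul_left, inner_smul_right, ← mul_assoc, Complex.conj_mul',
    ← Complex.ofReal_pow, Complex.re_ofReal_mul]

/-- The domain `D(s₀)` of the form: all `f ∈ W^{1,2}(X)` with `P_v f(v) = 0` for all `v` for which
the vertex part `∑_v ⟨L_v f(v), f(v)⟩` of the form converges. If the norms of the positive parts
`L_v⁺` and the inverse edge lengths are bounded, then the first of the two sums is always finite;
so is the second if also the norms of the `L_v⁻` are bounded. -/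
def formDomain : Submodule ℂ Γ.L2 where
  carrier := {f | f ∈ Γ.W12 ∧ Γ.HasTraces f ∧ (∀ v, B.P v (Γ.trace f v) = 0) ∧
    (Summable fun v => (⟪(B.L v)⁺ (Γ.trace f v), Γ.trace f v⟫_ℂ).re) ∧
    (Summable fun v => (⟪(B.L v)⁻ (Γ.trace f v), Γ.trace f v⟫_ℂ).re)}
  add_mem' := by
    rintro f g ⟨⟨f', hf'⟩, htf, hPf, hf1, hf2⟩ ⟨⟨g', hg'⟩, htg, hPg, hg1, hg2⟩
    refine ⟨⟨f' + g', hf'.add hg'⟩, htf.add htg, fun v => ?_, ?_, ?_⟩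
    · rw [trace_add htf htg, map_add, hPf, hPg, add_zero]
    · simp only [trace_add htf htg]
      exact summable_add (A := fun v => (B.L v)⁺) (fun v => CFC.posPart_nonneg _) hf1 hg1
    · simp only [trace_add htf htg]
      exact summable_add (A := fun v => (B.L v)⁻) (fun v => CFC.negPart_nonneg _) hf2 hg2
  zero_mem' := by
    have h0 : Γ.HasTraces 0 := fun h =>
      ⟨0, tendsto_const_nhds.congr' (eventually_approach_of_ae (by
        rw [lp.coeFn_zero, Pi.zero_apply]
        filter_upwards [Lp.coeFn_zero ℂ 2 (Γ.vol h.edge)] with t ht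
        rw [ht]; rfl))⟩
    have ht : ∀ v, Γ.trace (0 : Γ.L2) v = 0 := fun v => by
      have := trace_smul (0 : ℂ) h0 v
      rwa [zero_smul, zero_smul] at this
    refine ⟨⟨0, fun e ψ _ _ _ => ?_⟩, h0, fun v => by rw [ht, map_zero], ?_, ?_⟩
    · have : ((0 : Γ.L2) e : ℝ → ℂ) =ᵐ[Γ.vol e] 0 := by
        rw [lp.coeFn_zero, Pi.zero_apply]
        exact Lp.coeFn_zero _ _ _
      rw [integral_eq_zero_of_ae, integral_eq_zero_of_ae, neg_zero]
      · filter_upwards [this] with t ht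
        rw [ht]; simp
      · filter_upwards [this] with t ht
        rw [ht]; simp
    · simp only [ht, map_zero, inner_zero_left, Complex.zero_re]
      exact summable_zero
    · simp only [ht, map_zero, inner_zero_left, Complex.zero_re]
      exact summable_zero
  smul_mem' := by
    rintro c f ⟨⟨f', hf'⟩, htf, hPf, hf1, hf2⟩
    refine ⟨⟨c • f', hf'.smul c⟩, htf.smul c, fun v => ?_, ?_, ?_⟩
    · rw [trace_smul c htf, map_smul, hPf, smul_zero]
    · simp only [trace_smul c htf]
      exact summable_smul (A := fun v => (B.L v)⁺) c hf1
    · simp only [trace_smul c htf]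
      exact summable_smul (A := fun v => (B.L v)⁻) c hf2

/-- The form `s₀(f, g) = ∑ₑ ∫ fₑ' conj(gₑ') - ∑_v ⟨L_v f(v), g(v)⟩`, linear in `f` (the inner
product `⟪·, ·⟫_ℂ` is linear in its second argument). -/
def form (f g : Γ.L2) : ℂ :=
  ⟪Γ.derivL2 g, Γ.derivL2 f⟫_ℂ - ∑' v, ⟪Γ.trace g v, B.L v (Γ.trace f v)⟫_ℂ

variable {B}

lemma summable_diag {f : Γ.L2} (hf : f ∈ B.formDomain) :
    Summable fun v => ⟪B.L v (Γ.trace f v), Γ.trace f v⟫_ℂ := by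
  obtain ⟨-, -, -, h1, h2⟩ := hf
  have h : Summable fun v => (((⟪(B.L v)⁺ (Γ.trace f v), Γ.trace f v⟫_ℂ).re -
      (⟪(B.L v)⁻ (Γ.trace f v), Γ.trace f v⟫_ℂ).re : ℝ) : ℂ) :=
    Complex.ofRealCLM.summable (h1.sub h2)
  refine h.congr fun v => ?_
  have hs := B.isSelfAdjoint_L v
  have hr := hs.isSymmetric.coe_re_inner_apply_self (Γ.trace f v)
  have hd : B.L v (Γ.trace f v) = (B.L v)⁺ (Γ.trace f v) - (B.L v)⁻ (Γ.trace f v) := by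
    conv_lhs => rw [← CFC.posPart_sub_negPart (B.L v) hs]
    rfl
  rw [← Complex.sub_re, ← inner_sub_left, ← hd]
  exact hr

lemma summable_cross {f g : Γ.L2} (hf : f ∈ B.formDomain) (hg : g ∈ B.formDomain) :
    Summable fun v => ⟪Γ.trace g v, B.L v (Γ.trace f v)⟫_ℂ := by
  have hI := B.formDomain.smul_mem Complex.I hf
  have hm := B.formDomain.smul_mem (-1) hf
  have hmI := B.formDomain.smul_mem (-Complex.I) hf
  have key := fun {k : Γ.L2} (hk : k ∈ B.formDomain) =>
    (summable_diag (B.formDomain.add_mem hg hk))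
  have a1 := key hf
  have a2 := key hm
  have a3 := key hI
  have a4 := key hmI
  have tf := hf.2.1
  have tg := hg.2.1
  simp only [trace_add tg tf, trace_add tg (tf.smul _), trace_smul _ tf] at a1 a2 a3 a4
  have S := (((a1.sub a2).add (a3.mul_left Complex.I)).sub (a4.mul_left Complex.I)).div_const 4
  have S' : Summable fun v => ⟪B.L v (Γ.trace f v), Γ.trace g v⟫_ℂ := by
    refine S.congr fun v => ?_
    have := inner_map_polarization (B.L v : Γ.BdrySpace v →ₗ[ℂ] Γ.BdrySpace v)
      (Γ.trace g v) (Γ.trace f v)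
    simp only [ContinuousLinearMap.coe_coe] at this
    rw [this]
    simp only [neg_smul, one_smul, ← sub_eq_add_neg]
  refine (Complex.conjCLE.summable.2 S').congr fun v => ?_
  simp

lemma form_add {f₁ f₂ g : Γ.L2} (h₁ : f₁ ∈ B.formDomain) (h₂ : f₂ ∈ B.formDomain)
    (hg : g ∈ B.formDomain) : B.form (f₁ + f₂) g = B.form f₁ g + B.form f₂ g := by
  have hd := ((hasDerivL2_derivL2 h₁.1).add (hasDerivL2_derivL2 h₂.1)).derivL2_eq
  simp only [form, hd, inner_add_right, trace_add h₁.2.1 h₂.2.1, map_add]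
  rw [(summable_cross h₁ hg).tsum_add (summable_cross h₂ hg)]
  ring

lemma form_smul {f : Γ.L2} (c : ℂ) (g : Γ.L2) (h : f ∈ B.formDomain) :
    B.form (c • f) g = c * B.form f g := by
  have hd := ((hasDerivL2_derivL2 h.1).smul c).derivL2_eq
  simp only [form, hd, inner_smul_right, trace_smul c h.2.1, map_smul, tsum_mul_left]
  ring

variable (B)

/-- The graph of the operator associated with the form `s₀`: the pairs `(f, h)` with `f ∈ D(s₀)` and
`s₀(f, g) = ⟨h, g⟩` for all `g ∈ D(s₀)`. -/
def opGraph : Submodule ℂ (Γ.L2 × Γ.L2) where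
  carrier := {p | p.1 ∈ B.formDomain ∧ ∀ g ∈ B.formDomain, B.form p.1 g = ⟪g, p.2⟫_ℂ}
  add_mem' := by
    rintro p q ⟨hp, hp'⟩ ⟨hq, hq'⟩
    refine ⟨B.formDomain.add_mem hp hq, fun g hg => ?_⟩
    rw [Prod.fst_add, Prod.snd_add, form_add hp hq hg, inner_add_right, hp' g hg, hq' g hg]
  zero_mem' := by
    refine ⟨B.formDomain.zero_mem, fun g hg => ?_⟩
    have := form_smul (0 : ℂ) g B.formDomain.zero_mem
    rw [zero_smul, zero_mul] at this
    rw [Prod.fst_zero, Prod.snd_zero, this, inner_zero_right]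
  smul_mem' := by
    rintro c p ⟨hp, hp'⟩
    refine ⟨B.formDomain.smul_mem c hp, fun g hg => ?_⟩
    rw [Prod.smul_fst, Prod.smul_snd, form_smul c g hp, inner_smul_right, hp' g hg]

/-- The operator `H₀ = H_{L,P}` associated with the form `s₀`. -/
def H₀ : Γ.L2 →ₗ.[ℂ] Γ.L2 := B.opGraph.toLinearPMap

end BoundaryCondition

end Form

/-! ### Potentials -/

/-- `W` is in `L²_{loc,u}(X)`: its `L²`-norms on all edge segments of length between `u` and `2u` have
a common finite bound. -/
def IsUnifLocL2 (u : ℝ) (W : E → ℝ → ℝ) : Prop :=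
  (∀ e, AEStronglyMeasurable (W e) (Γ.vol e)) ∧
  ∃ M : ℝ, ∀ e, ∀ a b : ℝ, a ∈ Γ.closedInterval e → b ∈ Γ.closedInterval e →
    u ≤ b - a → b - a ≤ 2 * u →
      eLpNorm (W e) 2 (volume.restrict (Icc a b)) ≤ ENNReal.ofReal M

/-- The graph of the maximal operator of multiplication by `W` in `L²(X)`. -/
def mulGraph (W : E → ℝ → ℝ) : Submodule ℂ (Γ.L2 × Γ.L2) where
  carrier := {p | ∀ e, ∀ᵐ t ∂Γ.vol e, p.2 e t = (W e t : ℂ) * p.1 e t}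
  add_mem' := by
    intro p q hp hq e
    filter_upwards [hp e, hq e, coe_add_ae p.1 q.1 e, coe_add_ae p.2 q.2 e] with t h1 h2 h3 h4
    rw [Prod.fst_add, Prod.snd_add, h3, h4, h1, h2, mul_add]
  zero_mem' := by
    intro e
    have : ((0 : Γ.L2) e : ℝ → ℂ) =ᵐ[Γ.vol e] 0 := by
      rw [lp.coeFn_zero, Pi.zero_apply]
      exact Lp.coeFn_zero _ _ _
    filter_upwards [this] with t ht
    rw [Prod.fst_zero, Prod.snd_zero, ht, Pi.zero_apply, mul_zero]
  smul_mem' := by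
    intro c p hp e
    filter_upwards [hp e, coe_smul_ae c p.1 e, coe_smul_ae c p.2 e] with t h1 h2 h3
    rw [Prod.smul_fst, Prod.smul_snd, h2, h3, h1, mul_left_comm]

/-- The maximal operator of multiplication by `W`, with domain `{f ∈ L²(X) : W f ∈ L²(X)}`. -/
def mulOp (W : E → ℝ → ℝ) : Γ.L2 →ₗ.[ℂ] Γ.L2 := (Γ.mulGraph W).toLinearPMap

variable {Γ}

/-- `T` is infinitesimally small with respect to `A`. -/
def InfinitesimallyBounded (T A : Γ.L2 →ₗ.[ℂ] Γ.L2) : Prop :=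
  ∃ hD : A.domain ≤ T.domain, ∀ a : ℝ, 0 < a → ∃ b : ℝ, ∀ f : A.domain,
    ‖T ⟨f, hD f.2⟩‖ ≤ a * ‖A f‖ + b * ‖(f : Γ.L2)‖

/-- The bounded operator `S` is `(A + C)^{-1/2}`: it is positive, and `S²` is the (everywhere defined)
inverse of `A + C`. -/
def IsInvSqrtShift (A : Γ.L2 →ₗ.[ℂ] Γ.L2) (C : ℝ) (S : Γ.L2 →L[ℂ] Γ.L2) : Prop :=
  S.IsPositive ∧ ∀ f g : Γ.L2,
    (f, g) ∈ (A + ((C : ℂ) • LinearMap.id : Γ.L2 →ₗ[ℂ] Γ.L2).toPMap ⊤).graph ↔ f = S (S g)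

/-- For all sufficiently large `C > 0` the operator `(A + C)^{-1/2}` exists and is a continuous map
from `L²(X)` to `L^∞(X)`. -/
def InvSqrtBoundedToLinfty (A : Γ.L2 →ₗ.[ℂ] Γ.L2) : Prop :=
  ∃ C₀ : ℝ, 0 < C₀ ∧ ∀ C : ℝ, C₀ ≤ C → ∃ S : Γ.L2 →L[ℂ] Γ.L2, IsInvSqrtShift A C S ∧
    ∃ M : ℝ, ∀ g : Γ.L2, ∀ e, eLpNorm (S g e) ∞ (Γ.vol e) ≤ ENNReal.ofReal (M * ‖g‖)

/-- The elements of the domain of `A` that have compact support. -/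
def compactDomain (A : Γ.L2 →ₗ.[ℂ] Γ.L2) : Submodule ℂ Γ.L2 where
  carrier := {f | f ∈ A.domain ∧ Γ.HasCompactSupp f}
  add_mem' := by
    rintro f g ⟨hf, K, hK, hfK⟩ ⟨hg, K', hK', hgK⟩
    refine ⟨A.domain.add_mem hf hg, K ∪ K', hK.union hK', fun e => ?_⟩
    filter_upwards [hfK e, hgK e, coe_add_ae f g e] with t h1 h2 h3 h4
    rw [h3, h1 fun ⟨ht, h⟩ => h4 ⟨ht, Or.inl h⟩, h2 fun ⟨ht, h⟩ => h4 ⟨ht, Or.inr h⟩, add_zero]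
  zero_mem' := by
    refine ⟨A.domain.zero_mem, ∅, isCompact_empty, fun e => ?_⟩
    have : ((0 : Γ.L2) e : ℝ → ℂ) =ᵐ[Γ.vol e] 0 := by
      rw [lp.coeFn_zero, Pi.zero_apply]
      exact Lp.coeFn_zero _ _ _
    filter_upwards [this] with t ht _
    rw [ht, Pi.zero_apply]
  smul_mem' := by
    rintro c f ⟨hf, K, hK, hfK⟩
    refine ⟨A.domain.smul_mem c hf, K, hK, fun e => ?_⟩
    filter_upwards [hfK e, coe_smul_ae c f e] with t h1 h2 h3
    rw [h2, h1 h3, mul_zero]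

/-! ### Generalized eigenfunctions -/

variable (Γ)

/-- `φ ∈ L²_loc(X)`: the restrictions of `φ` to compact subsets of `X` are square integrable. -/
def MemL2Loc (φ : E → ℝ → ℂ) : Prop :=
  (∀ e, AEStronglyMeasurable (φ e) (Γ.vol e)) ∧
  ∀ K : Set Γ.Space, IsCompact K → ∑' e, ∫⁻ t in Γ.slice K e, ‖φ e t‖ₑ ^ 2 < ∞

/-- The pairing `⟨f, φ⟩ = ∫_X f conj(φ)` of a compactly supported `f ∈ L²(X)` and `φ ∈ L²_loc(X)`. -/
def pairing (f : Γ.L2) (φ : E → ℝ → ℂ) : ℂ :=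
  ∑' e, ∫ t in Γ.interval e, f e t * conj (φ e t)

variable {Γ} in
/-- `φ` is a generalized eigenfunction of the operator `A` corresponding to `lam`. -/
def IsGeneralizedEigenfunction (A : Γ.L2 →ₗ.[ℂ] Γ.L2) (lam : ℂ) (φ : E → ℝ → ℂ) : Prop :=
  Γ.MemL2Loc φ ∧ (¬ ∀ e, φ e =ᵐ[Γ.vol e] 0) ∧
  ∀ f : A.domain, Γ.HasCompactSupp (f : Γ.L2) → Γ.pairing (A f) φ = lam * Γ.pairing f φ

/-- `f ∈ W^{2,2}(a, b)`. -/
def MemW22 (a b : ℝ) (f : ℝ → ℂ) : Prop :=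
  ∃ f' f'' : ℝ → ℂ, MemLp f 2 (volume.restrict (Ioo a b)) ∧
    MemLp f' 2 (volume.restrict (Ioo a b)) ∧ MemLp f'' 2 (volume.restrict (Ioo a b)) ∧
    IsWeakDeriv (Ioo a b) f f' ∧ IsWeakDeriv (Ioo a b) f' f''

/-- `φ` is locally in `W^{2,2}`: its restriction to every compact edge segment is in `W^{2,2}`. -/
def LocallyW22 (φ : E → ℝ → ℂ) : Prop :=
  ∀ e, ∀ a b : ℝ, a ∈ Γ.closedInterval e → b ∈ Γ.closedInterval e → a < b → MemW22 a b (φ e)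

variable {Γ}

/-- The function `φ`, continuously differentiable on the open edges, has boundary values `φ(v)` and
`φ'(v)` at `v` that satisfy the boundary condition. -/
def BoundaryCondition.SatisfiedBy [∀ v, Fintype (Γ.Ends v)] (B : Γ.BoundaryCondition)
    (φ : E → ℝ → ℂ) (v : V) : Prop :=
  ∃ b b' : Γ.BdrySpace v,
    (∀ h : Γ.Ends v, Tendsto (φ h.1.edge) h.1.approach (𝓝 (b h))) ∧
    (∀ h : Γ.Ends v,
      Tendsto (fun t => h.1.sign * deriv (φ h.1.edge) t) h.1.approach (𝓝 (b' h))) ∧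
    B.Holds v b b'

end

end MetricGraph

namespace MetricGraph

/-! ### Primitives on intervals -/

/-- `F` is a primitive of `f` on the set `s`, in the sense of the Lebesgue integral. -/
def IsPrimitiveOn (s : Set ℝ) (F f : ℝ → ℂ) : Prop :=
  ∀ a ∈ s, ∀ b ∈ s, IntervalIntegrable f volume a b ∧ F b - F a = ∫ t in a..b, f t

namespace IsPrimitiveOn

variable {s : Set ℝ} {F f G g : ℝ → ℂ} {a b : ℝ}

lemma intervalIntegrable (h : IsPrimitiveOn s F f) (ha : a ∈ s) (hb : b ∈ s) :
    IntervalIntegrable f volume a b := (h a ha b hb).1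

lemma sub_eq (h : IsPrimitiveOn s F f) (ha : a ∈ s) (hb : b ∈ s) :
    F b - F a = ∫ t in a..b, f t := (h a ha b hb).2

lemma mono {t : Set ℝ} (h : IsPrimitiveOn s F f) (ht : t ⊆ s) : IsPrimitiveOn t F f :=
  fun a ha b hb => h a (ht ha) b (ht hb)

lemma norm_sub_le (h : IsPrimitiveOn s F f) (ha : a ∈ s) (hb : b ∈ s) :
    ‖F b - F a‖ ≤ |∫ t in a..b, ‖f t‖| := by
  rw [h.sub_eq ha hb]
  exact intervalIntegral.norm_integral_le_abs_integral_norm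

lemma absolutelyContinuousOnInterval (h : IsPrimitiveOn (uIcc a b) F f) :
    AbsolutelyContinuousOnInterval F a b := by
  have hi := (h.intervalIntegrable left_mem_uIcc right_mem_uIcc).norm
  have hac := hi.absolutelyContinuousOnInterval_intervalIntegral (c := a) left_mem_uIcc
  rw [absolutelyContinuousOnInterval_iff] at hac ⊢
  intro ε hε
  obtain ⟨δ, hδ, H⟩ := hac ε hε
  refine ⟨δ, hδ, fun I hI hI' => lt_of_le_of_lt (Finset.sum_le_sum fun i hi => ?_) (H I hI hI')⟩
  have hmem := hI.1 i hi
  have h1 := hmem.1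
  have h2 := hmem.2
  have i1 := (h.intervalIntegrable left_mem_uIcc h1).norm
  have i2 := (h.intervalIntegrable left_mem_uIcc h2).norm
  rw [dist_eq_norm, Real.dist_eq, intervalIntegral.integral_interval_sub_left i1 i2]
  exact h.norm_sub_le h2 h1

lemma continuousOn_uIcc (h : IsPrimitiveOn (uIcc a b) F f) : ContinuousOn F (uIcc a b) :=
  h.absolutelyContinuousOnInterval.continuousOn

lemma continuousOn [hs : s.OrdConnected] (h : IsPrimitiveOn s F f) : ContinuousOn F s := by
  intro x hx
  have hcov : s = (s ∩ Iic x) ∪ (s ∩ Ici x) := by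
    rw [← inter_union_distrib_left, Iic_union_Ici, inter_univ]
  rw [hcov]
  refine ContinuousWithinAt.union ?_ ?_
  · by_cases hy : ∃ y ∈ s, y < x
    · obtain ⟨y, hy, hyx⟩ := hy
      have hc := (h.mono (hs.uIcc_subset hy hx)).continuousOn_uIcc x right_mem_uIcc
      refine hc.mono_of_mem_nhdsWithin ?_
      rw [uIcc_of_le hyx.le]
      refine mem_nhdsWithin.2 ⟨Ioi y, isOpen_Ioi, hyx, ?_⟩
      rintro z ⟨hz, -, hz'⟩
      exact ⟨(le_of_lt hz), hz'⟩
    · push Not at hy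
      have : s ∩ Iic x ⊆ {x} := fun z hz => le_antisymm hz.2 (hy z hz.1)
      exact continuousWithinAt_singleton.mono this
  · by_cases hy : ∃ y ∈ s, x < y
    · obtain ⟨y, hy, hyx⟩ := hy
      have hc := (h.mono (hs.uIcc_subset hx hy)).continuousOn_uIcc x left_mem_uIcc
      refine hc.mono_of_mem_nhdsWithin ?_
      rw [uIcc_of_le hyx.le]
      refine mem_nhdsWithin.2 ⟨Iio y, isOpen_Iio, hyx, ?_⟩
      rintro z ⟨hz, -, hz'⟩
      exact ⟨hz', (le_of_lt hz)⟩
    · push Not at hy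
      have : s ∩ Ici x ⊆ {x} := fun z hz => le_antisymm (hy z hz.1) hz.2
      exact continuousWithinAt_singleton.mono this

lemma ae_hasDerivAt (h : IsPrimitiveOn (uIcc a b) F f) :
    ∀ᵐ x, x ∈ uIoo a b → HasDerivAt F (f x) x := by
  have hi := h.intervalIntegrable left_mem_uIcc right_mem_uIcc
  filter_upwards [hi.ae_hasDerivAt_integral] with x hx hx'
  have h1 := hx (Ioo_subset_Icc_self hx') a left_mem_uIcc
  have h2 : HasDerivAt (fun y => F a + ∫ t in a..y, f t) (f x) x := h1.const_add _
  refine h2.congr_of_eventuallyEq ?_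
  filter_upwards [isOpen_Ioo.mem_nhds hx'] with y hy
  rw [← h.sub_eq left_mem_uIcc (Ioo_subset_Icc_self hy)]
  ring

lemma of_intervalIntegrable (hf : ∀ a ∈ s, ∀ b ∈ s, IntervalIntegrable f volume a b) {t₀ : ℝ}
    (h0 : t₀ ∈ s) (c : ℂ) : IsPrimitiveOn s (fun t => c + ∫ x in t₀..t, f x) f := by
  intro a ha b hb
  refine ⟨hf a ha b hb, ?_⟩
  rw [add_sub_add_left_eq_sub,
    intervalIntegral.integral_interval_sub_left (hf _ h0 _ hb) (hf _ h0 _ ha)]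

lemma mul [hs : s.OrdConnected] (hF : IsPrimitiveOn s F f) (hG : IsPrimitiveOn s G g) :
    IsPrimitiveOn s (fun t => F t * G t) (fun t => f t * G t + F t * g t) := by
  intro a ha b hb
  have hsub := hs.uIcc_subset ha hb
  replace hF := hF.mono hsub
  replace hG := hG.mono hsub
  have hint : ∀ x ∈ uIcc a b, ∀ y ∈ uIcc a b,
      IntervalIntegrable (fun t => f t * G t + F t * g t) volume x y := by
    intro x hx y hy
    have hxy : uIcc x y ⊆ uIcc a b := uIcc_subset_uIcc hx hy
    exact ((hF.intervalIntegrable hx hy).mul_continuousOn (hG.continuousOn_uIcc.mono hxy)).add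
      ((hG.intervalIntegrable hx hy).continuousOn_mul (hF.continuousOn_uIcc.mono hxy))
  have hI := of_intervalIntegrable hint left_mem_uIcc 0
  refine ⟨hint a left_mem_uIcc b right_mem_uIcc, ?_⟩
  have hac : AbsolutelyContinuousOnInterval
      (fun x => F x * G x - (0 + ∫ t in a..x, f t * G t + F t * g t)) a b :=
    ((hF.absolutelyContinuousOnInterval).fun_smul hG.absolutelyContinuousOnInterval).fun_sub
      hI.absolutelyContinuousOnInterval
  have hne : ∀ᵐ x : ℝ, x ≠ min a b ∧ x ≠ max a b := by
    have h1 := Measure.ae_ne (volume : Measure ℝ) (min a b)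
    have h2 := Measure.ae_ne (volume : Measure ℝ) (max a b)
    filter_upwards [h1, h2] with x h1 h2 using ⟨h1, h2⟩
  obtain ⟨C, hC⟩ := hac.const_of_ae_hasDerivAt_zero (by
    filter_upwards [hF.ae_hasDerivAt, hG.ae_hasDerivAt, hI.ae_hasDerivAt, hne] with x h1 h2 h3 h4 h5
    have hx : x ∈ uIoo a b := ⟨lt_of_le_of_ne h5.1 (Ne.symm h4.1), lt_of_le_of_ne h5.2 h4.2⟩
    have := ((h1 hx).mul (h2 hx)).sub (h3 hx)
    rwa [sub_self] at this)
  have h1 := hC a left_mem_uIcc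
  have h2 := hC b right_mem_uIcc
  rw [← h1] at h2
  simp only [intervalIntegral.integral_same, zero_add, sub_zero] at h2
  change F b * G b - F a * G a = _
  rw [← h2]; ring

lemma star (h : IsPrimitiveOn s F f) :
    IsPrimitiveOn s (fun t => conj (F t)) (fun t => conj (f t)) := by
  intro a ha b hb
  have hi := h.intervalIntegrable ha hb
  refine ⟨⟨?_, ?_⟩, ?_⟩
  · exact Complex.conjLIE.toContinuousLinearEquiv.toContinuousLinearMap.integrable_comp hi.1
  · exact Complex.conjLIE.toContinuousLinearEquiv.toContinuousLinearMap.integrable_comp hi.2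
  · rw [← map_sub, h.sub_eq ha hb, intervalIntegral, intervalIntegral, map_sub, integral_conj,
      integral_conj]

lemma of_contDiff {p : ℝ → ℂ} (hp : ContDiff ℝ 1 p) : IsPrimitiveOn s p (deriv p) := by
  intro a _ b _
  have hc : Continuous (deriv p) := hp.continuous_deriv le_rfl
  exact ⟨hc.intervalIntegrable _ _,
    (intervalIntegral.integral_eq_sub_of_hasDerivAt
      (fun x _ => (hp.differentiable one_ne_zero x).hasDerivAt) (hc.intervalIntegrable _ _)).symm⟩

lemma congr_deriv (h : IsPrimitiveOn s F f)
    (hg : ∀ a ∈ s, ∀ b ∈ s, ∀ᵐ t, t ∈ uIoc a b → f t = g t) : IsPrimitiveOn s F g := by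
  intro a ha b hb
  have hi := h.intervalIntegrable ha hb
  refine ⟨hi.congr_ae ?_, ?_⟩
  · exact (ae_restrict_iff' measurableSet_uIoc).2 (hg a ha b hb)
  · rw [h.sub_eq ha hb]
    exact intervalIntegral.integral_congr_ae (hg a ha b hb)

end IsPrimitiveOn

end MetricGraph

namespace MetricGraph

/-! ### Test functions and weak derivatives -/

/-- `ψ` is a smooth function with compact support in `U`. -/
structure IsTest (U : Set ℝ) (ψ : ℝ → ℝ) : Prop where
  contDiff : ContDiff ℝ (⊤ : ℕ∞) ψ
  hasCompactSupport : HasCompactSupport ψ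
  tsupport_subset : tsupport ψ ⊆ U

namespace IsTest

variable {U : Set ℝ} {ψ χ : ℝ → ℝ}

lemma continuous (h : IsTest U ψ) : Continuous ψ := h.contDiff.continuous

lemma differentiable (h : IsTest U ψ) : Differentiable ℝ ψ := h.contDiff.differentiable (by simp)

lemma deriv (h : IsTest U ψ) : IsTest U (deriv ψ) :=
  ⟨ContDiff.deriv' (h.contDiff.of_le (by simp)), h.hasCompactSupport.deriv,
    (tsupport_deriv_subset).trans h.tsupport_subset⟩

lemma smul (c : ℝ) (h : IsTest U ψ) : IsTest U (fun t => c * ψ t) :=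
  ⟨contDiff_const.mul h.contDiff, h.hasCompactSupport.mul_left,
    (tsupport_mul_subset_right).trans h.tsupport_subset⟩

lemma sub (hψ : IsTest U ψ) (hχ : IsTest U χ) : IsTest U (fun t => ψ t - χ t) :=
  ⟨hψ.contDiff.sub hχ.contDiff, hψ.hasCompactSupport.sub hχ.hasCompactSupport,
    (tsupport_sub _ _).trans (union_subset hψ.tsupport_subset hχ.tsupport_subset)⟩

lemma eq_zero (h : IsTest U ψ) {t : ℝ} (ht : t ∉ U) : ψ t = 0 :=
  image_eq_zero_of_notMem_tsupport fun hmem => ht (h.tsupport_subset hmem)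

/-- The support of a test function on an open interval lies in a compact subinterval. -/
lemma exists_Ioo (h : IsTest U ψ) (hU : IsOpen U) (hne : U.Nonempty) :
    ∃ a ∈ U, ∃ b ∈ U, a < b ∧ tsupport ψ ⊆ Ioo a b := by
  have hK : IsCompact (tsupport ψ) := h.hasCompactSupport
  rcases (tsupport ψ).eq_empty_or_nonempty with h0 | h0
  · obtain ⟨x, hx⟩ := hne
    obtain ⟨ε, hε, hb⟩ := Metric.isOpen_iff.1 hU x hx
    refine ⟨x, hx, x + ε / 2, hb ?_, by linarith, ?_⟩
    · rw [Metric.mem_ball, Real.dist_eq, add_sub_cancel_left, abs_of_pos] <;> linarith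
    · rw [h0]; exact empty_subset _
  · obtain ⟨x, hx, hxm⟩ := hK.exists_isLeast h0
    obtain ⟨y, hy, hym⟩ := hK.exists_isGreatest h0
    obtain ⟨ε, hε, hb⟩ := Metric.isOpen_iff.1 hU x (h.tsupport_subset hx)
    obtain ⟨δ, hδ, hb'⟩ := Metric.isOpen_iff.1 hU y (h.tsupport_subset hy)
    have hxy := hxm hy
    refine ⟨x - ε / 2, hb ?_, y + δ / 2, hb' ?_, by linarith, fun t h' => ⟨?_, ?_⟩⟩
    · rw [Metric.mem_ball, Real.dist_eq, sub_sub_cancel_left, abs_neg, abs_of_pos] <;> linarith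
    · rw [Metric.mem_ball, Real.dist_eq, add_sub_cancel_left, abs_of_pos] <;> linarith
    · linarith [hxm h']
    · linarith [hym h']

lemma integrable_smul (h : IsTest U ψ) {f : ℝ → ℂ} (hf : LocallyIntegrableOn f U) :
    IntegrableOn (fun t => ψ t • f t) U := by
  have hK : IsCompact (tsupport ψ) := h.hasCompactSupport
  have h1 : IntegrableOn (fun t => ψ t • f t) (tsupport ψ) :=
    (hf.integrableOn_compact_subset h.tsupport_subset hK).continuousOn_smul
      h.continuous.continuousOn hK
  have h2 : Integrable (fun t => ψ t • f t) :=
    (integrableOn_iff_integrable_of_support_subset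
      ((Function.support_smul_subset_left _ _).trans (subset_tsupport ψ))).1 h1
  exact h2.integrableOn

/-- A test function with vanishing integral is the derivative of a test function. -/
lemma exists_primitive (h : IsTest U ψ) (hU : IsOpen U) [hc : U.OrdConnected] (hne : U.Nonempty)
    (h0 : ∫ t, ψ t = 0) : ∃ χ, IsTest U χ ∧ _root_.deriv χ = ψ := by
  obtain ⟨a, ha, b, hb, hab, hsub⟩ := h.exists_Ioo hU hne
  have hz : ∀ t, t ∉ Ioo a b → ψ t = 0 := fun t ht =>
    image_eq_zero_of_notMem_tsupport fun h' => ht (hsub h')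
  have hd : ∀ x, HasDerivAt (fun x => ∫ t in a..x, ψ t) (ψ x) x := fun x =>
    intervalIntegral.integral_hasDerivAt_right (h.continuous.intervalIntegrable _ _)
      (h.continuous.stronglyMeasurableAtFilter _ _) h.continuous.continuousAt
  have hder : _root_.deriv (fun x => ∫ t in a..x, ψ t) = ψ := funext fun x => (hd x).deriv
  have hsupp : Function.support (fun x => ∫ t in a..x, ψ t) ⊆ Icc a b := by
    intro x hx
    by_contra hx'
    apply hx
    rcases lt_or_ge x a with h1 | h1
    · change ∫ t in a..x, ψ t = 0
      rw [intervalIntegral.integral_symm, neg_eq_zero]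
      refine intervalIntegral.integral_zero_ae (Eventually.of_forall fun t ht => hz t ?_)
      rw [uIoc_of_le h1.le] at ht
      exact fun h' => absurd h'.1 (not_lt.2 ht.2)
    · have h2 : b < x := by
        by_contra h2
        exact hx' ⟨h1, not_lt.1 h2⟩
      change ∫ t in a..x, ψ t = 0
      rw [intervalIntegral.integral_of_le h1,
        setIntegral_eq_integral_of_forall_compl_eq_zero, h0]
      intro t ht
      exact hz t fun h' => ht ⟨h'.1, (h'.2.trans h2).le⟩
  refine ⟨fun x => ∫ t in a..x, ψ t, ⟨?_, ?_, ?_⟩, hder⟩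
  · refine contDiff_infty_iff_deriv.2 ⟨fun x => (hd x).differentiableAt, ?_⟩
    rw [hder]; exact h.contDiff
  · exact HasCompactSupport.of_support_subset_isCompact isCompact_Icc hsupp
  · exact (closure_minimal hsupp isClosed_Icc).trans (hc.out ha hb)

lemma exists_integral_one (hU : IsOpen U) (hne : U.Nonempty) :
    ∃ ψ, IsTest U ψ ∧ ∫ t, ψ t = 1 := by
  obtain ⟨x, hx⟩ := hne
  obtain ⟨ε, hε, hb⟩ := Metric.isOpen_iff.1 hU x hx
  let φ : ContDiffBump x := ⟨ε / 4, ε / 2, by linarith, by linarith⟩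
  refine ⟨φ.normed volume, ⟨φ.contDiff_normed, φ.hasCompactSupport_normed, ?_⟩,
    φ.integral_normed⟩
  rw [φ.tsupport_normed_eq]
  exact (Metric.closedBall_subset_ball (by change ε / 2 < ε; linarith)).trans hb

/-- A linear functional on test functions on an interval that annihilates derivatives is a multiple of
the integral. -/
lemma exists_eq_integral_mul (hU : IsOpen U) [hc : U.OrdConnected] (hne : U.Nonempty)
    (D : (ℝ → ℝ) → ℂ) (hsub : ∀ ψ χ, IsTest U ψ → IsTest U χ → D (fun t => ψ t - χ t) = D ψ - D χ)
    (hsmul : ∀ (c : ℝ) ψ, IsTest U ψ → D (fun t => c * ψ t) = c * D ψ)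
    (hD : ∀ ψ, IsTest U ψ → D (_root_.deriv ψ) = 0) :
    ∃ c : ℂ, ∀ ψ, IsTest U ψ → D ψ = (∫ t, ψ t : ℝ) * c := by
  obtain ⟨ψ₀, h₀, h₁⟩ := exists_integral_one hU hne
  refine ⟨D ψ₀, fun ψ hψ => ?_⟩
  have ht := hψ.sub (h₀.smul (∫ t, ψ t))
  obtain ⟨χ, hχ, he⟩ := ht.exists_primitive hU hne (by
    rw [integral_sub (hψ.continuous.integrable_of_hasCompactSupport hψ.hasCompactSupport)
      ((h₀.smul _).continuous.integrable_of_hasCompactSupport (h₀.smul _).hasCompactSupport),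
      integral_const_mul, h₁, mul_one, sub_self])
  have := hD χ hχ
  rw [he, hsub _ _ hψ (h₀.smul _), hsmul _ _ h₀] at this
  exact sub_eq_zero.1 this

end IsTest

lemma isWeakDeriv_iff {U : Set ℝ} {f g : ℝ → ℂ} : IsWeakDeriv U f g ↔
    ∀ ψ, IsTest U ψ → ∫ t in U, deriv ψ t • f t = -∫ t in U, ψ t • g t :=
  ⟨fun h ψ hψ => h ψ hψ.1 hψ.2 hψ.3, fun h ψ h1 h2 h3 => h ψ ⟨h1, h2, h3⟩⟩

section

variable {U : Set ℝ} {f g F : ℝ → ℂ}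

lemma locallyIntegrableOn_of_intervalIntegrable (hU : IsOpen U)
    (h : ∀ a ∈ U, ∀ b ∈ U, IntervalIntegrable f volume a b) : LocallyIntegrableOn f U := by
  intro x hx
  obtain ⟨ε, hε, hb⟩ := Metric.isOpen_iff.1 hU x hx
  have h1 : x - ε / 2 ∈ U := hb (by
    rw [Metric.mem_ball, Real.dist_eq, sub_sub_cancel_left, abs_neg, abs_of_pos] <;> linarith)
  have h2 : x + ε / 2 ∈ U := hb (by
    rw [Metric.mem_ball, Real.dist_eq, add_sub_cancel_left, abs_of_pos] <;> linarith)
  refine ⟨Ioc (x - ε / 2) (x + ε / 2), mem_nhdsWithin_of_mem_nhds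
    (Ioc_mem_nhds (by linarith) (by linarith)), (h _ h1 _ h2).1⟩

lemma IsPrimitiveOn.isWeakDeriv (hU : IsOpen U) [hc : U.OrdConnected] (h : IsPrimitiveOn U F f) :
    IsWeakDeriv U F f := by
  rw [isWeakDeriv_iff]
  intro ψ hψ
  rcases U.eq_empty_or_nonempty with rfl | hne
  · simp
  obtain ⟨a, ha, b, hb, hab, hsupp⟩ := hψ.exists_Ioo hU hne
  have hz : ∀ t, t ∉ Ioo a b → ψ t = 0 := fun t ht =>
    image_eq_zero_of_notMem_tsupport fun h' => ht (hsupp h')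
  have hp : IsPrimitiveOn U (fun t => (ψ t : ℂ)) (fun t => ((deriv ψ t : ℝ) : ℂ)) := by
    have hd : ContDiff ℝ 1 (fun t => (ψ t : ℂ)) :=
      Complex.ofRealCLM.contDiff.comp (hψ.contDiff.of_le (by simp))
    have := IsPrimitiveOn.of_contDiff (s := U) hd
    have he : deriv (fun t => (ψ t : ℂ)) = fun t => ((deriv ψ t : ℝ) : ℂ) :=
      funext fun t => ((hψ.differentiable t).hasDerivAt.ofReal_comp).deriv
    rwa [he] at this
  have key := (hp.mul h).sub_eq ha hb
  have z1 : ψ a = 0 := hz a (by simp)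
  have z2 : ψ b = 0 := hz b (by simp)
  have hdz : ∀ t, t ∉ Ioc a b → deriv ψ t = 0 := fun t ht =>
    image_eq_zero_of_notMem_tsupport
      fun h' => ht (Ioo_subset_Ioc_self (hsupp (tsupport_deriv_subset h')))
  have hli : LocallyIntegrableOn f U :=
    locallyIntegrableOn_of_intervalIntegrable hU fun a ha b hb => h.intervalIntegrable ha hb
  have hlF : LocallyIntegrableOn F U := h.continuousOn.locallyIntegrableOn hU.measurableSet
  have hsub : Ioc a b ⊆ U := Ioc_subset_Icc_self.trans (hc.out ha hb)
  have e1 : ∫ t in U, deriv ψ t • F t = ∫ t in Ioc a b, deriv ψ t • F t := by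
    refine (setIntegral_eq_of_subset_of_forall_sdiff_eq_zero hU.measurableSet hsub ?_)
    intro t ht
    rw [hdz t ht.2, zero_smul]
  have e2 : ∫ t in U, ψ t • f t = ∫ t in Ioc a b, ψ t • f t := by
    refine (setIntegral_eq_of_subset_of_forall_sdiff_eq_zero hU.measurableSet hsub ?_)
    intro t ht
    rw [hz t fun h' => ht.2 (Ioo_subset_Ioc_self h'), zero_smul]
  have i1 := (hψ.deriv.integrable_smul hlF).mono_set hsub
  have i2 := (hψ.integrable_smul hli).mono_set hsub
  rw [e1, e2, eq_neg_iff_add_eq_zero, ← integral_add i1 i2]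
  simp only [z1, z2, intervalIntegral.integral_of_le hab.le] at key
  simpa [Complex.real_smul] using key.symm

/-- A locally integrable function on an interval whose weak derivative vanishes is constant. -/
lemma exists_ae_eq_const_of_isWeakDeriv_zero (hU : IsOpen U) [hc : U.OrdConnected]
    (hne : U.Nonempty) (hf : LocallyIntegrableOn f U) (h : IsWeakDeriv U f 0) :
    ∃ c, f =ᵐ[volume.restrict U] fun _ => c := by
  rw [isWeakDeriv_iff] at h
  obtain ⟨c, hD⟩ := IsTest.exists_eq_integral_mul hU hne (fun ψ => ∫ t in U, ψ t • f t)
    (fun ψ χ hψ hχ => by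
      simp only [sub_smul]
      exact integral_sub (hψ.integrable_smul hf) (hχ.integrable_smul hf))
    (fun c ψ hψ => by
      simp only [mul_smul]
      rw [integral_smul, Complex.real_smul])
    (fun ψ hψ => by simpa using h ψ hψ)
  refine ⟨c, ?_⟩
  have key := hU.ae_eq_zero_of_integral_contDiff_smul_eq_zero
    (f := fun t => f t - c) (hf.sub (locallyIntegrableOn_const c)) ?_
  · rw [Filter.EventuallyEq, ae_restrict_iff' hU.measurableSet]
    filter_upwards [key] with t ht hmem
    exact sub_eq_zero.mp (ht hmem)
  · intro ψ h1 h2 h3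
    have hψ : IsTest U ψ := ⟨h1, h2, h3⟩
    have hz : ∀ t, t ∉ U → ψ t • (f t - c) = 0 := fun t ht => by
      rw [hψ.eq_zero ht, zero_smul]
    rw [← setIntegral_eq_integral_of_forall_compl_eq_zero hz]
    simp only [smul_sub]
    rw [integral_sub (hψ.integrable_smul hf)
      (hψ.integrable_smul (locallyIntegrableOn_const c)), hD ψ hψ]
    rw [integral_smul_const, setIntegral_eq_integral_of_forall_compl_eq_zero
      (fun t ht => hψ.eq_zero ht), Complex.real_smul, sub_self]

/-- A function with a weak derivative `g` on an open interval agrees almost everywhere with a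
primitive of `g`, also up to the boundary. -/
lemma IsWeakDeriv.exists_isPrimitiveOn (hU : IsOpen U) [hc : U.OrdConnected] (hne : U.Nonempty)
    {s : Set ℝ} (hs : U ⊆ s) (hf : LocallyIntegrableOn f U)
    (hg : ∀ a ∈ s, ∀ b ∈ s, IntervalIntegrable g volume a b) (h : IsWeakDeriv U f g) :
    ∃ F, IsPrimitiveOn s F g ∧ f =ᵐ[volume.restrict U] F := by
  obtain ⟨t₀, ht₀⟩ := hne
  have hP := IsPrimitiveOn.of_intervalIntegrable hg (hs ht₀) 0
  have hw := (hP.mono hs).isWeakDeriv hU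
  have hlG : LocallyIntegrableOn (fun t => 0 + ∫ x in t₀..t, g x) U :=
    (hP.mono hs).continuousOn.locallyIntegrableOn hU.measurableSet
  obtain ⟨c, hcc⟩ := exists_ae_eq_const_of_isWeakDeriv_zero hU ⟨t₀, ht₀⟩ (hf.sub hlG) (by
    rw [isWeakDeriv_iff] at h hw ⊢
    intro ψ hψ
    simp only [Pi.sub_apply, smul_sub, Pi.zero_apply, smul_zero, integral_zero, neg_zero]
    rw [integral_sub (hψ.deriv.integrable_smul hf) (hψ.deriv.integrable_smul hlG), h ψ hψ,
      hw ψ hψ, sub_self])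
  refine ⟨_, IsPrimitiveOn.of_intervalIntegrable hg (hs ht₀) c, ?_⟩
  filter_upwards [hcc] with t ht
  rw [Pi.sub_apply, zero_add] at ht
  rw [← ht, sub_add_cancel]

/-- If the second distributional derivative of `f` on an open interval is `q`, then `f` agrees almost
everywhere with an iterated primitive of `q`, also up to the boundary. -/
lemma exists_isPrimitiveOn_of_second_deriv (hU : IsOpen U) [hc : U.OrdConnected]
    (hne : U.Nonempty) {s : Set ℝ} [hsc : s.OrdConnected] (hs : U ⊆ s)
    (hf : LocallyIntegrableOn f U) {q : ℝ → ℂ}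
    (hq : ∀ a ∈ s, ∀ b ∈ s, IntervalIntegrable q volume a b)
    (h : ∀ ψ, IsTest U ψ → ∫ t in U, deriv (deriv ψ) t • f t = ∫ t in U, ψ t • q t) :
    ∃ F F', IsPrimitiveOn s F F' ∧ IsPrimitiveOn s F' q ∧ f =ᵐ[volume.restrict U] F := by
  obtain ⟨t₀, ht₀⟩ := hne
  have hP := IsPrimitiveOn.of_intervalIntegrable hq (hs ht₀) 0
  set Q : ℝ → ℂ := fun t => 0 + ∫ x in t₀..t, q x
  have hw := isWeakDeriv_iff.1 ((hP.mono hs).isWeakDeriv hU)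
  have hlQ : LocallyIntegrableOn Q U :=
    (hP.mono hs).continuousOn.locallyIntegrableOn hU.measurableSet
  obtain ⟨c, hD⟩ := IsTest.exists_eq_integral_mul hU ⟨t₀, ht₀⟩
    (fun ψ => (∫ t in U, deriv ψ t • f t) + ∫ t in U, ψ t • Q t)
    (fun ψ χ hψ hχ => by
      have hd : deriv (fun t => ψ t - χ t) = fun t => deriv ψ t - deriv χ t := funext fun t =>
        deriv_fun_sub (hψ.differentiable t) (hχ.differentiable t)
      simp only [hd, sub_smul]
      rw [integral_sub (hψ.deriv.integrable_smul hf) (hχ.deriv.integrable_smul hf),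
        integral_sub (hψ.integrable_smul hlQ) (hχ.integrable_smul hlQ)]
      ring)
    (fun c ψ hψ => by
      have hd : deriv (fun t => c * ψ t) = fun t => c * deriv ψ t := funext fun t =>
        deriv_const_mul c (hψ.differentiable t)
      simp only [hd, mul_smul]
      rw [integral_smul, integral_smul, Complex.real_smul, Complex.real_smul, mul_add])
    (fun ψ hψ => by
      rw [h ψ hψ, hw ψ hψ, add_neg_cancel])
  have hP' := IsPrimitiveOn.of_intervalIntegrable hq (hs ht₀) (-c)
  have hlP' : LocallyIntegrableOn (fun t => -c + ∫ x in t₀..t, q x) U :=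
    (hP'.mono hs).continuousOn.locallyIntegrableOn hU.measurableSet
  have hw' : IsWeakDeriv U f (fun t => -c + ∫ x in t₀..t, q x) := by
    rw [isWeakDeriv_iff]
    intro ψ hψ
    have h1 := hD ψ hψ
    have h2 : ∫ t in U, ψ t • (-c + ∫ x in t₀..t, q x)
        = (∫ t in U, ψ t • Q t) - (∫ t, ψ t : ℝ) * c := by
      rw [← Complex.real_smul, ← setIntegral_eq_integral_of_forall_compl_eq_zero
        (fun t ht => hψ.eq_zero ht), ← integral_smul_const, ← integral_sub
        (hψ.integrable_smul hlQ) (hψ.integrable_smul (locallyIntegrableOn_const c))]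
      refine integral_congr_ae (Eventually.of_forall fun t => ?_)
      simp only [Q, ← smul_sub]
      congr 1
      ring
    rw [h2, ← h1]
    ring
  obtain ⟨F, hF, he⟩ := hw'.exists_isPrimitiveOn hU ⟨t₀, ht₀⟩ hs hf fun a ha b hb =>
    (hP'.continuousOn.mono (hsc.uIcc_subset ha hb)).intervalIntegrable
  exact ⟨F, _, hF, hP', he⟩

end

end MetricGraph

namespace MetricGraph

variable {E V : Type*} {Γ : MetricGraph E V}

/-! ### Edges as intervals -/

instance (e : E) : (Γ.interval e).OrdConnected := by
  refine ⟨fun a ha b hb t ht => ⟨ha.1.trans_le ht.1, lt_of_le_of_lt ?_ hb.2⟩⟩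
  exact ENNReal.ofReal_le_ofReal ht.2

instance (e : E) : (Γ.closedInterval e).OrdConnected := by
  refine ⟨fun a ha b hb t ht => ⟨ha.1.trans ht.1, le_trans ?_ hb.2⟩⟩
  exact ENNReal.ofReal_le_ofReal ht.2

lemma interval_subset_closedInterval (e : E) : Γ.interval e ⊆ Γ.closedInterval e :=
  fun _ ht => ⟨ht.1.le, ht.2.le⟩

lemma zero_mem_closedInterval (e : E) : (0 : ℝ) ∈ Γ.closedInterval e := ⟨le_rfl, by simp⟩

lemma toReal_mem_closedInterval (e : E) : (Γ.l e).toReal ∈ Γ.closedInterval e :=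
  ⟨ENNReal.toReal_nonneg, ENNReal.ofReal_toReal_le⟩

lemma le_toReal_of_mem {e : E} (he : Γ.l e ≠ ∞) {t : ℝ} (ht : t ∈ Γ.closedInterval e) :
    t ≤ (Γ.l e).toReal := (ENNReal.ofReal_le_iff_le_toReal he).1 ht.2

lemma interval_eq_of_ne_top {e : E} (he : Γ.l e ≠ ∞) : Γ.interval e = Ioo 0 (Γ.l e).toReal := by
  ext t
  refine and_congr_right fun ht => ?_
  exact ENNReal.ofReal_lt_iff_lt_toReal ht.le he

lemma interval_eq_of_eq_top {e : E} (he : Γ.l e = ∞) : Γ.interval e = Ioi 0 := by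
  ext t
  simp [interval, he]

lemma interval_nonempty (e : E) : (Γ.interval e).Nonempty := by
  by_cases he : Γ.l e = ∞
  · rw [interval_eq_of_eq_top he]; exact nonempty_Ioi
  · rw [interval_eq_of_ne_top he]; exact nonempty_Ioo.2 (ENNReal.toReal_pos (Γ.l_pos e).ne' he)

lemma Ioo_subset_interval {e : E} {a b : ℝ} (ha : a ∈ Γ.closedInterval e)
    (hb : b ∈ Γ.closedInterval e) : Ioo a b ⊆ Γ.interval e := by
  intro t ht
  refine ⟨ha.1.trans_lt ht.1, lt_of_lt_of_le ?_ hb.2⟩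
  exact (ENNReal.ofReal_lt_ofReal_iff (ha.1.trans_lt (ht.1.trans ht.2))).2 ht.2

lemma restrict_Icc_le_vol {e : E} {a b : ℝ} (ha : a ∈ Γ.closedInterval e)
    (hb : b ∈ Γ.closedInterval e) : volume.restrict (Icc a b) ≤ Γ.vol e := by
  rw [← Measure.restrict_congr_set Ioo_ae_eq_Icc]
  exact Measure.restrict_mono (Ioo_subset_interval ha hb) le_rfl

lemma restrict_uIoc_le_vol {e : E} {a b : ℝ} (ha : a ∈ Γ.closedInterval e)
    (hb : b ∈ Γ.closedInterval e) : volume.restrict (uIoc a b) ≤ Γ.vol e := by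
  rcases le_total a b with h | h
  · rw [uIoc_of_le h]
    exact (Measure.restrict_mono Ioc_subset_Icc_self le_rfl).trans (restrict_Icc_le_vol ha hb)
  · rw [uIoc_of_ge h]
    exact (Measure.restrict_mono Ioc_subset_Icc_self le_rfl).trans (restrict_Icc_le_vol hb ha)

lemma ae_uIoc_of_ae_vol {e : E} {p : ℝ → Prop} (hp : ∀ᵐ t ∂Γ.vol e, p t) {a b : ℝ}
    (ha : a ∈ Γ.closedInterval e) (hb : b ∈ Γ.closedInterval e) : ∀ᵐ t, t ∈ uIoc a b → p t :=
  (ae_restrict_iff' measurableSet_uIoc).1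
    ((Measure.absolutelyContinuous_of_le (restrict_uIoc_le_vol ha hb)).ae_le hp)

lemma intervalIntegrable_of_memLp {e : E} {g : ℝ → ℂ} (hg : MemLp g 2 (Γ.vol e)) {a b : ℝ}
    (ha : a ∈ Γ.closedInterval e) (hb : b ∈ Γ.closedInterval e) :
    IntervalIntegrable g volume a b := by
  rw [intervalIntegrable_iff]
  have h1 : MemLp g 2 (volume.restrict (uIoc a b)) := hg.mono_measure (restrict_uIoc_le_vol ha hb)
  have : IsFiniteMeasure (volume.restrict (uIoc a b)) :=
    ⟨by rw [Measure.restrict_apply_univ]; exact measure_Ioc_lt_top⟩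
  exact h1.integrable (by norm_num)

lemma locallyIntegrableOn_coe (f : Γ.L2) (e : E) :
    LocallyIntegrableOn (f e : ℝ → ℂ) (Γ.interval e) volume :=
  locallyIntegrableOn_of_intervalIntegrable (Γ.isOpen_interval e) fun _ ha _ hb =>
    intervalIntegrable_of_memLp (Lp.memLp (f e)) (interval_subset_closedInterval e ha)
      (interval_subset_closedInterval e hb)

/-! ### Continuous representatives and boundary values -/

/-- `F` is the family of continuous representatives of `f`, with derivative `g`. -/
structure IsRep (f g : Γ.L2) (F : E → ℝ → ℂ) : Prop where
  prim : ∀ e, IsPrimitiveOn (Γ.closedInterval e) (F e) (g e)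
  ae_eq : ∀ e, f e =ᵐ[Γ.vol e] F e

lemma HasDerivL2.exists_isRep {f g : Γ.L2} (h : Γ.HasDerivL2 f g) : ∃ F, IsRep f g F := by
  have := fun e => (h e).exists_isPrimitiveOn (Γ.isOpen_interval e) (interval_nonempty e)
    (interval_subset_closedInterval e) (locallyIntegrableOn_coe f e)
    fun a ha b hb => intervalIntegrable_of_memLp (Lp.memLp (g e)) ha hb
  choose F hF using this
  exact ⟨F, fun e => (hF e).1, fun e => (hF e).2⟩

lemma IsRep.hasDerivL2 {f g : Γ.L2} {F : E → ℝ → ℂ} (h : IsRep f g F) : Γ.HasDerivL2 f g := by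
  intro e
  have hw := ((h.prim e).mono (interval_subset_closedInterval e)).isWeakDeriv (Γ.isOpen_interval e)
  rw [isWeakDeriv_iff] at hw ⊢
  intro ψ hψ
  rw [← hw ψ hψ]
  refine integral_congr_ae ?_
  filter_upwards [h.ae_eq e] with t ht
  rw [ht]

/-- The position of an edge end in the closed edge. -/
noncomputable def EdgeEnd.point : Γ.EdgeEnd → ℝ := Sum.elim (fun _ => 0) (fun e => (Γ.l e).toReal)

lemma EdgeEnd.point_mem (h : Γ.EdgeEnd) : h.point ∈ Γ.closedInterval h.edge := by
  rcases h with e | e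
  · exact zero_mem_closedInterval e
  · exact toReal_mem_closedInterval e.1

lemma EdgeEnd.approach_le (h : Γ.EdgeEnd) : h.approach ≤ 𝓝[Γ.closedInterval h.edge] h.point := by
  refine le_inf ?_ (le_principal_iff.2 (mem_of_superset (interval_mem_approach h)
    (interval_subset_closedInterval _)))
  rcases h with e | e <;> exact nhdsWithin_le_nhds

lemma tendsto_approach {F : E → ℝ → ℂ} (h : Γ.EdgeEnd)
    (hF : ContinuousOn (F h.edge) (Γ.closedInterval h.edge)) :
    Tendsto (F h.edge) h.approach (𝓝 (F h.edge h.point)) :=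
  (hF _ h.point_mem).mono_left h.approach_le

lemma tendsto_approach_of_ae {f : Γ.L2} {F : E → ℝ → ℂ} (h : Γ.EdgeEnd)
    (hf : f h.edge =ᵐ[Γ.vol h.edge] F h.edge)
    (hF : ContinuousOn (F h.edge) (Γ.closedInterval h.edge)) :
    Tendsto (f h.edge) (h.approach ⊓ ae volume) (𝓝 (F h.edge h.point)) :=
  ((tendsto_approach h hF).mono_left inf_le_left).congr'
    ((eventually_approach_of_ae hf).mono fun _ ht => ht.symm)

lemma IsRep.hasTraces {f g : Γ.L2} {F : E → ℝ → ℂ} (h : IsRep f g F) : Γ.HasTraces f :=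
  fun k => ⟨_, tendsto_approach_of_ae k (h.ae_eq _) (h.prim _).continuousOn⟩

lemma IsRep.trace_apply {f g : Γ.L2} {F : E → ℝ → ℂ} (h : IsRep f g F) (v : V) (k : Γ.Ends v) :
    Γ.trace f v k = F k.1.edge k.1.point :=
  tendsto_nhds_unique (h.hasTraces.tendsto v k)
    (tendsto_approach_of_ae k.1 (h.ae_eq _) (h.prim _).continuousOn)

lemma HasDerivL2.hasTraces {f g : Γ.L2} (h : Γ.HasDerivL2 f g) : Γ.HasTraces f := by
  obtain ⟨F, hF⟩ := h.exists_isRep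
  exact hF.hasTraces

/-! ### The space `L²(X)` -/

variable (Γ) in
/-- The family of functions `F` on the edges is in `L²(X)`. -/
def MemL2 (F : E → ℝ → ℂ) : Prop :=
  (∀ e, AEStronglyMeasurable (F e) (Γ.vol e)) ∧ ∑' e, ∫⁻ t, ‖F e t‖ₑ ^ 2 ∂Γ.vol e ≠ ∞

lemma eLpNorm_two_sq {μ : Measure ℝ} (f : ℝ → ℂ) :
    eLpNorm f 2 μ ^ 2 = ∫⁻ t, ‖f t‖ₑ ^ 2 ∂μ := by
  rw [eLpNorm_eq_lintegral_rpow_enorm_toReal (by norm_num) (by norm_num), ← ENNReal.rpow_natCast,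
    ← ENNReal.rpow_mul]
  simp

lemma MemL2.memLp {F : E → ℝ → ℂ} (h : Γ.MemL2 F) (e : E) : MemLp (F e) 2 (Γ.vol e) := by
  refine ⟨h.1 e, ?_⟩
  have := ENNReal.ne_top_of_tsum_ne_top h.2 e
  rw [← eLpNorm_two_sq] at this
  rw [lt_top_iff_ne_top]
  intro h'
  rw [h'] at this
  exact this (by simp)

lemma enorm_sq_eq (f : Γ.L2) : ‖f‖ₑ ^ 2 = ∑' e, ∫⁻ t, ‖f e t‖ₑ ^ 2 ∂Γ.vol e := by
  have h1 : ∀ e, ∫⁻ t, ‖f e t‖ₑ ^ 2 ∂Γ.vol e = ENNReal.ofReal (‖f e‖ ^ 2) := by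
    intro e
    rw [← eLpNorm_two_sq, ENNReal.ofReal_pow (norm_nonneg _), Lp.norm_def,
      ENNReal.ofReal_toReal (Lp.eLpNorm_ne_top _)]
  have h2 : HasSum (fun e => ‖f e‖ ^ 2) (‖f‖ ^ 2) := by
    have := lp.hasSum_norm (p := 2) (by norm_num) f
    simpa using this
  simp only [h1]
  rw [← ENNReal.ofReal_tsum_of_nonneg (fun e => by positivity) h2.summable, h2.tsum_eq,
    ENNReal.ofReal_pow (norm_nonneg _), ofReal_norm]

lemma memL2_coe (f : Γ.L2) : Γ.MemL2 (fun e => f e) := by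
  refine ⟨fun e => (Lp.memLp (f e)).1, ?_⟩
  rw [← enorm_sq_eq]
  simp

/-- The element of `L²(X)` given by a family of functions on the edges. -/
noncomputable def mkL2 (F : E → ℝ → ℂ) (h : Γ.MemL2 F) : Γ.L2 :=
  ⟨fun e => (h.memLp e).toLp, by
    refine memℓp_gen ?_
    have h1 : ∀ e, ‖(h.memLp e).toLp‖ ^ (2 : ℝ≥0∞).toReal
        = (∫⁻ t, ‖F e t‖ₑ ^ 2 ∂Γ.vol e).toReal := by
      intro e
      rw [Lp.norm_toLp, ← eLpNorm_two_sq, ENNReal.toReal_pow]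
      simp
    simp only [h1]
    exact ENNReal.summable_toReal h.2⟩

lemma coe_mkL2 (F : E → ℝ → ℂ) (h : Γ.MemL2 F) (e : E) : mkL2 F h e =ᵐ[Γ.vol e] F e :=
  (h.memLp e).coeFn_toLp

lemma L2_ext {f g : Γ.L2} (h : ∀ e, f e =ᵐ[Γ.vol e] g e) : f = g :=
  lp.ext (funext fun e => Lp.ext (h e))

lemma enorm_mkL2_sq (F : E → ℝ → ℂ) (h : Γ.MemL2 F) :
    ‖mkL2 F h‖ₑ ^ 2 = ∑' e, ∫⁻ t, ‖F e t‖ₑ ^ 2 ∂Γ.vol e := by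
  rw [enorm_sq_eq]
  refine tsum_congr fun e => lintegral_congr_ae ?_
  filter_upwards [coe_mkL2 F h e] with t ht
  rw [ht]

lemma inner_edge_eq (f g : Γ.L2) (e : E) : ⟪f e, g e⟫_ℂ = ∫ t, g e t * conj (f e t) ∂Γ.vol e :=
  L2.inner_def _ _

lemma hasSum_inner (f g : Γ.L2) :
    HasSum (fun e => ∫ t, g e t * conj (f e t) ∂Γ.vol e) ⟪f, g⟫_ℂ := by
  have := lp.hasSum_inner (𝕜 := ℂ) f g
  simpa only [inner_edge_eq] using this

lemma integrable_mul_conj (f g : Γ.L2) (e : E) :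
    Integrable (fun t => g e t * conj (f e t)) (Γ.vol e) :=
  L2.integrable_inner (𝕜 := ℂ) (f e) (g e)

end MetricGraph

namespace MetricGraph

/-! ### Sobolev estimates -/

/-- The density `(2 / δ) |F|² + 2 δ |f|²`, whose integral over an interval of length `δ` bounds
`sup |F|²` if `f` is the derivative of `F`. -/
noncomputable def sobolevDensity (δ : ℝ) (F f : ℝ → ℂ) (t : ℝ) : ℝ≥0∞ :=
  ENNReal.ofReal (2 / δ) * ‖F t‖ₑ ^ 2 + ENNReal.ofReal (2 * δ) * ‖f t‖ₑ ^ 2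

lemma sq_lintegral_enorm_le {μ : Measure ℝ} (f : ℝ → ℂ) (hf : AEStronglyMeasurable f μ) :
    (∫⁻ t, ‖f t‖ₑ ∂μ) ^ 2 ≤ (∫⁻ t, ‖f t‖ₑ ^ 2 ∂μ) * μ univ := by
  have h := eLpNorm_le_eLpNorm_mul_rpow_measure_univ (p := 1) (q := 2) (by norm_num) hf
  rw [eLpNorm_one_eq_lintegral_enorm] at h
  calc (∫⁻ t, ‖f t‖ₑ ∂μ) ^ 2
      ≤ (eLpNorm f 2 μ * μ univ ^ (1 / (1 : ℝ≥0∞).toReal - 1 / (2 : ℝ≥0∞).toReal)) ^ 2 := by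
        gcongr
    _ = _ := by
        rw [mul_pow, eLpNorm_two_sq, ← ENNReal.rpow_natCast (μ univ ^ _), ← ENNReal.rpow_mul]
        norm_num

lemma add_sq_le_two_mul (a b : ℝ≥0∞) : (a + b) ^ 2 ≤ 2 * a ^ 2 + 2 * b ^ 2 := by
  have := ENNReal.rpow_add_le_mul_rpow_add_rpow a b (p := 2) (by norm_num)
  norm_num at this
  calc (a + b) ^ 2 ≤ 2 * (a ^ 2 + b ^ 2) := by exact_mod_cast this
    _ = _ := mul_add _ _ _

lemma IsPrimitiveOn.enorm_sq_le {a δ x : ℝ} (hδ : 0 < δ) {F f : ℝ → ℂ}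
    (h : IsPrimitiveOn (Icc a (a + δ)) F f) (hx : x ∈ Icc a (a + δ)) :
    ‖F x‖ₑ ^ 2 ≤ ∫⁻ t in Icc a (a + δ), sobolevDensity δ F f t := by
  have hle : a ≤ a + δ := by linarith
  have hi := h.intervalIntegrable (left_mem_Icc.2 hle) (right_mem_Icc.2 hle)
  have hm : AEStronglyMeasurable f (volume.restrict (Icc a (a + δ))) := by
    have := hi.1.aestronglyMeasurable
    rwa [Measure.restrict_congr_set Ioc_ae_eq_Icc] at this
  have hF : ContinuousOn F (Icc a (a + δ)) := h.continuousOn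
  have hFm : AEMeasurable (fun t => ‖F t‖ₑ ^ 2) (volume.restrict (Icc a (a + δ))) :=
    (hF.aestronglyMeasurable measurableSet_Icc).enorm.pow_const 2
  set μ := volume.restrict (Icc a (a + δ)) with hμ
  have hvol : μ univ = ENNReal.ofReal δ := by
    rw [hμ, Measure.restrict_apply_univ, Real.volume_Icc, add_sub_cancel_left]
  have hδ0 : ENNReal.ofReal δ ≠ 0 := by simpa using hδ
  have h1 : ∀ y ∈ Icc a (a + δ), ‖F x‖ₑ ^ 2
      ≤ 2 * ‖F y‖ₑ ^ 2 + 2 * ((∫⁻ t, ‖f t‖ₑ ^ 2 ∂μ) * ENNReal.ofReal δ) := by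
    intro y hy
    have hd : ‖F x - F y‖ₑ ≤ ∫⁻ t, ‖f t‖ₑ ∂μ := by
      rw [h.sub_eq hy hx, intervalIntegral.intervalIntegral_eq_integral_uIoc, enorm_smul]
      refine le_trans (mul_le_of_le_one_left' ?_) ((enorm_integral_le_lintegral_enorm _).trans
        (lintegral_mono' (Measure.restrict_mono ?_ le_rfl) le_rfl))
      · split_ifs <;> simp
      · exact uIoc_subset_uIcc.trans (ordConnected_Icc.uIcc_subset hy hx)
    calc ‖F x‖ₑ ^ 2 = ‖F y + (F x - F y)‖ₑ ^ 2 := by rw [add_sub_cancel]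
      _ ≤ (‖F y‖ₑ + ∫⁻ t, ‖f t‖ₑ ∂μ) ^ 2 := by
        gcongr
        exact (enorm_add_le _ _).trans (by gcongr)
      _ ≤ 2 * ‖F y‖ₑ ^ 2 + 2 * (∫⁻ t, ‖f t‖ₑ ∂μ) ^ 2 := add_sq_le_two_mul _ _
      _ ≤ _ := by
        gcongr
        rw [← hvol]
        exact sq_lintegral_enorm_le f hm
  have h2 : ENNReal.ofReal δ * ‖F x‖ₑ ^ 2 ≤ 2 * (∫⁻ t, ‖F t‖ₑ ^ 2 ∂μ)
      + 2 * ((∫⁻ t, ‖f t‖ₑ ^ 2 ∂μ) * ENNReal.ofReal δ) * ENNReal.ofReal δ := by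
    calc ENNReal.ofReal δ * ‖F x‖ₑ ^ 2 = ∫⁻ _, ‖F x‖ₑ ^ 2 ∂μ := by
          rw [lintegral_const, hvol, mul_comm]
      _ ≤ ∫⁻ y, (2 * ‖F y‖ₑ ^ 2 + 2 * ((∫⁻ t, ‖f t‖ₑ ^ 2 ∂μ) * ENNReal.ofReal δ)) ∂μ :=
          setLIntegral_mono' measurableSet_Icc fun y hy => h1 y hy
      _ = _ := by
          rw [lintegral_add_right _ measurable_const, lintegral_const_mul'' _ hFm, lintegral_const,
            hvol]
  have e1 : ENNReal.ofReal (2 / δ) = 2 / ENNReal.ofReal δ := by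
    rw [ENNReal.ofReal_div_of_pos hδ]; simp
  have e2 : ENNReal.ofReal (2 * δ) = 2 * ENNReal.ofReal δ := by
    rw [ENNReal.ofReal_mul (by norm_num)]; simp
  have h3 : ∫⁻ t, sobolevDensity δ F f t ∂μ
      = 2 / ENNReal.ofReal δ * (∫⁻ t, ‖F t‖ₑ ^ 2 ∂μ)
        + 2 * ENNReal.ofReal δ * (∫⁻ t, ‖f t‖ₑ ^ 2 ∂μ) := by
    simp only [sobolevDensity]
    rw [lintegral_add_left' (hFm.const_mul _), lintegral_const_mul'' _ hFm,
      lintegral_const_mul'' _ (hm.enorm.pow_const 2), e1, e2]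
  rw [h3, ← ENNReal.mul_le_mul_iff_right hδ0 ENNReal.ofReal_ne_top]
  refine h2.trans (le_of_eq ?_)
  have e3 : ENNReal.ofReal δ * (2 / ENNReal.ofReal δ) = 2 :=
    ENNReal.mul_div_cancel hδ0 ENNReal.ofReal_ne_top
  rw [mul_add, ← mul_assoc (ENNReal.ofReal δ), e3]
  ring

variable {E V : Type*} {Γ : MetricGraph E V}

lemma exists_segment {u δ : ℝ} (hδ : 0 < δ) (hδu : δ ≤ u) {e : E} (hLB : ENNReal.ofReal u ≤ Γ.l e)
    {x : ℝ} (hx : x ∈ Γ.closedInterval e) :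
    ∃ a, x ∈ Icc a (a + δ) ∧ a ∈ Γ.closedInterval e ∧ a + δ ∈ Γ.closedInterval e := by
  by_cases h : ENNReal.ofReal (x + δ) ≤ Γ.l e
  · exact ⟨x, ⟨le_rfl, by linarith⟩, hx, by linarith [hx.1], h⟩
  · have hne : Γ.l e ≠ ∞ := fun h' => h (h' ▸ le_top)
    have h1 : (Γ.l e).toReal < x + δ := by
      by_contra h2
      exact h (ENNReal.ofReal_le_of_le_toReal (not_lt.1 h2))
    have h2 : u ≤ (Γ.l e).toReal := (ENNReal.ofReal_le_iff_le_toReal hne).1 hLB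
    have h3 := le_toReal_of_mem hne hx
    have h4 := toReal_mem_closedInterval (Γ := Γ) e
    refine ⟨(Γ.l e).toReal - δ, ⟨by linarith, by linarith⟩, ?_, by simpa using h4⟩
    refine Set.OrdConnected.out inferInstance (zero_mem_closedInterval e) h4 ⟨by linarith, ?_⟩
    linarith

/-- The pointwise bound by the Sobolev density in a neighbourhood of the point. -/
lemma enorm_sq_le_ball {u δ : ℝ} (hδ : 0 < δ) (hδu : δ ≤ u) {e : E}
    (hLB : ENNReal.ofReal u ≤ Γ.l e) {F f : ℝ → ℂ} (h : IsPrimitiveOn (Γ.closedInterval e) F f)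
    {x : ℝ} (hx : x ∈ Γ.closedInterval e) :
    ‖F x‖ₑ ^ 2 ≤ ∫⁻ t in Metric.closedBall x δ, sobolevDensity δ F f t ∂Γ.vol e := by
  obtain ⟨a, hxa, ha, hb⟩ := exists_segment hδ hδu hLB hx
  refine ((h.mono (Set.OrdConnected.out inferInstance ha hb)).enorm_sq_le hδ hxa).trans ?_
  refine lintegral_mono' ?_ le_rfl
  rw [Measure.restrict_restrict measurableSet_closedBall,
    ← Measure.restrict_congr_set Ioo_ae_eq_Icc]
  refine Measure.restrict_mono (subset_inter (fun t ht => ?_) (Ioo_subset_interval ha hb)) le_rfl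
  rw [Metric.mem_closedBall, Real.dist_eq, abs_le]
  constructor <;> linarith [ht.1, ht.2, hxa.1, hxa.2]

lemma enorm_sq_le_lintegral {u δ : ℝ} (hδ : 0 < δ) (hδu : δ ≤ u) {e : E}
    (hLB : ENNReal.ofReal u ≤ Γ.l e) {F f : ℝ → ℂ} (h : IsPrimitiveOn (Γ.closedInterval e) F f)
    {x : ℝ} (hx : x ∈ Γ.closedInterval e) :
    ‖F x‖ₑ ^ 2 ≤ ∫⁻ t, sobolevDensity δ F f t ∂Γ.vol e :=
  (enorm_sq_le_ball hδ hδu hLB h hx).trans (setLIntegral_le_lintegral _ _)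

lemma lintegral_sobolevDensity {δ : ℝ} {f g : Γ.L2} {F : E → ℝ → ℂ} (h : IsRep f g F) (e : E) :
    ∫⁻ t, sobolevDensity δ (F e) (g e) t ∂Γ.vol e
      = ENNReal.ofReal (2 / δ) * ∫⁻ t, ‖f e t‖ₑ ^ 2 ∂Γ.vol e
        + ENNReal.ofReal (2 * δ) * ∫⁻ t, ‖g e t‖ₑ ^ 2 ∂Γ.vol e := by
  have h1 : ∫⁻ t, sobolevDensity δ (F e) (g e) t ∂Γ.vol e
      = ∫⁻ t, (ENNReal.ofReal (2 / δ) * ‖f e t‖ₑ ^ 2 + ENNReal.ofReal (2 * δ) * ‖g e t‖ₑ ^ 2)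
        ∂Γ.vol e := by
    refine lintegral_congr_ae ?_
    filter_upwards [h.ae_eq e] with t ht
    rw [sobolevDensity, ht]
  have m1 : AEMeasurable (fun t => ‖f e t‖ₑ ^ 2) (Γ.vol e) :=
    (Lp.memLp (f e)).1.enorm.pow_const 2
  have m2 : AEMeasurable (fun t => ‖g e t‖ₑ ^ 2) (Γ.vol e) :=
    (Lp.memLp (g e)).1.enorm.pow_const 2
  rw [h1, lintegral_add_left' (m1.const_mul _), lintegral_const_mul'' _ m1,
    lintegral_const_mul'' _ m2]

lemma tsum_lintegral_sobolevDensity {δ : ℝ} {f g : Γ.L2} {F : E → ℝ → ℂ} (h : IsRep f g F) :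
    ∑' e, ∫⁻ t, sobolevDensity δ (F e) (g e) t ∂Γ.vol e
      = ENNReal.ofReal (2 / δ) * ‖f‖ₑ ^ 2 + ENNReal.ofReal (2 * δ) * ‖g‖ₑ ^ 2 := by
  simp only [lintegral_sobolevDensity h]
  rw [ENNReal.tsum_add, ENNReal.tsum_mul_left, ENNReal.tsum_mul_left, enorm_sq_eq, enorm_sq_eq]

lemma enorm_mul_sq_add_toReal {c d x y : ℝ} (hc : 0 ≤ c) (hd : 0 ≤ d) (hx : 0 ≤ x) (hy : 0 ≤ y) :
    ENNReal.ofReal c * ENNReal.ofReal x ^ 2 + ENNReal.ofReal d * ENNReal.ofReal y ^ 2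
      = ENNReal.ofReal (c * x ^ 2 + d * y ^ 2) := by
  rw [ENNReal.ofReal_add (by positivity) (by positivity), ENNReal.ofReal_mul hc,
    ENNReal.ofReal_mul hd, ENNReal.ofReal_pow hx, ENNReal.ofReal_pow hy]

/-- The supremum of `f ∈ W^{1,2}(X)` is bounded by its Sobolev norm. -/
lemma IsRep.norm_sq_le {u δ : ℝ} (hδ : 0 < δ) (hδu : δ ≤ u) (hLB : ∀ e, ENNReal.ofReal u ≤ Γ.l e)
    {f g : Γ.L2} {F : E → ℝ → ℂ} (h : IsRep f g F) {e : E} {x : ℝ}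
    (hx : x ∈ Γ.closedInterval e) : ‖F e x‖ ^ 2 ≤ 2 / δ * ‖f‖ ^ 2 + 2 * δ * ‖g‖ ^ 2 := by
  have h1 := (enorm_sq_le_lintegral hδ hδu (hLB e) (h.prim e) hx).trans
    (ENNReal.le_tsum (f := fun e => ∫⁻ t, sobolevDensity δ (F e) (g e) t ∂Γ.vol e) e)
  rw [tsum_lintegral_sobolevDensity h, ← ofReal_norm, ← ofReal_norm, ← ofReal_norm,
    enorm_mul_sq_add_toReal (by positivity) (by positivity) (norm_nonneg _) (norm_nonneg _),
    ← ENNReal.ofReal_pow (norm_nonneg _)] at h1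
  exact (ENNReal.ofReal_le_ofReal_iff (by positivity)).1 h1

/-! ### Boundary values are square summable -/

section Trace

variable [∀ v, Fintype (Γ.Ends v)]

lemma tsum_enorm_trace_le {u δ : ℝ} (hδ : 0 < δ) (hδu : δ ≤ u)
    (hLB : ∀ e, ENNReal.ofReal u ≤ Γ.l e) {f g : Γ.L2} (h : Γ.HasDerivL2 f g) :
    ∑' v, ‖Γ.trace f v‖ₑ ^ 2 ≤ 2 * (ENNReal.ofReal (2 / δ) * ‖f‖ₑ ^ 2
      + ENNReal.ofReal (2 * δ) * ‖g‖ₑ ^ 2) := by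
  obtain ⟨F, hF⟩ := h.exists_isRep
  have h1 : ∀ v, ‖Γ.trace f v‖ₑ ^ 2 = ∑' k : Γ.Ends v, ‖F k.1.edge k.1.point‖ₑ ^ 2 := by
    intro v
    rw [tsum_fintype, ← ofReal_norm, ← ENNReal.ofReal_pow (norm_nonneg _),
      EuclideanSpace.norm_sq_eq, ENNReal.ofReal_sum_of_nonneg (fun _ _ => by positivity)]
    refine Finset.sum_congr rfl fun k _ => ?_
    rw [hF.trace_apply, ENNReal.ofReal_pow (norm_nonneg _), ofReal_norm]
  have h2 : ∀ k : Γ.EdgeEnd, ‖F k.edge k.point‖ₑ ^ 2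
      ≤ ∫⁻ t, sobolevDensity δ (F k.edge) (g k.edge) t ∂Γ.vol k.edge := fun k =>
    enorm_sq_le_lintegral hδ hδu (hLB _) (hF.prim _) k.point_mem
  simp only [h1]
  rw [← ENNReal.tsum_sigma fun (v : V) (k : Γ.Ends v) => ‖F k.1.edge k.1.point‖ₑ ^ 2]
  have h3 : ∑' p : (Σ v, Γ.Ends v), ‖F p.2.1.edge p.2.1.point‖ₑ ^ 2
      = ∑' k : Γ.EdgeEnd, ‖F k.edge k.point‖ₑ ^ 2 :=
    (Equiv.sigmaFiberEquiv (EdgeEnd.vertex (Γ := Γ))).tsum_eq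
      fun k : Γ.EdgeEnd => ‖F k.edge k.point‖ₑ ^ 2
  rw [h3]
  refine (ENNReal.tsum_le_tsum h2).trans ?_
  have h4 : ∑' k : Γ.EdgeEnd, ∫⁻ t, sobolevDensity δ (F k.edge) (g k.edge) t ∂Γ.vol k.edge
      = (∑' e : E, ∫⁻ t, sobolevDensity δ (F e) (g e) t ∂Γ.vol e)
      + ∑' e : {e : E // Γ.l e ≠ ∞}, ∫⁻ t, sobolevDensity δ (F e) (g e) t ∂Γ.vol e.1 :=
    Summable.tsum_sum (f := fun k : E ⊕ {e : E // Γ.l e ≠ ∞} =>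
      ∫⁻ t, sobolevDensity δ (F (EdgeEnd.edge (Γ := Γ) k)) (g (EdgeEnd.edge (Γ := Γ) k)) t
        ∂Γ.vol (EdgeEnd.edge (Γ := Γ) k)) ENNReal.summable ENNReal.summable
  rw [h4, two_mul, ← tsum_lintegral_sobolevDensity hF]
  gcongr
  exact ENNReal.tsum_comp_le_tsum_of_injective Subtype.val_injective
    (fun e => ∫⁻ t, sobolevDensity δ (F e) (g e) t ∂Γ.vol e)

lemma summable_norm_trace_sq {u : ℝ} (hu : 0 < u) (hLB : ∀ e, ENNReal.ofReal u ≤ Γ.l e)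
    {f g : Γ.L2} (h : Γ.HasDerivL2 f g) : Summable fun v => ‖Γ.trace f v‖ ^ 2 := by
  have h1 := tsum_enorm_trace_le hu le_rfl hLB h
  have h2 : ∑' v, ‖Γ.trace f v‖ₑ ^ 2 ≠ ∞ := by
    refine ne_top_of_le_ne_top ?_ h1
    finiteness
  simpa using ENNReal.summable_toReal h2

lemma tsum_norm_trace_sq_le {u δ : ℝ} (hδ : 0 < δ) (hδu : δ ≤ u)
    (hLB : ∀ e, ENNReal.ofReal u ≤ Γ.l e) {f g : Γ.L2} (h : Γ.HasDerivL2 f g) :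
    ∑' v, ‖Γ.trace f v‖ ^ 2 ≤ 4 / δ * ‖f‖ ^ 2 + 4 * δ * ‖g‖ ^ 2 := by
  have h1 := tsum_enorm_trace_le hδ hδu hLB h
  have h2 := summable_norm_trace_sq (hδ.trans_le hδu) hLB h
  have h3 : ∑' v, ‖Γ.trace f v‖ₑ ^ 2 = ENNReal.ofReal (∑' v, ‖Γ.trace f v‖ ^ 2) := by
    rw [ENNReal.ofReal_tsum_of_nonneg (fun v => by positivity) h2]
    refine tsum_congr fun v => ?_
    rw [ENNReal.ofReal_pow (norm_nonneg _), ofReal_norm]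
  have e2 : ∀ x : ℝ, 2 * ENNReal.ofReal x = ENNReal.ofReal (2 * x) := fun x => by
    rw [ENNReal.ofReal_mul (by norm_num)]; simp
  rw [h3, ← ofReal_norm, ← ofReal_norm,
    enorm_mul_sq_add_toReal (by positivity) (by positivity) (norm_nonneg _) (norm_nonneg _),
    e2] at h1
  have := (ENNReal.ofReal_le_ofReal_iff (by positivity)).1 h1
  refine this.trans (le_of_eq ?_)
  ring

end Trace

/-! ### Multiplication by the potential -/

lemma exists_segment_ball {u : ℝ} (hu : 0 < u) {e : E} (hLB : ENNReal.ofReal u ≤ Γ.l e)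
    {s : ℝ} (hs : s ∈ Γ.closedInterval e) :
    ∃ a b, a ∈ Γ.closedInterval e ∧ b ∈ Γ.closedInterval e ∧ u ≤ b - a ∧ b - a ≤ 2 * u ∧
      Γ.closedInterval e ∩ Metric.closedBall s u ⊆ Icc a b := by
  have ha : max 0 (s - u) ∈ Γ.closedInterval e :=
    Set.OrdConnected.out inferInstance (zero_mem_closedInterval e) hs
      ⟨le_max_left _ _, max_le hs.1 (by linarith)⟩
  have hball : ∀ t, t ∈ Γ.closedInterval e ∩ Metric.closedBall s u →
      max 0 (s - u) ≤ t ∧ t ≤ s + u := by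
    intro t ht
    have h2 := ht.2
    rw [Metric.mem_closedBall, Real.dist_eq, abs_le] at h2
    exact ⟨max_le ht.1.1 (by linarith [h2.1]), by linarith [h2.2]⟩
  have hs0 := hs.1
  by_cases h : ENNReal.ofReal (s + u) ≤ Γ.l e
  · refine ⟨max 0 (s - u), s + u, ha, ⟨by linarith, h⟩, ?_, ?_, fun t ht => hball t ht⟩
    · have : max 0 (s - u) ≤ s := max_le hs0 (by linarith)
      linarith
    · linarith [le_max_right 0 (s - u)]
  · have hne : Γ.l e ≠ ∞ := fun h' => h (h' ▸ le_top)
    have h1 : (Γ.l e).toReal < s + u := by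
      by_contra h2
      exact h (ENNReal.ofReal_le_of_le_toReal (not_lt.1 h2))
    have h2 : u ≤ (Γ.l e).toReal := (ENNReal.ofReal_le_iff_le_toReal hne).1 hLB
    have h3 := le_toReal_of_mem hne hs
    refine ⟨max 0 (s - u), (Γ.l e).toReal, ha, toReal_mem_closedInterval e, ?_, ?_,
      fun t ht => ⟨(hball t ht).1, le_toReal_of_mem hne ht.1⟩⟩
    · rcases max_choice 0 (s - u) with h4 | h4 <;> rw [h4] <;> linarith
    · linarith [le_max_right 0 (s - u)]

lemma IsUnifLocL2.exists_bound {u : ℝ} (hu : 0 < u) (hLB : ∀ e, ENNReal.ofReal u ≤ Γ.l e)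
    {W : E → ℝ → ℝ} (hW : Γ.IsUnifLocL2 u W) :
    ∃ M : ℝ, 0 ≤ M ∧ ∀ e, ∀ δ ≤ u, ∀ s ∈ Γ.closedInterval e,
      ∫⁻ t in Metric.closedBall s δ, ‖W e t‖ₑ ^ 2 ∂Γ.vol e ≤ ENNReal.ofReal M := by
  obtain ⟨-, M, hM⟩ := hW
  refine ⟨(max M 0) ^ 2, by positivity, fun e δ hδ s hs => ?_⟩
  obtain ⟨a, b, ha, hb, h1, h2, hsub⟩ := exists_segment_ball hu (hLB e) hs
  have h3 := hM e a b ha hb h1 h2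
  have h4 : eLpNorm (W e) 2 (volume.restrict (Icc a b)) ^ 2
      = ∫⁻ t in Icc a b, ‖W e t‖ₑ ^ 2 := by
    rw [eLpNorm_eq_lintegral_rpow_enorm_toReal (by norm_num) (by norm_num),
      ← ENNReal.rpow_natCast, ← ENNReal.rpow_mul]
    simp
  calc ∫⁻ t in Metric.closedBall s δ, ‖W e t‖ₑ ^ 2 ∂Γ.vol e
      ≤ ∫⁻ t in Icc a b, ‖W e t‖ₑ ^ 2 := by
        refine lintegral_mono' ?_ le_rfl
        rw [Measure.restrict_restrict measurableSet_closedBall]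
        refine Measure.restrict_mono (fun t ht => hsub ⟨interval_subset_closedInterval e ht.2, ?_⟩)
          le_rfl
        exact Metric.closedBall_subset_closedBall hδ ht.1
    _ = eLpNorm (W e) 2 (volume.restrict (Icc a b)) ^ 2 := h4.symm
    _ ≤ ENNReal.ofReal (max M 0) ^ 2 := by
        gcongr
        exact h3.trans (ENNReal.ofReal_le_ofReal (le_max_left _ _))
    _ = _ := (ENNReal.ofReal_pow (le_max_right _ _) 2).symm

lemma lintegral_mul_sq_le {u δ M : ℝ} (hδ : 0 < δ) (hδu : δ ≤ u) {e : E}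
    (hLB : ENNReal.ofReal u ≤ Γ.l e) {W : ℝ → ℝ} (hWm : AEStronglyMeasurable W (Γ.vol e))
    (hM : ∀ s ∈ Γ.closedInterval e,
      ∫⁻ t in Metric.closedBall s δ, ‖W t‖ₑ ^ 2 ∂Γ.vol e ≤ ENNReal.ofReal M)
    {F f : ℝ → ℂ} (h : IsPrimitiveOn (Γ.closedInterval e) F f)
    (hf : AEStronglyMeasurable f (Γ.vol e)) :
    ∫⁻ t, ‖W t‖ₑ ^ 2 * ‖F t‖ₑ ^ 2 ∂Γ.vol e
      ≤ ENNReal.ofReal M * ∫⁻ t, sobolevDensity δ F f t ∂Γ.vol e := by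
  have hFm : AEStronglyMeasurable F (Γ.vol e) :=
    (h.continuousOn.mono (interval_subset_closedInterval e)).aestronglyMeasurable
      (Γ.isOpen_interval e).measurableSet
  have hqm : AEMeasurable (sobolevDensity δ F f) (Γ.vol e) :=
    ((hFm.enorm.pow_const 2).const_mul _).add ((hf.enorm.pow_const 2).const_mul _)
  have hWm' : AEMeasurable (fun t => ‖W t‖ₑ ^ 2) (Γ.vol e) := hWm.enorm.pow_const 2
  have hS : MeasurableSet {p : ℝ × ℝ | dist p.1 p.2 ≤ δ} :=
    (isClosed_le continuous_dist continuous_const).measurableSet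
  let k : ℝ → ℝ → ℝ≥0∞ := fun t s => {p : ℝ × ℝ | dist p.1 p.2 ≤ δ}.indicator
    (fun p => ‖W p.1‖ₑ ^ 2 * sobolevDensity δ F f p.2) (t, s)
  have hk : AEMeasurable (Function.uncurry k) ((Γ.vol e).prod (Γ.vol e)) :=
    ((hWm'.comp_fst).mul hqm.comp_snd).indicator hS
  have k1 : ∀ t, ∫⁻ s, k t s ∂Γ.vol e
      = ‖W t‖ₑ ^ 2 * ∫⁻ s in Metric.closedBall t δ, sobolevDensity δ F f s ∂Γ.vol e := by
    intro t
    rw [← lintegral_const_mul'' _ hqm.restrict, ← lintegral_indicator measurableSet_closedBall]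
    refine lintegral_congr fun s => ?_
    simp only [k, indicator, Metric.mem_closedBall, mem_ofPred_eq, dist_comm t s]
  have k2 : ∀ s, ∫⁻ t, k t s ∂Γ.vol e
      = (∫⁻ t in Metric.closedBall s δ, ‖W t‖ₑ ^ 2 ∂Γ.vol e) * sobolevDensity δ F f s := by
    intro s
    rw [← lintegral_mul_const'' _ hWm'.restrict, ← lintegral_indicator measurableSet_closedBall]
    refine lintegral_congr fun t => ?_
    simp only [k, indicator, Metric.mem_closedBall, mem_ofPred_eq]
  calc ∫⁻ t, ‖W t‖ₑ ^ 2 * ‖F t‖ₑ ^ 2 ∂Γ.vol e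
      ≤ ∫⁻ t, ∫⁻ s, k t s ∂Γ.vol e ∂Γ.vol e := by
        refine setLIntegral_mono' (Γ.isOpen_interval e).measurableSet fun t ht => ?_
        rw [k1]
        gcongr
        exact enorm_sq_le_ball hδ hδu hLB h (interval_subset_closedInterval e ht)
    _ = ∫⁻ s, ∫⁻ t, k t s ∂Γ.vol e ∂Γ.vol e := lintegral_lintegral_swap hk
    _ ≤ ∫⁻ s, ENNReal.ofReal M * sobolevDensity δ F f s ∂Γ.vol e := by
        refine setLIntegral_mono' (Γ.isOpen_interval e).measurableSet fun s hs => ?_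
        rw [k2]
        gcongr
        exact hM s (interval_subset_closedInterval e hs)
    _ = _ := lintegral_const_mul'' _ hqm

/-- Multiplication by `W` maps `W^{1,2}(X)` to `L²(X)`, with an arbitrarily small bound relative to
the derivative. -/
lemma IsUnifLocL2.exists_mul_bound {u : ℝ} (hu : 0 < u) (hLB : ∀ e, ENNReal.ofReal u ≤ Γ.l e)
    {W : E → ℝ → ℝ} (hW : Γ.IsUnifLocL2 u W) :
    ∃ M : ℝ, 0 ≤ M ∧ ∀ f g : Γ.L2, Γ.HasDerivL2 f g →
      ∃ k : Γ.L2, (f, k) ∈ Γ.mulGraph W ∧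
        ∀ δ, 0 < δ → δ ≤ u → ‖k‖ ^ 2 ≤ M * (2 / δ * ‖f‖ ^ 2 + 2 * δ * ‖g‖ ^ 2) := by
  obtain ⟨M, hM0, hM⟩ := hW.exists_bound hu hLB
  refine ⟨M, hM0, fun f g hfg => ?_⟩
  obtain ⟨F, hF⟩ := hfg.exists_isRep
  have key : ∀ δ, 0 < δ → δ ≤ u →
      ∑' e, ∫⁻ t, ‖(W e t : ℂ) * f e t‖ₑ ^ 2 ∂Γ.vol e
        ≤ ENNReal.ofReal M *
          (ENNReal.ofReal (2 / δ) * ‖f‖ₑ ^ 2 + ENNReal.ofReal (2 * δ) * ‖g‖ₑ ^ 2) := by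
    intro δ hδ hδu
    rw [← tsum_lintegral_sobolevDensity hF, ← ENNReal.tsum_mul_left]
    refine ENNReal.tsum_le_tsum fun e => ?_
    refine le_trans (le_of_eq (lintegral_congr_ae ?_)) (lintegral_mul_sq_le hδ hδu (hLB e)
      (hW.1 e) (fun s hs => hM e δ hδu s hs) (hF.prim e) (Lp.memLp (g e)).1)
    filter_upwards [hF.ae_eq e] with t ht
    rw [ht, enorm_mul, mul_pow]
    congr 2
    simp [enorm_eq_nnnorm]
  have hmem : Γ.MemL2 (fun e t => (W e t : ℂ) * f e t) := by
    refine ⟨fun e => ?_, ne_top_of_le_ne_top (by finiteness) (key u hu le_rfl)⟩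
    exact (Complex.continuous_ofReal.comp_aestronglyMeasurable (hW.1 e)).mul (Lp.memLp (f e)).1
  refine ⟨mkL2 _ hmem, fun e => coe_mkL2 _ hmem e, fun δ hδ hδu => ?_⟩
  have h1 := key δ hδ hδu
  rw [← enorm_mkL2_sq _ hmem, ← ofReal_norm, ← ofReal_norm, ← ofReal_norm,
    enorm_mul_sq_add_toReal (by positivity) (by positivity) (norm_nonneg _) (norm_nonneg _),
    ← ENNReal.ofReal_pow (norm_nonneg _), ← ENNReal.ofReal_mul hM0] at h1
  exact (ENNReal.ofReal_le_ofReal_iff (by positivity)).1 h1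

end MetricGraph

namespace MetricGraph

/-! ### Operators with a bounded symmetric resolvent -/

section Abstract

variable {H : Type*} [NormedAddCommGroup H] [InnerProductSpace ℂ H]

lemma mem_graph_add_iff {A T : H →ₗ.[ℂ] H} {f h : H} :
    (f, h) ∈ (A + T).graph ↔ ∃ a b, (f, a) ∈ A.graph ∧ (f, b) ∈ T.graph ∧ h = a + b := by
  simp only [LinearPMap.mem_graph_iff]
  constructor
  · rintro ⟨⟨y, h1, h2⟩, rfl, rfl⟩
    exact ⟨A ⟨y, h1⟩, T ⟨y, h2⟩, ⟨⟨y, h1⟩, rfl, rfl⟩, ⟨⟨y, h2⟩, rfl, rfl⟩, rfl⟩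
  · rintro ⟨a, b, ⟨⟨y, h1⟩, rfl, rfl⟩, ⟨⟨z, h2⟩, hz, rfl⟩, rfl⟩
    obtain rfl : z = y := hz
    exact ⟨⟨z, h1, h2⟩, rfl, rfl⟩

/-- The shift `A + C` of a partially defined operator. -/
noncomputable abbrev shift (A : H →ₗ.[ℂ] H) (C : ℝ) : H →ₗ.[ℂ] H :=
  A + ((C : ℂ) • LinearMap.id : H →ₗ[ℂ] H).toPMap ⊤

lemma mem_graph_shift_iff {A : H →ₗ.[ℂ] H} {C : ℝ} {f h : H} :
    (f, h) ∈ (shift A C).graph ↔ (f, h - (C : ℂ) • f) ∈ A.graph := by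
  rw [mem_graph_add_iff]
  have h0 : ∀ b, (f, b) ∈ (((C : ℂ) • LinearMap.id : H →ₗ[ℂ] H).toPMap ⊤).graph
      ↔ b = (C : ℂ) • f := by
    intro b
    rw [LinearPMap.mem_graph_iff]
    constructor
    · rintro ⟨y, hy, hy'⟩
      simp only at hy hy'
      rw [← hy', ← hy]
      rfl
    · rintro rfl
      exact ⟨⟨f, trivial⟩, rfl, rfl⟩
  constructor
  · rintro ⟨a, b, ha, hb, rfl⟩
    rw [(h0 b).1 hb]
    simpa using ha
  · intro hf
    exact ⟨_, _, hf, (h0 _).2 rfl, by simp⟩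

variable [CompleteSpace H]

/-- An operator whose shift by a real number has a bounded symmetric inverse is self-adjoint. -/
lemma isSelfAdjoint_of_resolvent {A : H →ₗ.[ℂ] H} {C : ℝ} {R : H →L[ℂ] H}
    (hR : ∀ x y, ⟪R x, y⟫_ℂ = ⟪x, R y⟫_ℂ)
    (hA : ∀ f g, (f, g) ∈ (shift A C).graph ↔ f = R g) : IsSelfAdjoint A := by
  have hmem : ∀ g, R g ∈ A.domain := fun g =>
    LinearPMap.mem_domain_of_mem_graph (mem_graph_shift_iff.1 ((hA (R g) g).2 rfl))
  have hval : ∀ x : A.domain, (x : H) = R (A x + (C : ℂ) • (x : H)) := fun x =>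
    (hA _ _).1 (mem_graph_shift_iff.2 (by simp))
  have hval' : ∀ g, A ⟨R g, hmem g⟩ = g - (C : ℂ) • R g := fun g =>
    A.mem_graph_snd_inj (A.mem_graph ⟨R g, hmem g⟩)
      (mem_graph_shift_iff.1 ((hA (R g) g).2 rfl)) rfl
  have hdense : Dense (A.domain : Set H) := by
    rw [Submodule.dense_iff_topologicalClosure_eq_top, Submodule.topologicalClosure_eq_top_iff,
      Submodule.eq_bot_iff]
    intro y hy
    have h1 : R y = 0 := by
      refine ext_inner_left ℂ fun z => ?_
      rw [← hR, inner_zero_right]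
      exact hy _ (hmem z)
    have h2 := hval' y
    have h3 : (⟨R y, hmem y⟩ : A.domain) = 0 := Subtype.ext h1
    rw [h3, h1, LinearPMap.map_zero] at h2
    simpa using h2.symm
  have hsymm : A.IsFormalAdjoint A := by
    intro x y
    have e1 := hR (A x + (C : ℂ) • (x : H)) (A y + (C : ℂ) • (y : H))
    rw [← hval, ← hval, inner_add_left, inner_add_right, inner_smul_left, inner_smul_right,
      Complex.conj_ofReal] at e1
    exact (add_right_cancel e1).symm
  rw [LinearPMap.isSelfAdjoint_def]
  refine le_antisymm ?_ (hsymm.le_adjoint hdense)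
  have hdom : ∀ y : A.adjoint.domain,
      (y : H) = R (A.adjoint y + (C : ℂ) • (y : H)) := by
    intro y
    refine ext_inner_right ℂ fun z => ?_
    rw [hR]
    have h1 := A.adjoint_isFormalAdjoint hdense y ⟨R z, hmem z⟩
    rw [hval'] at h1
    simp only [inner_add_left, inner_smul_left, inner_sub_right, inner_smul_right,
      Complex.conj_ofReal] at h1 ⊢
    rw [h1]
    ring
  refine ⟨fun y hy => ?_, fun x y hxy => ?_⟩
  · have := hdom ⟨y, hy⟩
    simp only at this
    rw [this]; exact hmem _
  · have h1 := hdom x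
    have h2 := hval' (A.adjoint x + (C : ℂ) • (x : H))
    have h3 : (⟨R (A.adjoint x + (C : ℂ) • (x : H)), hmem _⟩ : A.domain) = y :=
      Subtype.ext (h1.symm.trans hxy)
    rw [h3, ← h1] at h2
    rw [h2]
    simp

lemma exists_isPositive_sqrt {R : H →L[ℂ] H} (hR : R.IsPositive) :
    ∃ S : H →L[ℂ] H, S.IsPositive ∧ ∀ x, S (S x) = R x := by
  have h0 : 0 ≤ R := (ContinuousLinearMap.nonneg_iff_isPositive R).2 hR
  refine ⟨CFC.sqrt R, (ContinuousLinearMap.nonneg_iff_isPositive _).1 (CFC.sqrt_nonneg R),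
    fun x => ?_⟩
  have := CFC.sqrt_mul_sqrt_self R h0
  exact congrArg (fun T : H →L[ℂ] H => T x) this

variable {G : Type*} [NormedAddCommGroup G] [InnerProductSpace ℂ G] [CompleteSpace G]

/-- The operator `J T⁻¹ J*` given by a coercive symmetric operator `T`, the weak solution operator
of `⟨T x, y⟩ = ⟨h, J y⟩`, together with the mapping properties of its square root. -/
lemma exists_resolvent_of_coercive (J : G →L[ℂ] H) (T : G →L[ℂ] G)
    (hT : ∀ x y, ⟪T x, y⟫_ℂ = ⟪x, T y⟫_ℂ) {c : ℝ} (hc : 0 < c)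
    (hcoer : ∀ x, c * ‖x‖ ^ 2 ≤ (⟪T x, x⟫_ℂ).re) (hJ : ∀ h, (∀ y, ⟪J y, h⟫_ℂ = 0) → h = 0) :
    ∃ R : H →L[ℂ] H, R.IsPositive ∧
      (∀ f h, f = R h ↔ ∃ x, J x = f ∧ ∀ y, ⟪y, T x⟫_ℂ = ⟪J y, h⟫_ℂ) ∧
      ∃ S : H →L[ℂ] H, S.IsPositive ∧ (∀ x, S (S x) = R x) ∧
        ∀ g, ∃ x, J x = S g ∧ c * ‖x‖ ^ 2 ≤ ‖g‖ ^ 2 := by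
  have hu : IsUnit T := by
    refine ContinuousLinearMap.isUnit_of_forall_le_norm_inner_map T (c := ⟨c, hc.le⟩) hc
      fun x => ?_
    rw [mul_comm]
    exact (hcoer x).trans (Complex.re_le_norm _)
  obtain ⟨U, hU⟩ := hu
  set T' : G →L[ℂ] G := ((U⁻¹ : (G →L[ℂ] G)ˣ) : G →L[ℂ] G) with hT'
  have h1 : ∀ x, T (T' x) = x := fun x => by
    rw [← hU]; exact congrArg (fun T : G →L[ℂ] G => T x) U.mul_inv
  have h2 : ∀ x, T' (T x) = x := fun x => by
    rw [← hU]; exact congrArg (fun T : G →L[ℂ] G => T x) U.inv_mul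
  set Q : H →L[ℂ] G := T' ∘L J.adjoint with hQ
  have hTQ : ∀ h y, ⟪y, T (Q h)⟫_ℂ = ⟪J y, h⟫_ℂ := fun h y => by
    rw [hQ, ContinuousLinearMap.comp_apply, h1, ContinuousLinearMap.adjoint_inner_right]
  set R : H →L[ℂ] H := J ∘L Q with hRdef
  have hRsymm : ∀ x y, ⟪R x, y⟫_ℂ = ⟪x, R y⟫_ℂ := by
    intro x y
    have e1 := hTQ y (Q x)
    have e2 := hTQ x (Q y)
    rw [← hT] at e1
    change ⟪J (Q x), y⟫_ℂ = ⟪x, J (Q y)⟫_ℂ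
    rw [← e1, ← inner_conj_symm x, ← e2, inner_conj_symm]
  have hQb : ∀ h, c * ‖Q h‖ ^ 2 ≤ (⟪R h, h⟫_ℂ).re := by
    intro h
    refine (hcoer (Q h)).trans (le_of_eq ?_)
    rw [hT, hTQ]
    rfl
  have hRpos : R.IsPositive := by
    rw [ContinuousLinearMap.isPositive_def']
    refine ⟨(ContinuousLinearMap.isSelfAdjoint_iff_isSymmetric).2 hRsymm, fun x => ?_⟩
    exact le_trans (by positivity) (hQb x)
  obtain ⟨S, hS, hSS⟩ := exists_isPositive_sqrt hRpos
  have hSsymm : ∀ x y, ⟪S x, y⟫_ℂ = ⟪x, S y⟫_ℂ := hS.isSelfAdjoint.isSymmetric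
  have hnorm : ∀ h, (⟪R h, h⟫_ℂ).re = ‖S h‖ ^ 2 := fun h => by
    rw [← hSS, hSsymm, inner_self_eq_norm_sq_to_K]
    norm_cast
  refine ⟨R, hRpos, fun f h => ⟨?_, ?_⟩, S, hS, hSS, fun g => ?_⟩
  · rintro rfl
    exact ⟨Q h, rfl, fun y => hTQ h y⟩
  · rintro ⟨x, rfl, hx⟩
    have : T x = T (Q h) := ext_inner_left ℂ fun y => by rw [hx, hTQ]
    have := congrArg T' this
    rw [h2, h2] at this
    rw [this]
    rfl
  · have hdense : DenseRange S := by
      have : (LinearMap.range (S : H →ₗ[ℂ] H)).topologicalClosure = ⊤ := by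
        rw [Submodule.topologicalClosure_eq_top_iff, Submodule.eq_bot_iff]
        intro y hy
        have hSy : S y = 0 := by
          refine ext_inner_left ℂ fun z => ?_
          rw [← hSsymm, inner_zero_right]
          exact hy _ ⟨z, rfl⟩
        have hRy : (⟪R y, y⟫_ℂ).re = 0 := by rw [hnorm, hSy]; simp
        have hQy : Q y = 0 := by
          have h3 := hQb y
          rw [hRy] at h3
          have h4 : ‖Q y‖ ^ 2 ≤ 0 := by
            by_contra h5
            exact absurd h3 (not_le.2 (mul_pos hc (not_le.1 h5)))
          simpa using le_antisymm h4 (by positivity)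
        refine hJ y fun z => ?_
        rw [← hTQ, hQy, map_zero, inner_zero_right]
      exact Submodule.dense_iff_topologicalClosure_eq_top.2 this
    have hg : g ∈ closure (range S) := hdense g
    obtain ⟨w, hw, hwg⟩ := mem_closure_iff_seq_limit.1 hg
    choose h hh using hw
    have hdiff : ∀ n m, c * ‖Q (h n) - Q (h m)‖ ^ 2 ≤ ‖w n - w m‖ ^ 2 := by
      intro n m
      have := hQb (h n - h m)
      rwa [hnorm, map_sub, map_sub, hh, hh] at this
    have hcau : CauchySeq fun n => Q (h n) := by
      have hwc := hwg.cauchySeq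
      rw [Metric.cauchySeq_iff] at hwc ⊢
      intro ε hε
      obtain ⟨N, hN⟩ := hwc (Real.sqrt c * ε) (mul_pos (Real.sqrt_pos.2 hc) hε)
      refine ⟨N, fun m hm n hn => ?_⟩
      have h3 := hN m hm n hn
      rw [dist_eq_norm] at h3 ⊢
      have h4 : ‖w m - w n‖ ^ 2 < (Real.sqrt c * ε) ^ 2 := by gcongr
      rw [mul_pow, Real.sq_sqrt hc.le] at h4
      have h5 := lt_of_le_of_lt (hdiff m n) h4
      exact lt_of_pow_lt_pow_left₀ 2 hε.le (lt_of_mul_lt_mul_left h5 hc.le)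
    obtain ⟨x, hx⟩ := cauchySeq_tendsto_of_complete hcau
    refine ⟨x, ?_, ?_⟩
    · have e1 : Tendsto (fun n => J (Q (h n))) atTop (𝓝 (J x)) := (J.continuous.tendsto x).comp hx
      have e2 : Tendsto (fun n => S (w n)) atTop (𝓝 (S g)) := (S.continuous.tendsto g).comp hwg
      refine tendsto_nhds_unique e1 (e2.congr fun n => ?_)
      rw [← hh, hSS]
      rfl
    · refine le_of_tendsto_of_tendsto' ((hx.norm.pow 2).const_mul c) (hwg.norm.pow 2) fun n => ?_
      have := hQb (h n)
      rwa [hnorm, hh] at this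

end Abstract

end MetricGraph

namespace MetricGraph

variable {E V : Type*} {Γ : MetricGraph E V}

/-! ### Integration by parts -/

/-- The value of `p` at the terminal end of `e`, zero if `e` has infinite length. -/
noncomputable def endValue (Γ : MetricGraph E V) (e : E) (p : ℝ → ℂ) : ℂ :=
  open Classical in if Γ.l e = ∞ then 0 else p (Γ.l e).toReal

lemma integral_deriv_mul_add {e : E} {p p' G g : ℝ → ℂ}
    (hp : IsPrimitiveOn (Γ.closedInterval e) p p') (hG : IsPrimitiveOn (Γ.closedInterval e) G g)
    (hsupp : ∃ T, ∀ t, T ≤ t → p t = 0 ∧ p' t = 0) :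
    IntegrableOn (fun t => p' t * G t + p t * g t) (Γ.interval e) ∧
    ∫ t in Γ.interval e, (p' t * G t + p t * g t)
      = endValue Γ e (fun t => p t * G t) - p 0 * G 0 := by
  have hm := hp.mul hG
  by_cases he : Γ.l e = ∞
  · obtain ⟨T, hT⟩ := hsupp
    set b := max T 0
    have hb : b ∈ Γ.closedInterval e := ⟨le_max_right _ _, by simp [he]⟩
    have h1 := hm _ (zero_mem_closedInterval e) b hb
    have hz : ∀ t, t ∈ Ioi (0 : ℝ) \ Ioc 0 b → p' t * G t + p t * g t = 0 := by
      intro t ht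
      have : T ≤ t := by
        by_contra h
        exact ht.2 ⟨ht.1, (not_le.1 h).le.trans (le_max_left _ _)⟩
      rw [(hT t this).1, (hT t this).2]
      simp
    rw [interval_eq_of_eq_top he, endValue, if_pos he]
    refine ⟨h1.1.1.of_forall_sdiff_eq_zero measurableSet_Ioi hz, ?_⟩
    rw [setIntegral_eq_of_subset_of_forall_sdiff_eq_zero measurableSet_Ioi Ioc_subset_Ioi_self hz,
      ← intervalIntegral.integral_of_le (le_max_right _ _), ← h1.2]
    simp only [(hT b (le_max_left _ _)).1, zero_mul]
  · have h1 := hm _ (zero_mem_closedInterval e) _ (toReal_mem_closedInterval e)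
    have hle : (0 : ℝ) ≤ (Γ.l e).toReal := ENNReal.toReal_nonneg
    rw [interval_eq_of_ne_top he, endValue, if_neg he]
    refine ⟨h1.1.1.mono_set Ioo_subset_Ioc_self, ?_⟩
    rw [← integral_Ioc_eq_integral_Ioo, ← intervalIntegral.integral_of_le hle, ← h1.2]

/-- `p` is a function on finitely many edges, absolutely continuous with derivative `p'` and with
bounded support. -/
structure IsCompactRep (Γ : MetricGraph E V) (p p' : E → ℝ → ℂ) : Prop where
  prim : ∀ e, IsPrimitiveOn (Γ.closedInterval e) (p e) (p' e)
  memL2 : Γ.MemL2 p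
  memL2' : Γ.MemL2 p'
  finite : {e | p e ≠ 0}.Finite
  bounded : ∀ e, ∃ T, ∀ t, T ≤ t → p e t = 0 ∧ p' e t = 0

lemma IsPrimitiveOn.congr_mkL2 {e : E} {F : ℝ → ℂ} {f : E → ℝ → ℂ} (hf : Γ.MemL2 f)
    (h : IsPrimitiveOn (Γ.closedInterval e) F (f e)) :
    IsPrimitiveOn (Γ.closedInterval e) F (mkL2 f hf e) :=
  h.congr_deriv fun _ ha _ hb => ae_uIoc_of_ae_vol
    ((coe_mkL2 f hf e).mono fun _ ht => ht.symm) ha hb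

lemma IsCompactRep.isRep {p p' : E → ℝ → ℂ} (h : IsCompactRep Γ p p') :
    IsRep (mkL2 p h.memL2) (mkL2 p' h.memL2') p :=
  ⟨fun e => (h.prim e).congr_mkL2 h.memL2', fun e => coe_mkL2 p h.memL2 e⟩

/-- The boundary vector at `v` of the family `p`, with the sign of the inner normal. -/
noncomputable def signedBdry (Γ : MetricGraph E V) (p : E → ℝ → ℂ) (v : V) : Γ.BdrySpace v :=
  WithLp.toLp 2 fun k : Γ.Ends v => k.1.sign * p k.1.edge k.1.point

/-- The boundary vector at `v` of the family `p`. -/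
noncomputable def bdry (Γ : MetricGraph E V) (p : E → ℝ → ℂ) (v : V) : Γ.BdrySpace v :=
  WithLp.toLp 2 fun k : Γ.Ends v => p k.1.edge k.1.point

lemma IsRep.trace_eq_bdry {f g : Γ.L2} {F : E → ℝ → ℂ} (h : IsRep f g F) (v : V) :
    Γ.trace f v = bdry Γ F v := by
  ext k
  exact h.trace_apply v k

/-- The sum over all edges of the boundary terms, sorted by the vertices. -/
lemma hasSum_boundary [∀ v, Fintype (Γ.Ends v)] {p : E → ℝ → ℂ} (hfin : {e | p e ≠ 0}.Finite)
    (G : E → ℝ → ℂ) {a : ℂ}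
    (ha : HasSum (fun e => endValue Γ e (fun t => p e t * conj (G e t))
      - p e 0 * conj (G e 0)) a) :
    HasSum (fun v => ⟪bdry Γ G v, signedBdry Γ p v⟫_ℂ) (-a) := by
  set s := hfin.toFinset
  have hs : ∀ e, e ∉ s → p e = 0 := fun e he => by simpa [s] using he
  have hL : HasSum (fun e => p e 0 * conj (G e 0)) (∑ e ∈ s, p e 0 * conj (G e 0)) :=
    hasSum_sum_of_ne_finset_zero fun e he => by rw [hs e he]; simp
  have hR : HasSum (fun e => endValue Γ e (fun t => p e t * conj (G e t)))
      (∑ e ∈ s, endValue Γ e (fun t => p e t * conj (G e t))) :=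
    hasSum_sum_of_ne_finset_zero fun e he => by rw [hs e he]; simp [endValue]
  have ha' : a = (∑ e ∈ s, endValue Γ e (fun t => p e t * conj (G e t)))
      - ∑ e ∈ s, p e 0 * conj (G e 0) := ha.unique (hR.sub hL)
  have hR' : HasSum (fun e : {e : E // Γ.l e ≠ ∞} =>
      p e (Γ.l e).toReal * conj (G e (Γ.l e).toReal))
      (∑ e ∈ s, endValue Γ e (fun t => p e t * conj (G e t))) := by
    rw [← Function.Injective.hasSum_iff (g := fun e : {e : E // Γ.l e ≠ ∞} => (e : E))
      Subtype.val_injective] at hR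
    · refine hR.congr_fun ?_
      intro e
      simp [endValue, e.2]
    · intro e he
      have : Γ.l e = ∞ := by
        by_contra h
        exact he ⟨⟨e, h⟩, rfl⟩
      simp [endValue, this]
  have hE : HasSum (fun k : Γ.EdgeEnd => k.sign * p k.edge k.point * conj (G k.edge k.point))
      (-a) := by
    have e1 : -a = (∑ e ∈ s, p e 0 * conj (G e 0))
        + -∑ e ∈ s, endValue Γ e (fun t => p e t * conj (G e t)) := by rw [ha']; ring
    rw [e1]
    refine HasSum.sum (f := fun k : E ⊕ {e : E // Γ.l e ≠ ∞} =>
      EdgeEnd.sign (Γ := Γ) k * p (EdgeEnd.edge (Γ := Γ) k) (EdgeEnd.point (Γ := Γ) k)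
        * conj (G (EdgeEnd.edge (Γ := Γ) k) (EdgeEnd.point (Γ := Γ) k))) ?_ ?_
    · refine hL.congr_fun fun e => ?_
      simp [EdgeEnd.sign, EdgeEnd.edge, EdgeEnd.point]
    · refine hR'.neg.congr_fun fun e => ?_
      simp [EdgeEnd.sign, EdgeEnd.edge, EdgeEnd.point]
  have hS := ((Equiv.sigmaFiberEquiv (EdgeEnd.vertex (Γ := Γ))).hasSum_iff).2 hE
  refine HasSum.sigma hS fun v => ?_
  have := hasSum_fintype fun k : Γ.Ends v =>
    k.1.sign * p k.1.edge k.1.point * conj (G k.1.edge k.1.point)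
  have e2 : ⟪bdry Γ G v, signedBdry Γ p v⟫_ℂ
      = ∑ k : Γ.Ends v, k.1.sign * p k.1.edge k.1.point * conj (G k.1.edge k.1.point) := by
    rw [PiLp.inner_apply]
    rfl
  rw [e2]
  exact this

/-- Integration by parts on the graph. -/
lemma IsCompactRep.hasSum_inner_deriv [∀ v, Fintype (Γ.Ends v)] {p p' : E → ℝ → ℂ}
    (h : IsCompactRep Γ p p') {f g : Γ.L2} {F : E → ℝ → ℂ} (hF : IsRep f g F) :
    HasSum (fun v => ⟪Γ.trace f v, signedBdry Γ p v⟫_ℂ)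
      (-(⟪f, mkL2 p' h.memL2'⟫_ℂ + ⟪g, mkL2 p h.memL2⟫_ℂ)) := by
  simp only [hF.trace_eq_bdry]
  refine hasSum_boundary h.finite F ?_
  refine ((hasSum_inner f (mkL2 p' h.memL2')).add (hasSum_inner g (mkL2 p h.memL2))).congr_fun ?_
  intro e
  rw [← (integral_deriv_mul_add (h.prim e) (hF.prim e).star (h.bounded e)).2,
    ← integral_add (integrable_mul_conj _ _ _) (integrable_mul_conj _ _ _)]
  refine integral_congr_ae ?_
  filter_upwards [coe_mkL2 p' h.memL2' e, coe_mkL2 p h.memL2 e, hF.ae_eq e] with t h1 h2 h3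
  rw [h1, h2, h3]

/-! ### Smooth functions on finitely many edges -/

/-- `p` is a smooth function with compact support on finitely many edges. -/
structure IsSmoothFamily (p : E → ℝ → ℂ) : Prop where
  contDiff : ∀ e, ContDiff ℝ (⊤ : ℕ∞) (p e)
  hasCompactSupport : ∀ e, HasCompactSupport (p e)
  finite : {e | p e ≠ 0}.Finite

lemma memL2_of_finite {p : E → ℝ → ℂ} (hp : ∀ e, MemLp (p e) 2 (Γ.vol e))
    (hfin : {e | p e ≠ 0}.Finite) : Γ.MemL2 p := by
  refine ⟨fun e => (hp e).1, ?_⟩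
  rw [tsum_eq_sum (s := hfin.toFinset) fun e he => by
    have : p e = 0 := by simpa using he
    simp [this]]
  refine ENNReal.sum_ne_top.2 fun e _ => ?_
  rw [← eLpNorm_two_sq]
  exact ENNReal.pow_ne_top (hp e).2.ne

namespace IsSmoothFamily

variable {p : E → ℝ → ℂ}

lemma deriv (h : IsSmoothFamily p) : IsSmoothFamily fun e => deriv (p e) :=
  ⟨fun e => ContDiff.deriv' ((h.contDiff e).of_le (by simp)), fun e => (h.hasCompactSupport e).deriv,
    h.finite.subset fun e he h0 => he (by rw [h0]; exact deriv_const' 0)⟩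

lemma neg (h : IsSmoothFamily p) : IsSmoothFamily fun e t => -p e t :=
  ⟨fun e => (h.contDiff e).neg, fun e => (h.hasCompactSupport e).neg,
    h.finite.subset fun e he h0 => he (by rw [h0]; simp; rfl)⟩

lemma memLp (h : IsSmoothFamily p) (e : E) (μ : Measure ℝ) [IsFiniteMeasureOnCompacts μ] :
    MemLp (p e) 2 μ :=
  (h.contDiff e).continuous.memLp_of_hasCompactSupport (h.hasCompactSupport e)

lemma memL2 (h : IsSmoothFamily p) : Γ.MemL2 p :=
  memL2_of_finite (fun e => (h.memLp e volume).restrict _) h.finite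

lemma exists_forall_ge_eq_zero (h : IsSmoothFamily p) (e : E) : ∃ T, ∀ t, T ≤ t → p e t = 0 := by
  obtain ⟨T, hT⟩ := (h.hasCompactSupport e).isBounded.bddAbove
  refine ⟨T + 1, fun t ht => image_eq_zero_of_notMem_tsupport fun h' => ?_⟩
  linarith [hT h']

lemma isCompactRep (h : IsSmoothFamily p) : IsCompactRep Γ p fun e => _root_.deriv (p e) := by
  refine ⟨fun e => IsPrimitiveOn.of_contDiff ((h.contDiff e).of_le (by simp)), h.memL2,
    h.deriv.memL2, h.finite, fun e => ?_⟩
  obtain ⟨T, hT⟩ := h.exists_forall_ge_eq_zero e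
  obtain ⟨T', hT'⟩ := h.deriv.exists_forall_ge_eq_zero e
  exact ⟨max T T', fun t ht => ⟨hT t ((le_max_left _ _).trans ht),
    hT' t ((le_max_right _ _).trans ht)⟩⟩

end IsSmoothFamily

open Classical in
lemma IsTest.isSmoothFamily {U : Set ℝ} {ψ : ℝ → ℝ} (h : IsTest U ψ) (e : E) :
    IsSmoothFamily (Pi.single e fun t => (ψ t : ℂ) : E → ℝ → ℂ) := by
  refine ⟨fun e' => ?_, fun e' => ?_, (finite_singleton e).subset fun e' he' => ?_⟩
  · by_cases he : e' = e
    · subst he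
      rw [Pi.single_eq_same]
      exact Complex.ofRealCLM.contDiff.comp h.contDiff
    · rw [Pi.single_eq_of_ne he]
      exact contDiff_const
  · by_cases he : e' = e
    · subst he
      rw [Pi.single_eq_same]
      exact h.hasCompactSupport.comp_left Complex.ofReal_zero
    · rw [Pi.single_eq_of_ne he]
      exact HasCompactSupport.zero
  · by_contra hne
    exact he' (Pi.single_eq_of_ne hne _)

open Classical in
lemma inner_mkL2_single {e : E} {p : ℝ → ℂ} (hp : Γ.MemL2 (Pi.single e p)) (f : Γ.L2) :
    ⟪mkL2 _ hp, f⟫_ℂ = ∫ t, f e t * conj (p t) ∂Γ.vol e := by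
  refine (hasSum_inner (mkL2 _ hp) f).unique ?_
  have h1 : ∀ e', ∫ t, f e' t * conj (mkL2 _ hp e' t) ∂Γ.vol e'
      = ∫ t, f e' t * conj ((Pi.single e p : E → ℝ → ℂ) e' t) ∂Γ.vol e' := by
    intro e'
    refine integral_congr_ae ?_
    filter_upwards [coe_mkL2 _ hp e'] with t ht
    rw [ht]
  simp only [h1]
  have := hasSum_single (f := fun e' => ∫ t, f e' t * conj ((Pi.single e p : E → ℝ → ℂ) e' t)
    ∂Γ.vol e') e fun e' he' => by simp [Pi.single_eq_of_ne he']
  simpa using this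

open Classical in
/-- The test functions on the edges are total in `L²(X)`. -/
lemma eq_zero_of_forall_test {h : Γ.L2} (hh : ∀ e ψ, ∀ hψ : IsTest (Γ.interval e) ψ,
    ⟪mkL2 (Γ := Γ) _ (hψ.isSmoothFamily e).memL2, h⟫_ℂ = 0) : h = 0 := by
  refine L2_ext fun e => ?_
  have hO := Γ.isOpen_interval e
  have key := hO.ae_eq_zero_of_integral_contDiff_smul_eq_zero (locallyIntegrableOn_coe h e) ?_
  · have h0 : ((0 : Γ.L2) e : ℝ → ℂ) =ᵐ[Γ.vol e] 0 := by
      rw [lp.coeFn_zero, Pi.zero_apply]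
      exact Lp.coeFn_zero _ _ _
    refine EventuallyEq.trans ?_ h0.symm
    rw [Filter.EventuallyEq, ae_restrict_iff' hO.measurableSet]
    filter_upwards [key] with t ht hmem using ht hmem
  · intro ψ h1 h2 h3
    have hψ : IsTest (Γ.interval e) ψ := ⟨h1, h2, h3⟩
    have := hh e ψ hψ
    rw [inner_mkL2_single] at this
    rw [← setIntegral_eq_integral_of_forall_compl_eq_zero (s := Γ.interval e), ← this]
    · refine integral_congr_ae (Eventually.of_forall fun t => ?_)
      simp [mul_comm]
    · intro t ht
      rw [hψ.eq_zero ht, zero_smul]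

lemma EdgeEnd.point_notMem_interval (k : Γ.EdgeEnd) : k.point ∉ Γ.interval k.edge := by
  rcases k with e | e
  · exact fun h => lt_irrefl _ h.1
  · intro h
    have := h.2
    change ENNReal.ofReal (Γ.l e).toReal < Γ.l e at this
    rw [ENNReal.ofReal_toReal e.2] at this
    exact lt_irrefl _ this

open Classical in
lemma IsTest.bdry_eq_zero {e : E} {ψ : ℝ → ℝ} (hψ : IsTest (Γ.interval e) ψ) (v : V) :
    bdry Γ (Pi.single e fun t => (ψ t : ℂ)) v = 0 := by
  ext k
  change (Pi.single e fun t => (ψ t : ℂ) : E → ℝ → ℂ) k.1.edge k.1.point = 0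
  by_cases he : k.1.edge = e
  · subst he
    rw [Pi.single_eq_same, hψ.eq_zero k.1.point_notMem_interval, Complex.ofReal_zero]
  · rw [Pi.single_eq_of_ne he]
    rfl

/-- The graph of the weak derivative is closed. -/
lemma HasDerivL2.of_tendsto {f g : ℕ → Γ.L2} {f₀ g₀ : Γ.L2} (h : ∀ n, Γ.HasDerivL2 (f n) (g n))
    (hf : Tendsto f atTop (𝓝 f₀)) (hg : Tendsto g atTop (𝓝 g₀)) : Γ.HasDerivL2 f₀ g₀ := by
  classical
  have key : ∀ e ψ, ∀ hψ : IsTest (Γ.interval e) ψ, ∀ k : Γ.L2,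
      ∫ t in Γ.interval e, ψ t • k e t = ⟪mkL2 (Γ := Γ) _ (hψ.isSmoothFamily e).memL2, k⟫_ℂ := by
    intro e ψ hψ k
    rw [inner_mkL2_single]
    refine integral_congr_ae (Eventually.of_forall fun t => ?_)
    simp [mul_comm]
  intro e
  rw [isWeakDeriv_iff]
  intro ψ hψ
  have h1 := fun n => (isWeakDeriv_iff.1 (h n e)) ψ hψ
  rw [key e _ hψ.deriv, key e _ hψ]
  simp only [key e _ hψ.deriv, key e _ hψ] at h1
  refine tendsto_nhds_unique (tendsto_const_nhds.inner hf) ?_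
  exact ((tendsto_const_nhds.inner hg).neg).congr fun n => (h1 n).symm

end MetricGraph

namespace MetricGraph

/-! ### Square roots of positive operators -/

section Sqrt

variable {H : Type*} [NormedAddCommGroup H] [InnerProductSpace ℂ H] [CompleteSpace H]

lemma inner_sqrt_sqrt {A : H →L[ℂ] H} (hA : 0 ≤ A) (x y : H) :
    ⟪CFC.sqrt A x, CFC.sqrt A y⟫_ℂ = ⟪x, A y⟫_ℂ := by
  have hs : (CFC.sqrt A).IsPositive :=
    (ContinuousLinearMap.nonneg_iff_isPositive _).1 (CFC.sqrt_nonneg A)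
  have h1 : ∀ x y, ⟪CFC.sqrt A x, y⟫_ℂ = ⟪x, CFC.sqrt A y⟫_ℂ := hs.isSelfAdjoint.isSymmetric
  have h2 : CFC.sqrt A (CFC.sqrt A y) = A y :=
    congrArg (fun T : H →L[ℂ] H => T y) (CFC.sqrt_mul_sqrt_self A hA)
  rw [h1, h2]

lemma norm_sqrt_sq {A : H →L[ℂ] H} (hA : 0 ≤ A) (x : H) :
    ‖CFC.sqrt A x‖ ^ 2 = (⟪A x, x⟫_ℂ).re := by
  have h1 := inner_sqrt_sqrt hA x x
  rw [inner_self_eq_norm_sq_to_K] at h1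
  have h2 := congrArg Complex.re h1
  rw [← inner_conj_symm, Complex.conj_re] at h2
  rw [← h2]
  norm_cast

lemma norm_sqrt_sq_le {A : H →L[ℂ] H} (hA : 0 ≤ A) {S : ℝ} (hS : ‖A‖ ≤ S) (x : H) :
    ‖CFC.sqrt A x‖ ^ 2 ≤ S * ‖x‖ ^ 2 := by
  rw [norm_sqrt_sq hA]
  calc (⟪A x, x⟫_ℂ).re ≤ ‖A x‖ * ‖x‖ := (Complex.re_le_norm _).trans (norm_inner_le_norm _ _)
    _ ≤ S * ‖x‖ * ‖x‖ := by
        gcongr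
        exact (A.le_opNorm x).trans (by gcongr)
    _ = _ := by ring

end Sqrt

section Potential

variable {E V : Type*} {Γ : MetricGraph E V}

lemma graph_mulOp (W : E → ℝ → ℝ) : (Γ.mulOp W).graph = Γ.mulGraph W := by
  refine Submodule.toLinearPMap_graph_eq _ ?_
  rintro ⟨f, h⟩ hfh rfl
  refine L2_ext fun e => ?_
  have h0 : ((0 : Γ.L2) e : ℝ → ℂ) =ᵐ[Γ.vol e] 0 := by
    rw [lp.coeFn_zero, Pi.zero_apply]
    exact Lp.coeFn_zero _ _ _
  filter_upwards [hfh e, h0] with t h1 h2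
  rw [h1, h2]
  simp

lemma inner_mul_symm {W : E → ℝ → ℝ} {f g k m : Γ.L2} (hf : (f, k) ∈ Γ.mulGraph W)
    (hg : (g, m) ∈ Γ.mulGraph W) : ⟪g, k⟫_ℂ = ⟪m, f⟫_ℂ := by
  refine (hasSum_inner g k).unique ((hasSum_inner m f).congr_fun fun e => ?_)
  refine integral_congr_ae ?_
  filter_upwards [hf e, hg e] with t h1 h2
  have h1' : k e t = (W e t : ℂ) * f e t := h1
  have h2' : m e t = (W e t : ℂ) * g e t := h2
  rw [h1', h2', map_mul, Complex.conj_ofReal]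
  ring

end Potential

section Form

variable {E V : Type*} {Γ : MetricGraph E V} [∀ v, Fintype (Γ.Ends v)]

namespace BoundaryCondition

variable {B : Γ.BoundaryCondition}

lemma L_pos_nonneg (v : V) : 0 ≤ (B.L v)⁺ := CFC.posPart_nonneg (B.L v)

lemma L_neg_nonneg (v : V) : 0 ≤ (B.L v)⁻ := CFC.negPart_nonneg (B.L v)

variable (B) in
/-- The square root of the positive part of `L_v`. -/
@[irreducible]
noncomputable def sqrtPos (v : V) : Γ.BdrySpace v →L[ℂ] Γ.BdrySpace v := CFC.sqrt (B.L v)⁺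

variable (B) in
/-- The square root of the negative part of `L_v`. -/
@[irreducible]
noncomputable def sqrtNeg (v : V) : Γ.BdrySpace v →L[ℂ] Γ.BdrySpace v := CFC.sqrt (B.L v)⁻

lemma inner_sqrtPos (v : V) (x y : Γ.BdrySpace v) :
    ⟪B.sqrtPos v x, B.sqrtPos v y⟫_ℂ = ⟪x, (B.L v)⁺ y⟫_ℂ := by
  rw [sqrtPos]; exact inner_sqrt_sqrt (L_pos_nonneg v) x y

lemma inner_sqrtNeg (v : V) (x y : Γ.BdrySpace v) :
    ⟪B.sqrtNeg v x, B.sqrtNeg v y⟫_ℂ = ⟪x, (B.L v)⁻ y⟫_ℂ := by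
  rw [sqrtNeg]; exact inner_sqrt_sqrt (L_neg_nonneg v) x y

lemma norm_sqrtPos_sq (v : V) (x : Γ.BdrySpace v) :
    ‖B.sqrtPos v x‖ ^ 2 = (⟪(B.L v)⁺ x, x⟫_ℂ).re := by
  rw [sqrtPos]; exact norm_sqrt_sq (L_pos_nonneg v) x

lemma norm_sqrtNeg_sq (v : V) (x : Γ.BdrySpace v) :
    ‖B.sqrtNeg v x‖ ^ 2 = (⟪(B.L v)⁻ x, x⟫_ℂ).re := by
  rw [sqrtNeg]; exact norm_sqrt_sq (L_neg_nonneg v) x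

lemma norm_sqrtPos_sq_le {v : V} {S : ℝ} (hS : ‖(B.L v)⁺‖ ≤ S) (x : Γ.BdrySpace v) :
    ‖B.sqrtPos v x‖ ^ 2 ≤ S * ‖x‖ ^ 2 := by
  rw [sqrtPos]; exact norm_sqrt_sq_le (L_pos_nonneg v) hS x

lemma L_apply_eq (v : V) (x : Γ.BdrySpace v) : B.L v x = (B.L v)⁺ x - (B.L v)⁻ x := by
  conv_lhs => rw [← CFC.posPart_sub_negPart (B.L v) (B.isSelfAdjoint_L v)]
  rfl

lemma mem_formDomain {u : ℝ} (hu : 0 < u) (hLB : ∀ e, ENNReal.ofReal u ≤ Γ.l e) {S : ℝ}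
    (hUB : ∀ v, ‖(B.L v)⁺‖ ≤ S) {f g : Γ.L2} (hfg : Γ.HasDerivL2 f g)
    (hP : ∀ v, B.P v (Γ.trace f v) = 0)
    (hL : Summable fun v => (⟪(B.L v)⁻ (Γ.trace f v), Γ.trace f v⟫_ℂ).re) :
    f ∈ B.formDomain := by
  refine ⟨⟨g, hfg⟩, hfg.hasTraces, hP, ?_, hL⟩
  refine Summable.of_nonneg_of_le (fun v => ?_) (fun v => ?_)
    ((summable_norm_trace_sq hu hLB hfg).mul_left S)
  · rw [← norm_sqrtPos_sq v]; positivity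
  · rw [← norm_sqrtPos_sq v]
    exact norm_sqrtPos_sq_le (hUB v) _

lemma mem_formDomain_of_finite {f g : Γ.L2} (hfg : Γ.HasDerivL2 f g)
    (hP : ∀ v, B.P v (Γ.trace f v) = 0) (hfin : {v | Γ.trace f v ≠ 0}.Finite) :
    f ∈ B.formDomain := by
  refine ⟨⟨g, hfg⟩, hfg.hasTraces, hP, ?_, ?_⟩ <;>
  · refine summable_of_hasFiniteSupport (hfin.subset fun v hv h0 => hv ?_)
    simp [h0]

lemma test_mem_formDomain {e : E} {ψ : ℝ → ℝ} (hψ : IsTest (Γ.interval e) ψ) :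
    mkL2 _ (hψ.isSmoothFamily e).memL2 ∈ B.formDomain := by
  have hr := (hψ.isSmoothFamily e).isCompactRep.isRep (Γ := Γ)
  have h0 : ∀ v, Γ.trace (mkL2 _ (hψ.isSmoothFamily e).memL2) v = 0 := fun v => by
    rw [hr.trace_eq_bdry, hψ.bdry_eq_zero]
  refine mem_formDomain_of_finite hr.hasDerivL2 (fun v => by rw [h0, map_zero]) ?_
  simp [h0]

lemma eq_zero_of_forall_formDomain {h : Γ.L2} (hh : ∀ g ∈ B.formDomain, ⟪g, h⟫_ℂ = 0) : h = 0 :=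
  eq_zero_of_forall_test fun _ _ hψ => hh _ (test_mem_formDomain hψ)

lemma form_zero_left (g : Γ.L2) : B.form 0 g = 0 := by
  have := form_smul (0 : ℂ) g B.formDomain.zero_mem
  rwa [zero_smul, zero_mul] at this

lemma graph_H₀ : B.H₀.graph = B.opGraph := by
  refine Submodule.toLinearPMap_graph_eq _ ?_
  rintro ⟨f, h⟩ ⟨hf, hfh⟩ rfl
  refine eq_zero_of_forall_formDomain (B := B) fun g hg => ?_
  rw [← hfh g hg, form_zero_left]

end BoundaryCondition

namespace BoundaryCondition

variable (B : Γ.BoundaryCondition)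

/-! ### The form domain as a Hilbert space -/

/-- The form domain, realized as the closed subspace of the triples `(f, f', ((L_v⁻)^{1/2} f(v))_v)`. -/
noncomputable def formSpace :
    Submodule ℂ (WithLp 2 (WithLp 2 (Γ.L2 × Γ.L2) × lp (fun v => Γ.BdrySpace v) 2)) where
  carrier := {x | Γ.HasDerivL2 x.fst.fst x.fst.snd ∧
    ∀ v, B.P v (Γ.trace x.fst.fst v) = 0 ∧
      x.snd v = B.sqrtNeg v (Γ.trace x.fst.fst v)}
  add_mem' := by
    rintro x y ⟨hx, hx'⟩ ⟨hy, hy'⟩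
    refine ⟨hx.add hy, fun v => ?_⟩
    have ht : Γ.trace (x + y).fst.fst v = Γ.trace x.fst.fst v + Γ.trace y.fst.fst v :=
      trace_add hx.hasTraces hy.hasTraces v
    rw [ht, map_add, map_add, (hx' v).1, (hy' v).1, ← (hx' v).2, ← (hy' v).2]
    exact ⟨add_zero _, rfl⟩
  zero_mem' := by
    have h0 : Γ.HasDerivL2 0 0 := by
      obtain ⟨g, hg⟩ := B.formDomain.zero_mem.1
      have := hg.smul 0
      rwa [zero_smul, zero_smul] at this
    refine ⟨h0, fun v => ?_⟩
    have ht : Γ.trace (0 : Γ.L2) v = 0 := by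
      have := trace_smul (0 : ℂ) h0.hasTraces v
      rwa [zero_smul, zero_smul] at this
    change B.P v (Γ.trace 0 v) = 0 ∧ (0 : Γ.BdrySpace v) = B.sqrtNeg v (Γ.trace 0 v)
    rw [ht, map_zero, map_zero]
    exact ⟨rfl, rfl⟩
  smul_mem' := by
    rintro c x ⟨hx, hx'⟩
    refine ⟨hx.smul c, fun v => ?_⟩
    have ht : Γ.trace (c • x).fst.fst v = c • Γ.trace x.fst.fst v :=
      trace_smul c hx.hasTraces v
    rw [ht, map_smul, map_smul, (hx' v).1, ← (hx' v).2]
    exact ⟨smul_zero _, rfl⟩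

/-- The function underlying an element of the form space. -/
noncomputable def toL2 : B.formSpace →L[ℂ] Γ.L2 :=
  WithLp.fstL 2 ℂ _ _ ∘L WithLp.fstL 2 ℂ _ _ ∘L B.formSpace.subtypeL

/-- The derivative of an element of the form space. -/
noncomputable def toDeriv : B.formSpace →L[ℂ] Γ.L2 :=
  WithLp.sndL 2 ℂ _ _ ∘L WithLp.fstL 2 ℂ _ _ ∘L B.formSpace.subtypeL

/-- The boundary part of an element of the form space. -/
noncomputable def toNegTrace : B.formSpace →L[ℂ] lp (fun v => Γ.BdrySpace v) 2 :=
  WithLp.sndL 2 ℂ _ _ ∘L B.formSpace.subtypeL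

variable {B}

lemma hasDerivL2_toL2 (x : B.formSpace) : Γ.HasDerivL2 (B.toL2 x) (B.toDeriv x) := x.2.1

lemma P_trace_toL2 (x : B.formSpace) (v : V) : B.P v (Γ.trace (B.toL2 x) v) = 0 := (x.2.2 v).1

lemma toNegTrace_apply (x : B.formSpace) (v : V) :
    B.toNegTrace x v = B.sqrtNeg v (Γ.trace (B.toL2 x) v) := (x.2.2 v).2

lemma norm_sq_formSpace (x : B.formSpace) :
    ‖x‖ ^ 2 = ‖B.toL2 x‖ ^ 2 + ‖B.toDeriv x‖ ^ 2 + ‖B.toNegTrace x‖ ^ 2 := by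
  have h1 : ‖x‖ = ‖(x : WithLp 2 (WithLp 2 (Γ.L2 × Γ.L2) × lp (fun v => Γ.BdrySpace v) 2))‖ := rfl
  rw [h1, WithLp.prod_norm_sq_eq_of_L2, WithLp.prod_norm_sq_eq_of_L2]
  rfl

lemma trace_sub_norm_le {u : ℝ} (hu : 0 < u) (hLB : ∀ e, ENNReal.ofReal u ≤ Γ.l e)
    {f f' g g' : Γ.L2} (hf : Γ.HasDerivL2 f f') (hg : Γ.HasDerivL2 g g') (v : V) :
    ‖Γ.trace f v - Γ.trace g v‖ ^ 2 ≤ 4 / u * ‖f - g‖ ^ 2 + 4 * u * ‖f' - g'‖ ^ 2 := by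
  have hd : Γ.HasDerivL2 (f - g) (f' - g') := by
    have := hf.add (hg.smul (-1))
    simpa [sub_eq_add_neg] using this
  have ht : Γ.trace (f - g) v = Γ.trace f v - Γ.trace g v := by
    have h1 := trace_add hf.hasTraces (hg.hasTraces.smul (-1)) v
    rw [trace_smul _ hg.hasTraces] at h1
    simpa [sub_eq_add_neg] using h1
  rw [← ht]
  refine le_trans ?_ (tsum_norm_trace_sq_le hu le_rfl hLB hd)
  exact (summable_norm_trace_sq hu hLB hd).le_tsum v fun _ _ => by positivity

lemma isClosed_formSpace {u : ℝ} (hu : 0 < u) (hLB : ∀ e, ENNReal.ofReal u ≤ Γ.l e) :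
    IsClosed (B.formSpace : Set (WithLp 2 (WithLp 2 (Γ.L2 × Γ.L2) ×
      lp (fun v => Γ.BdrySpace v) 2))) := by
  refine IsSeqClosed.isClosed fun x x₀ hx hlim => ?_
  have h1 : Tendsto (fun n => (x n).fst) atTop (𝓝 x₀.fst) :=
    ((WithLp.fstL 2 ℂ _ _).continuous.tendsto x₀).comp hlim
  have hf : Tendsto (fun n => (x n).fst.fst) atTop (𝓝 x₀.fst.fst) :=
    ((WithLp.fstL 2 ℂ _ _).continuous.tendsto _).comp h1
  have hg : Tendsto (fun n => (x n).fst.snd) atTop (𝓝 x₀.fst.snd) :=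
    ((WithLp.sndL 2 ℂ _ _).continuous.tendsto _).comp h1
  have hb : Tendsto (fun n => (x n).snd) atTop (𝓝 x₀.snd) :=
    ((WithLp.sndL 2 ℂ _ _).continuous.tendsto _).comp hlim
  have hd : Γ.HasDerivL2 x₀.fst.fst x₀.fst.snd :=
    HasDerivL2.of_tendsto (fun n => (hx n).1) hf hg
  have ht : ∀ v, Tendsto (fun n => Γ.trace (x n).fst.fst v) atTop (𝓝 (Γ.trace x₀.fst.fst v)) := by
    intro v
    rw [tendsto_iff_norm_sub_tendsto_zero]
    have hz : Tendsto (fun n => 4 / u * ‖(x n).fst.fst - x₀.fst.fst‖ ^ 2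
        + 4 * u * ‖(x n).fst.snd - x₀.fst.snd‖ ^ 2) atTop (𝓝 0) := by
      have a1 := ((tendsto_iff_norm_sub_tendsto_zero.1 hf).pow 2).const_mul (4 / u)
      have a2 := ((tendsto_iff_norm_sub_tendsto_zero.1 hg).pow 2).const_mul (4 * u)
      simpa using a1.add a2
    have h2 : Tendsto (fun n => ‖Γ.trace (x n).fst.fst v - Γ.trace x₀.fst.fst v‖ ^ 2) atTop
        (𝓝 0) :=
      squeeze_zero (fun n => by positivity)
        (fun n => trace_sub_norm_le hu hLB (hx n).1 hd v) hz
    have h3 := h2.sqrt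
    simpa [Real.sqrt_sq (norm_nonneg _)] using h3
  refine ⟨hd, fun v => ⟨?_, ?_⟩⟩
  · refine tendsto_nhds_unique (((B.P v).continuous.tendsto _).comp (ht v)) ?_
    refine tendsto_const_nhds.congr fun n => ?_
    exact ((hx n).2 v).1.symm
  · have hbv : Tendsto (fun n => (x n).snd v) atTop (𝓝 (x₀.snd v)) := by
      have := (lp.uniformContinuous_coe (p := 2) (E := fun v => Γ.BdrySpace v)).continuous.tendsto
        x₀.snd
      exact (tendsto_pi_nhds.1 (this.comp hb)) v
    refine tendsto_nhds_unique hbv ?_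
    refine (((B.sqrtNeg v).continuous.tendsto _).comp (ht v)).congr fun n => ?_
    exact ((hx n).2 v).2.symm

lemma norm_lp_sq {x : lp (fun v => Γ.BdrySpace v) 2} : HasSum (fun v => ‖x v‖ ^ 2) (‖x‖ ^ 2) := by
  have := lp.hasSum_norm (p := 2) (by norm_num) x
  simpa using this

lemma toL2_mem_formDomain {u : ℝ} (hu : 0 < u) (hLB : ∀ e, ENNReal.ofReal u ≤ Γ.l e) {S : ℝ}
    (hUB : ∀ v, ‖(B.L v)⁺‖ ≤ S) (x : B.formSpace) : B.toL2 x ∈ B.formDomain := by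
  refine mem_formDomain hu hLB hUB (hasDerivL2_toL2 x) (P_trace_toL2 x) ?_
  refine (norm_lp_sq (x := B.toNegTrace x)).summable.congr fun v => ?_
  rw [toNegTrace_apply, norm_sqrtNeg_sq v]

lemma exists_toL2_eq {f : Γ.L2} (hf : f ∈ B.formDomain) : ∃ x : B.formSpace, B.toL2 x = f := by
  obtain ⟨⟨g, hg⟩, -, hP, -, hneg⟩ := hf
  have hmem : Memℓp (fun v => B.sqrtNeg v (Γ.trace f v)) 2 := by
    refine memℓp_gen (hneg.congr fun v => ?_)
    rw [← norm_sqrtNeg_sq v]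
    simp
  exact ⟨⟨WithLp.toLp 2 (WithLp.toLp 2 (f, g), ⟨_, hmem⟩), hg, fun v => ⟨hP v, rfl⟩⟩, rfl⟩

lemma add_le_add_mul_add {p q a b c : ℝ} (hp : 0 ≤ p) (hq : 0 ≤ q) (ha : 0 ≤ a) (hb : 0 ≤ b)
    (hc : 0 ≤ c) : p * a + q * b ≤ (p + q) * (a + b + c) := by
  nlinarith [mul_nonneg hp hb, mul_nonneg hp hc, mul_nonneg hq ha, mul_nonneg hq hc]

/-- The boundary values weighted by the square roots of the `L_v⁺`. -/
lemma exists_posTrace {u : ℝ} (hu : 0 < u) (hLB : ∀ e, ENNReal.ofReal u ≤ Γ.l e) {S : ℝ}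
    (hS : 0 < S) (hUB : ∀ v, ‖(B.L v)⁺‖ ≤ S) :
    ∃ J : B.formSpace →L[ℂ] lp (fun v => Γ.BdrySpace v) 2,
      (∀ x v, J x v = B.sqrtPos v (Γ.trace (B.toL2 x) v)) ∧
      ∀ x δ, 0 < δ → δ ≤ u →
        ‖J x‖ ^ 2 ≤ S * (4 / δ * ‖B.toL2 x‖ ^ 2 + 4 * δ * ‖B.toDeriv x‖ ^ 2) := by
  have hle : ∀ (x : B.formSpace) v, ‖B.sqrtPos v (Γ.trace (B.toL2 x) v)‖ ^ 2
      ≤ S * ‖Γ.trace (B.toL2 x) v‖ ^ 2 := fun x v =>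
    norm_sqrtPos_sq_le (hUB v) _
  have hmem : ∀ x : B.formSpace,
      Memℓp (fun v => B.sqrtPos v (Γ.trace (B.toL2 x) v)) 2 := fun x => by
    refine memℓp_gen ?_
    have : Summable fun v => ‖B.sqrtPos v (Γ.trace (B.toL2 x) v)‖ ^ 2 :=
      Summable.of_nonneg_of_le (fun v => by positivity) (hle x)
        ((summable_norm_trace_sq hu hLB (hasDerivL2_toL2 x)).mul_left S)
    simpa using this
  have hadd : ∀ (x y : B.formSpace) v, B.sqrtPos v (Γ.trace (B.toL2 (x + y)) v)
      = B.sqrtPos v (Γ.trace (B.toL2 x) v) + B.sqrtPos v (Γ.trace (B.toL2 y) v) := fun x y v => by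
    rw [map_add B.toL2, trace_add (hasDerivL2_toL2 x).hasTraces (hasDerivL2_toL2 y).hasTraces,
      map_add (B.sqrtPos v)]
  have hsmul : ∀ (c : ℂ) (x : B.formSpace) v, B.sqrtPos v (Γ.trace (B.toL2 (c • x)) v)
      = c • B.sqrtPos v (Γ.trace (B.toL2 x) v) := fun c x v => by
    rw [map_smul B.toL2, trace_smul c (hasDerivL2_toL2 x).hasTraces, map_smul (B.sqrtPos v)]
  let J₀ : B.formSpace →ₗ[ℂ] lp (fun v => Γ.BdrySpace v) 2 :=
    { toFun := fun x => ⟨_, hmem x⟩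
      map_add' := fun x y => lp.ext (funext fun v => hadd x y v)
      map_smul' := fun c x => lp.ext (funext fun v => hsmul c x v) }
  have hJ₀ : ∀ x δ, 0 < δ → δ ≤ u →
      ‖J₀ x‖ ^ 2 ≤ S * (4 / δ * ‖B.toL2 x‖ ^ 2 + 4 * δ * ‖B.toDeriv x‖ ^ 2) := by
    intro x δ hδ hδu
    have h1 := tsum_norm_trace_sq_le hδ hδu hLB (hasDerivL2_toL2 x)
    refine le_trans ?_ (mul_le_mul_of_nonneg_left h1 hS.le)
    rw [← tsum_mul_left]
    have h2 : HasSum (fun v => ‖B.sqrtPos v (Γ.trace (B.toL2 x) v)‖ ^ 2) (‖J₀ x‖ ^ 2) :=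
      norm_lp_sq (x := J₀ x)
    exact hasSum_le (hle x) h2
      ((summable_norm_trace_sq hu hLB (hasDerivL2_toL2 x)).mul_left S).hasSum
  refine ⟨J₀.mkContinuous (Real.sqrt (S * (4 / u + 4 * u))) fun x => ?_, fun x v => rfl, hJ₀⟩
  refine le_of_sq_le_sq ?_ (by positivity)
  rw [mul_pow, Real.sq_sqrt (by positivity), mul_assoc]
  refine (hJ₀ x u hu le_rfl).trans (mul_le_mul_of_nonneg_left ?_ hS.le)
  rw [norm_sq_formSpace]
  exact add_le_add_mul_add (by positivity) (by positivity) (by positivity) (by positivity)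
    (by positivity)

/-- Multiplication by the potential as a bounded operator on the form space. -/
lemma exists_mulCLM {u : ℝ} (hu : 0 < u) (hLB : ∀ e, ENNReal.ofReal u ≤ Γ.l e)
    {W : E → ℝ → ℝ} (hW : Γ.IsUnifLocL2 u W) :
    ∃ J : B.formSpace →L[ℂ] Γ.L2, (∀ x, (B.toL2 x, J x) ∈ Γ.mulGraph W) ∧ ∃ M : ℝ, 0 ≤ M ∧
      ∀ x δ, 0 < δ → δ ≤ u →
        ‖J x‖ ^ 2 ≤ M * (2 / δ * ‖B.toL2 x‖ ^ 2 + 2 * δ * ‖B.toDeriv x‖ ^ 2) := by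
  obtain ⟨M, hM, hMb⟩ := hW.exists_mul_bound hu hLB
  have huniq : ∀ {f k k' : Γ.L2}, (f, k) ∈ Γ.mulGraph W → (f, k') ∈ Γ.mulGraph W → k = k' := by
    intro f k k' h1 h2
    refine L2_ext fun e => ?_
    filter_upwards [h1 e, h2 e] with t h3 h4
    exact h3.trans h4.symm
  choose J hJ hJb using fun x : B.formSpace => hMb _ _ (hasDerivL2_toL2 x)
  have hadd : ∀ x y, J (x + y) = J x + J y := fun x y => by
    have h := (Γ.mulGraph W).add_mem (hJ x) (hJ y)
    rw [Prod.mk_add_mk, ← map_add] at h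
    exact huniq (hJ _) h
  have hsmul : ∀ (c : ℂ) x, J (c • x) = c • J x := fun c x => by
    have h := (Γ.mulGraph W).smul_mem c (hJ x)
    rw [Prod.smul_mk, ← map_smul] at h
    exact huniq (hJ _) h
  let J₀ : B.formSpace →ₗ[ℂ] Γ.L2 :=
    { toFun := J
      map_add' := hadd
      map_smul' := hsmul }
  refine ⟨J₀.mkContinuous (Real.sqrt (M * (2 / u + 2 * u))) fun x => ?_, hJ, M, hM, hJb⟩
  refine le_of_sq_le_sq ?_ (by positivity)
  rw [mul_pow, Real.sq_sqrt (by positivity), mul_assoc]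
  refine (hJb x u hu le_rfl).trans (mul_le_mul_of_nonneg_left ?_ hM)
  rw [norm_sq_formSpace]
  exact add_le_add_mul_add (by positivity) (by positivity) (by positivity) (by positivity)
    (by positivity)

lemma form_toL2 {J : B.formSpace →L[ℂ] lp (fun v => Γ.BdrySpace v) 2}
    (hJ : ∀ x v, J x v = B.sqrtPos v (Γ.trace (B.toL2 x) v)) (x y : B.formSpace) :
    B.form (B.toL2 x) (B.toL2 y) = ⟪B.toDeriv y, B.toDeriv x⟫_ℂ
      + ⟪B.toNegTrace y, B.toNegTrace x⟫_ℂ - ⟪J y, J x⟫_ℂ := by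
  have h1 := (lp.hasSum_inner (𝕜 := ℂ) (J y) (J x)).sub
    (lp.hasSum_inner (𝕜 := ℂ) (B.toNegTrace y) (B.toNegTrace x))
  have h2 : HasSum (fun v => ⟪Γ.trace (B.toL2 y) v, B.L v (Γ.trace (B.toL2 x) v)⟫_ℂ)
      (⟪J y, J x⟫_ℂ - ⟪B.toNegTrace y, B.toNegTrace x⟫_ℂ) := by
    refine h1.congr_fun fun v => ?_
    rw [hJ, hJ, toNegTrace_apply, toNegTrace_apply, inner_sqrtPos,
      inner_sqrtNeg, L_apply_eq v (Γ.trace (B.toL2 x) v), inner_sub_right]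
  rw [form, (hasDerivL2_toL2 x).derivL2_eq, (hasDerivL2_toL2 y).derivL2_eq, h2.tsum_eq]
  ring

end BoundaryCondition

end Form

end MetricGraph

namespace MetricGraph

lemma exists_form_operator {G H K : Type*} [NormedAddCommGroup G] [InnerProductSpace ℂ G]
    [CompleteSpace G] [NormedAddCommGroup H] [InnerProductSpace ℂ H] [CompleteSpace H]
    [NormedAddCommGroup K] [InnerProductSpace ℂ K] [CompleteSpace K]
    (J D M : G →L[ℂ] H) (A B : G →L[ℂ] K) (c : ℂ) :
    ∃ T : G →L[ℂ] G, ∀ x y, ⟪y, T x⟫_ℂ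
      = ⟪D y, D x⟫_ℂ + ⟪A y, A x⟫_ℂ - ⟪B y, B x⟫_ℂ + ⟪J y, M x⟫_ℂ + c * ⟪J y, J x⟫_ℂ := by
  refine ⟨D.adjoint ∘L D + A.adjoint ∘L A - B.adjoint ∘L B + J.adjoint ∘L M
    + c • (J.adjoint ∘L J), fun x y => ?_⟩
  simp only [add_apply, sub_apply, smul_apply, ContinuousLinearMap.comp_apply, inner_add_right,
    inner_sub_right, inner_smul_right, ContinuousLinearMap.adjoint_inner_right]

lemma coercive_arith {S M u : ℝ} (hS : 0 < S) (hM : 0 ≤ M) (hu : 0 < u) :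
    ∃ C₀ : ℝ, 0 < C₀ ∧ ∃ δ : ℝ, 0 < δ ∧ δ ≤ u ∧ ∀ C ≥ C₀, ∀ a b c j w r : ℝ,
      j ^ 2 ≤ S * (4 / δ * a ^ 2 + 4 * δ * b ^ 2) →
      w ^ 2 ≤ M * (2 / δ * a ^ 2 + 2 * δ * b ^ 2) → -(a * w) ≤ r →
      1 / 2 * (a ^ 2 + b ^ 2 + c ^ 2) ≤ b ^ 2 + c ^ 2 - j ^ 2 + r + C * a ^ 2 := by
  set q : ℝ := 1 / (2 * (4 * S + M)) with hq
  have hq0 : 0 < q := by positivity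
  set δ := min u q with hδ
  have hδ0 : 0 < δ := lt_min hu hq0
  have hδq : δ * (4 * S + M) ≤ 1 / 2 := by
    calc δ * (4 * S + M) ≤ q * (4 * S + M) := by
          gcongr
          exact min_le_right _ _
      _ = 1 / 2 := by
          rw [hq]
          field_simp
  refine ⟨4 * S / δ + M / δ + 1, by positivity, δ, hδ0, min_le_left _ _, ?_⟩
  intro C hC a b c j w r hj hw hr
  have h1 : -(a * w) ≥ -(a ^ 2 + w ^ 2) / 2 := by nlinarith [sq_nonneg (a - w)]
  have h2 : (δ * (4 * S + M)) * b ^ 2 ≤ 1 / 2 * b ^ 2 := by gcongr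
  have h3 : (4 * S / δ + M / δ + 1) * a ^ 2 ≤ C * a ^ 2 := by gcongr
  have e1 : S * (4 / δ * a ^ 2 + 4 * δ * b ^ 2) = 4 * S / δ * a ^ 2 + 4 * S * δ * b ^ 2 := by ring
  have e2 : M * (2 / δ * a ^ 2 + 2 * δ * b ^ 2) = 2 * (M / δ * a ^ 2) + 2 * (M * δ * b ^ 2) := by
    ring
  rw [e1] at hj
  rw [e2] at hw
  nlinarith [sq_nonneg c, sq_nonneg a]

lemma exists_coercive_form_operator {G H K : Type*} [NormedAddCommGroup G] [InnerProductSpace ℂ G]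
    [CompleteSpace G] [NormedAddCommGroup H] [InnerProductSpace ℂ H] [CompleteSpace H]
    [NormedAddCommGroup K] [InnerProductSpace ℂ K] [CompleteSpace K]
    (J D N : G →L[ℂ] H) (A P : G →L[ℂ] K)
    (hnorm : ∀ x, ‖x‖ ^ 2 = ‖J x‖ ^ 2 + ‖D x‖ ^ 2 + ‖A x‖ ^ 2)
    (hsymm : ∀ x y, ⟪J y, N x⟫_ℂ = ⟪N y, J x⟫_ℂ)
    {S M u : ℝ} (hS : 0 < S) (hM : 0 ≤ M) (hu : 0 < u)
    (hP : ∀ x δ, 0 < δ → δ ≤ u → ‖P x‖ ^ 2 ≤ S * (4 / δ * ‖J x‖ ^ 2 + 4 * δ * ‖D x‖ ^ 2))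
    (hN : ∀ x δ, 0 < δ → δ ≤ u → ‖N x‖ ^ 2 ≤ M * (2 / δ * ‖J x‖ ^ 2 + 2 * δ * ‖D x‖ ^ 2)) :
    ∃ C₀ : ℝ, 0 < C₀ ∧ ∀ C ≥ C₀, ∃ T : G →L[ℂ] G,
      (∀ x y, ⟪T x, y⟫_ℂ = ⟪x, T y⟫_ℂ) ∧ (∀ x, 1 / 2 * ‖x‖ ^ 2 ≤ (⟪T x, x⟫_ℂ).re) ∧
      ∀ x y, ⟪y, T x⟫_ℂ = ⟪D y, D x⟫_ℂ + ⟪A y, A x⟫_ℂ - ⟪P y, P x⟫_ℂ + ⟪J y, N x⟫_ℂ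
        + (C : ℂ) * ⟪J y, J x⟫_ℂ := by
  obtain ⟨C₀, hC₀, δ, hδ, hδu, H⟩ := coercive_arith hS hM hu
  refine ⟨C₀, hC₀, fun C hC => ?_⟩
  obtain ⟨T, hT⟩ := exists_form_operator J D N A P (C : ℂ)
  refine ⟨T, fun x y => ?_, fun x => ?_, hT⟩
  · rw [← inner_conj_symm, hT, hT]
    simp only [map_add, map_sub, map_mul, inner_conj_symm, Complex.conj_ofReal]
    rw [hsymm y x]
  · have h2 : (⟪T x, x⟫_ℂ).re = (⟪x, T x⟫_ℂ).re := by rw [← inner_conj_symm, Complex.conj_re]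
    rw [h2, hT, inner_self_eq_norm_sq_to_K, inner_self_eq_norm_sq_to_K, inner_self_eq_norm_sq_to_K,
      inner_self_eq_norm_sq_to_K, hnorm]
    refine (H C hC _ _ _ _ _ (⟪J x, N x⟫_ℂ).re (hP x δ hδ hδu) (hN x δ hδ hδu) ?_).trans
      (le_of_eq ?_)
    · exact (abs_le.1 ((Complex.abs_re_le_norm _).trans (norm_inner_le_norm _ _))).1
    · simp only [Complex.add_re, Complex.sub_re, Complex.re_ofReal_mul]
      norm_cast

variable {E V : Type*} {Γ : MetricGraph E V}

lemma isUnifLocL2_zero (u : ℝ) : Γ.IsUnifLocL2 u (0 : E → ℝ → ℝ) :=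
  ⟨fun _ => aestronglyMeasurable_const, 0, fun _ _ _ _ _ _ _ => by simp⟩

variable [∀ v, Fintype (Γ.Ends v)]

namespace BoundaryCondition

variable {B : Γ.BoundaryCondition}

/-- Bounded maps on a Hilbert space `G` that represent the form domain, the derivative, the
multiplication by `W` and the two parts of the vertex terms of the form. -/
structure IsFormModel (B : Γ.BoundaryCondition) (W : E → ℝ → ℝ) (S M u : ℝ) {G K : Type*}
    [NormedAddCommGroup G] [InnerProductSpace ℂ G] [NormedAddCommGroup K] [InnerProductSpace ℂ K]
    (J D N : G →L[ℂ] Γ.L2) (A P : G →L[ℂ] K) : Prop where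
  norm_sq : ∀ x, ‖x‖ ^ 2 = ‖J x‖ ^ 2 + ‖D x‖ ^ 2 + ‖A x‖ ^ 2
  hasDeriv : ∀ x, Γ.HasDerivL2 (J x) (D x)
  mul_mem : ∀ x, (J x, N x) ∈ Γ.mulGraph W
  mem_formDomain : ∀ x, J x ∈ B.formDomain
  surj : ∀ f ∈ B.formDomain, ∃ x, J x = f
  form_eq : ∀ x y, B.form (J x) (J y) = ⟪D y, D x⟫_ℂ + ⟪A y, A x⟫_ℂ - ⟪P y, P x⟫_ℂ
  norm_pos_sq_le : ∀ x δ, 0 < δ → δ ≤ u → ‖P x‖ ^ 2 ≤ S * (4 / δ * ‖J x‖ ^ 2 + 4 * δ * ‖D x‖ ^ 2)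
  norm_mul_sq_le : ∀ x δ, 0 < δ → δ ≤ u → ‖N x‖ ^ 2 ≤ M * (2 / δ * ‖J x‖ ^ 2 + 2 * δ * ‖D x‖ ^ 2)

section Model

variable {G K : Type*} [NormedAddCommGroup G] [InnerProductSpace ℂ G]
  [NormedAddCommGroup K] [InnerProductSpace ℂ K]
  {W : E → ℝ → ℝ} {S M u : ℝ} {J D N : G →L[ℂ] Γ.L2} {A P : G →L[ℂ] K}

/-- The shifted form of `H₀ + W` is given by a coercive symmetric operator on the form space. -/
lemma IsFormModel.exists_coercive [CompleteSpace G] [CompleteSpace K]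
    (h : IsFormModel B W S M u J D N A P) (hS : 0 < S) (hM : 0 ≤ M)
    (hu : 0 < u) :
    ∃ C₀ : ℝ, 0 < C₀ ∧ ∀ C ≥ C₀, ∃ T : G →L[ℂ] G,
      (∀ x y, ⟪T x, y⟫_ℂ = ⟪x, T y⟫_ℂ) ∧ (∀ x, 1 / 2 * ‖x‖ ^ 2 ≤ (⟪T x, x⟫_ℂ).re) ∧
      ∀ x y, ⟪y, T x⟫_ℂ = B.form (J x) (J y) + ⟪J y, N x⟫_ℂ + C * ⟪J y, J x⟫_ℂ := by
  obtain ⟨C₀, hC₀, H⟩ := exists_coercive_form_operator J D N A P h.norm_sq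
    (fun x y => inner_mul_symm (h.mul_mem x) (h.mul_mem y)) hS hM hu h.norm_pos_sq_le
    h.norm_mul_sq_le
  refine ⟨C₀, hC₀, fun C hC => ?_⟩
  obtain ⟨T, hTs, hTc, hT⟩ := H C hC
  refine ⟨T, hTs, hTc, fun x y => ?_⟩
  rw [h.form_eq x y]
  exact hT x y

/-- The operator `H₀ + W + C` is associated with its form. -/
lemma IsFormModel.mem_graph_shift_iff (h : IsFormModel B W S M u J D N A P) {C : ℝ} {T : G → G}
    (hT : ∀ x y, ⟪y, T x⟫_ℂ = B.form (J x) (J y) + ⟪J y, N x⟫_ℂ + C * ⟪J y, J x⟫_ℂ)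
    (f k : Γ.L2) :
    (f, k) ∈ (shift (B.H₀ + Γ.mulOp W) C).graph ↔
      ∃ x, J x = f ∧ ∀ y, ⟪y, T x⟫_ℂ = ⟪J y, k⟫_ℂ := by
  rw [MetricGraph.mem_graph_shift_iff, mem_graph_add_iff, graph_H₀, graph_mulOp]
  constructor
  · rintro ⟨a, b, ha, hb, hab⟩
    obtain ⟨x, rfl⟩ := h.surj f ha.1
    obtain rfl : N x = b := L2_ext fun e => by
      filter_upwards [h.mul_mem x e, hb e] with t h1 h2
      exact h1.trans h2.symm
    refine ⟨x, rfl, fun y => ?_⟩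
    have h1 : B.form (J x) (J y) = ⟪J y, a⟫_ℂ := ha.2 _ (h.mem_formDomain y)
    have h2 : ⟪J y, k⟫_ℂ - C * ⟪J y, J x⟫_ℂ = ⟪J y, a⟫_ℂ + ⟪J y, N x⟫_ℂ := by
      rw [← inner_smul_right, ← inner_sub_right, hab, inner_add_right]
    rw [hT x y, h1, ← h2]
    ring
  · rintro ⟨x, rfl, hx⟩
    refine ⟨k - (C : ℂ) • J x - N x, N x, ⟨h.mem_formDomain x, fun g hg => ?_⟩, h.mul_mem x,
      (sub_add_cancel _ _).symm⟩
    obtain ⟨y, rfl⟩ := h.surj g hg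
    have h1 := (hT x y).symm.trans (hx y)
    have h2 : ⟪J y, k - (C : ℂ) • J x - N x⟫_ℂ
        = ⟪J y, k⟫_ℂ - C * ⟪J y, J x⟫_ℂ - ⟪J y, N x⟫_ℂ := by
      rw [inner_sub_right, inner_sub_right, inner_smul_right]
    change B.form (J x) (J y) = ⟪J y, k - (C : ℂ) • J x - N x⟫_ℂ
    rw [h2, ← h1]
    ring

lemma IsFormModel.exists_resolvent [CompleteSpace G] [CompleteSpace K]
    (h : IsFormModel B W S M u J D N A P) (hS : 0 < S)
    (hM : 0 ≤ M) (hu : 0 < u) :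
    ∃ C₀ : ℝ, 0 < C₀ ∧ ∀ C ≥ C₀, ∃ R : Γ.L2 →L[ℂ] Γ.L2, R.IsPositive ∧
      (∀ f k, (f, k) ∈ (shift (B.H₀ + Γ.mulOp W) C).graph ↔ f = R k) ∧
      ∃ Q : Γ.L2 →L[ℂ] Γ.L2, Q.IsPositive ∧ (∀ g, Q (Q g) = R g) ∧
        ∀ g, ∃ q, Γ.HasDerivL2 (Q g) q ∧ ‖Q g‖ ^ 2 + ‖q‖ ^ 2 ≤ 2 * ‖g‖ ^ 2 := by
  obtain ⟨C₀, hC₀, H⟩ := h.exists_coercive hS hM hu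
  refine ⟨C₀, hC₀, fun C hC => ?_⟩
  obtain ⟨T, hTs, hTc, hT⟩ := H C hC
  obtain ⟨R, hR, hRg, Q, hQ, hQQ, hQb⟩ := exists_resolvent_of_coercive J T hTs
    (c := 1 / 2) (by norm_num) hTc (fun k hk => eq_zero_of_forall_formDomain (B := B) fun g hg => by
      obtain ⟨y, rfl⟩ := h.surj g hg
      exact hk y)
  refine ⟨R, hR, fun f k => ?_, Q, hQ, hQQ, fun g => ?_⟩
  · rw [hRg]
    exact h.mem_graph_shift_iff hT f k
  · obtain ⟨x, hx, hxb⟩ := hQb g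
    refine ⟨D x, hx ▸ h.hasDeriv x, ?_⟩
    rw [h.norm_sq, hx] at hxb
    nlinarith [sq_nonneg ‖A x‖]

lemma IsFormModel.norm_deriv_sq_le [CompleteSpace G] [CompleteSpace K]
    (h : IsFormModel B W S M u J D N A P) (hS : 0 < S)
    (hM : 0 ≤ M) (hu : 0 < u) (hW : W = 0) :
    ∃ C₀ : ℝ, 0 < C₀ ∧ ∀ f k g, (f, k) ∈ B.opGraph → Γ.HasDerivL2 f g →
      ‖g‖ ^ 2 ≤ 2 * (‖f‖ * ‖k‖) + 2 * C₀ * ‖f‖ ^ 2 := by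
  subst hW
  obtain ⟨C₀, hC₀, H⟩ := h.exists_coercive hS hM hu
  refine ⟨C₀, hC₀, fun f k g hfk hfg => ?_⟩
  obtain ⟨T, hTs, hTc, hT⟩ := H C₀ le_rfl
  obtain ⟨x, hx⟩ := h.surj f hfk.1
  have hgx : D x = g := (h.hasDeriv x).unique (hx ▸ hfg)
  have hk0 : N x = 0 := L2_ext fun e => by
    have hz : ((0 : Γ.L2) e : ℝ → ℂ) =ᵐ[Γ.vol e] 0 := by
      rw [lp.coeFn_zero, Pi.zero_apply]
      exact Lp.coeFn_zero _ _ _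
    filter_upwards [h.mul_mem x e, hz] with t h1 h2
    rw [h2]
    simpa using h1
  have h1 := hTc x
  rw [hTs, hT, hk0, inner_zero_right, hx] at h1
  have h2 : B.form f f = ⟪f, k⟫_ℂ := hfk.2 f hfk.1
  rw [h2, inner_self_eq_norm_sq_to_K, h.norm_sq, hx, hgx] at h1
  have h3 : (⟪f, k⟫_ℂ).re ≤ ‖f‖ * ‖k‖ := (Complex.re_le_norm _).trans (norm_inner_le_norm _ _)
  have h4 : (⟪f, k⟫_ℂ + 0 + (C₀ : ℂ) * ((‖f‖ : ℝ) : ℂ) ^ 2).re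
      = (⟪f, k⟫_ℂ).re + C₀ * ‖f‖ ^ 2 := by
    rw [add_zero, Complex.add_re]
    norm_cast
  have h5 := h1.trans (le_of_eq h4)
  nlinarith [sq_nonneg ‖f‖, sq_nonneg ‖A x‖]

end Model

lemma exists_isFormModel {u : ℝ} (hu : 0 < u) (hLB : ∀ e, ENNReal.ofReal u ≤ Γ.l e) {S : ℝ}
    (hS : 0 < S) (hUB : ∀ v, ‖(B.L v)⁺‖ ≤ S) {W : E → ℝ → ℝ} (hW : Γ.IsUnifLocL2 u W) :
    ∃ M : ℝ, 0 ≤ M ∧ ∃ (N : B.formSpace →L[ℂ] Γ.L2)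
      (P : B.formSpace →L[ℂ] lp (fun v => Γ.BdrySpace v) 2),
      IsFormModel B W S M u (G := B.formSpace) (K := lp (fun v => Γ.BdrySpace v) 2)
        B.toL2 B.toDeriv N B.toNegTrace P := by
  obtain ⟨P, hP, hPb⟩ := exists_posTrace (B := B) hu hLB hS hUB
  obtain ⟨N, hN, M, hM, hNb⟩ := exists_mulCLM (B := B) hu hLB hW
  exact ⟨M, hM, N, P, norm_sq_formSpace, hasDerivL2_toL2, hN, toL2_mem_formDomain hu hLB hUB,
    fun f hf => exists_toL2_eq hf, form_toL2 hP, hPb, hNb⟩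

/-- The resolvent of `H₀ + W` and its square root. -/
lemma exists_resolvent {u : ℝ} (hu : 0 < u) (hLB : ∀ e, ENNReal.ofReal u ≤ Γ.l e) {S : ℝ}
    (hS : 0 < S) (hUB : ∀ v, ‖(B.L v)⁺‖ ≤ S) {W : E → ℝ → ℝ} (hW : Γ.IsUnifLocL2 u W) :
    ∃ C₀ : ℝ, 0 < C₀ ∧ ∀ C ≥ C₀, ∃ R : Γ.L2 →L[ℂ] Γ.L2, R.IsPositive ∧
      (∀ f k, (f, k) ∈ (shift (B.H₀ + Γ.mulOp W) C).graph ↔ f = R k) ∧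
      ∃ Q : Γ.L2 →L[ℂ] Γ.L2, Q.IsPositive ∧ (∀ g, Q (Q g) = R g) ∧
        ∀ g, ∃ q, Γ.HasDerivL2 (Q g) q ∧ ‖Q g‖ ^ 2 + ‖q‖ ^ 2 ≤ 2 * ‖g‖ ^ 2 := by
  have : CompleteSpace B.formSpace := (isClosed_formSpace hu hLB).completeSpace_coe
  obtain ⟨M, hM, N, P, h⟩ := exists_isFormModel (B := B) hu hLB hS hUB hW
  exact h.exists_resolvent hS hM hu

/-- The derivative of `f ∈ D(H₀)` is bounded by `f` and `H₀ f`. -/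
lemma exists_norm_deriv_sq_le {u : ℝ} (hu : 0 < u) (hLB : ∀ e, ENNReal.ofReal u ≤ Γ.l e) {S : ℝ}
    (hS : 0 < S) (hUB : ∀ v, ‖(B.L v)⁺‖ ≤ S) :
    ∃ C₀ : ℝ, 0 < C₀ ∧ ∀ f k g, (f, k) ∈ B.opGraph → Γ.HasDerivL2 f g →
      ‖g‖ ^ 2 ≤ 2 * (‖f‖ * ‖k‖) + 2 * C₀ * ‖f‖ ^ 2 := by
  have : CompleteSpace B.formSpace := (isClosed_formSpace hu hLB).completeSpace_coe
  obtain ⟨M, hM, N, P, h⟩ := exists_isFormModel (B := B) hu hLB hS hUB (isUnifLocL2_zero u)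
  exact h.norm_deriv_sq_le hS hM hu rfl

lemma domain_add_mulOp {u : ℝ} (hu : 0 < u) (hLB : ∀ e, ENNReal.ofReal u ≤ Γ.l e)
    {W : E → ℝ → ℝ} (hW : Γ.IsUnifLocL2 u W) : (B.H₀).domain ≤ (Γ.mulOp W).domain := by
  intro f hf
  obtain ⟨h, hh⟩ := LinearPMap.mem_domain_iff.1 hf
  rw [graph_H₀] at hh
  obtain ⟨g, hg⟩ := hh.1.1
  obtain ⟨M, -, hM⟩ := hW.exists_mul_bound hu hLB
  obtain ⟨k, hk, -⟩ := hM f g hg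
  rw [← graph_mulOp] at hk
  exact LinearPMap.mem_domain_of_mem_graph hk

lemma H₀_add_mulOp_zero : B.H₀ + Γ.mulOp (0 : E → ℝ → ℝ) = B.H₀ := by
  have h0 : ∀ f k : Γ.L2, (f, k) ∈ (Γ.mulOp (0 : E → ℝ → ℝ)).graph ↔ k = 0 := by
    intro f k
    have hz : ∀ e, ((0 : Γ.L2) e : ℝ → ℂ) =ᵐ[Γ.vol e] 0 := fun e => by
      rw [lp.coeFn_zero, Pi.zero_apply]
      exact Lp.coeFn_zero _ _ _
    rw [graph_mulOp]
    constructor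
    · intro h
      refine L2_ext fun e => ?_
      filter_upwards [h e, hz e] with t h1 h2
      rw [h2]
      simpa using h1
    · rintro rfl e
      filter_upwards [hz e] with t h2
      simpa using h2
  refine LinearPMap.eq_of_eq_graph ?_
  ext ⟨f, h⟩
  rw [mem_graph_add_iff]
  constructor
  · rintro ⟨a, b, ha, hb, rfl⟩
    rw [(h0 f b).1 hb, add_zero]
    exact ha
  · intro h
    exact ⟨_, 0, h, (h0 f 0).2 rfl, by simp⟩

lemma isSelfAdjoint_add_mulOp {u : ℝ} (hu : 0 < u) (hLB : ∀ e, ENNReal.ofReal u ≤ Γ.l e) {S : ℝ}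
    (hS : 0 < S) (hUB : ∀ v, ‖(B.L v)⁺‖ ≤ S) {W : E → ℝ → ℝ} (hW : Γ.IsUnifLocL2 u W) :
    IsSelfAdjoint (B.H₀ + Γ.mulOp W) := by
  obtain ⟨C₀, -, H⟩ := exists_resolvent (B := B) hu hLB hS hUB hW
  obtain ⟨R, hR, hRg, -⟩ := H C₀ le_rfl
  exact isSelfAdjoint_of_resolvent hR.isSelfAdjoint.isSymmetric hRg

lemma invSqrtBoundedToLinfty {u : ℝ} (hu : 0 < u) (hLB : ∀ e, ENNReal.ofReal u ≤ Γ.l e) {S : ℝ}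
    (hS : 0 < S) (hUB : ∀ v, ‖(B.L v)⁺‖ ≤ S) {W : E → ℝ → ℝ} (hW : Γ.IsUnifLocL2 u W) :
    InvSqrtBoundedToLinfty (B.H₀ + Γ.mulOp W) := by
  obtain ⟨C₀, hC₀, H⟩ := exists_resolvent (B := B) hu hLB hS hUB hW
  refine ⟨C₀, hC₀, fun C hC => ?_⟩
  obtain ⟨R, hR, hRg, Q, hQ, hQQ, hQb⟩ := H C hC
  refine ⟨Q, ⟨hQ, fun f g => ?_⟩, Real.sqrt (2 * (2 / u + 2 * u)), fun g e => ?_⟩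
  · rw [hQQ]
    exact hRg f g
  · obtain ⟨q, hq, hqb⟩ := hQb g
    obtain ⟨F, hF⟩ := hq.exists_isRep
    rw [eLpNorm_exponent_top]
    refine eLpNormEssSup_le_of_ae_bound ?_
    filter_upwards [hF.ae_eq e, ae_restrict_mem (Γ.isOpen_interval e).measurableSet] with t ht htm
    rw [ht]
    refine le_of_sq_le_sq ?_ (by positivity)
    refine (hF.norm_sq_le hu le_rfl hLB (interval_subset_closedInterval e htm)).trans ?_
    rw [mul_pow, Real.sq_sqrt (by positivity)]
    have h1 := add_le_add_mul_add (p := 2 / u) (q := 2 * u) (a := ‖Q g‖ ^ 2)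
      (b := ‖q‖ ^ 2) (c := 0) (by positivity) (by positivity)
      (by positivity) (by positivity) le_rfl
    rw [add_zero] at h1
    refine h1.trans ?_
    calc (2 / u + 2 * u) * (‖Q g‖ ^ 2 + ‖q‖ ^ 2) ≤ (2 / u + 2 * u) * (2 * ‖g‖ ^ 2) := by gcongr
      _ = _ := by ring

lemma infinitesimallyBounded {u : ℝ} (hu : 0 < u) (hLB : ∀ e, ENNReal.ofReal u ≤ Γ.l e) {S : ℝ}
    (hS : 0 < S) (hUB : ∀ v, ‖(B.L v)⁺‖ ≤ S) {W : E → ℝ → ℝ} (hW : Γ.IsUnifLocL2 u W) :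
    InfinitesimallyBounded (Γ.mulOp W) B.H₀ := by
  refine ⟨domain_add_mulOp hu hLB hW, fun a ha => ?_⟩
  obtain ⟨C₀, hC₀, hder⟩ := exists_norm_deriv_sq_le (B := B) hu hLB hS hUB
  obtain ⟨M, hM, hMb⟩ := hW.exists_mul_bound hu hLB
  set δ := min u (a ^ 2 / (2 * M + 1)) with hδ
  have hδ0 : 0 < δ := lt_min hu (by positivity)
  have hδM : 2 * M * δ ≤ a ^ 2 := by
    calc 2 * M * δ ≤ (2 * M + 1) * (a ^ 2 / (2 * M + 1)) := by
          gcongr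
          · linarith
          · exact min_le_right _ _
      _ = a ^ 2 := by field_simp
  set b := Real.sqrt (2 * M / δ + a ^ 2 * (1 + 2 * C₀)) with hb
  refine ⟨b, fun f => ?_⟩
  have hf : ((f : Γ.L2), B.H₀ f) ∈ B.opGraph := by
    rw [← graph_H₀]; exact B.H₀.mem_graph f
  obtain ⟨g, hg⟩ := hf.1.1
  obtain ⟨k, hk, hkb⟩ := hMb _ _ hg
  have hval : Γ.mulOp W ⟨f, domain_add_mulOp hu hLB hW f.2⟩ = k := by
    rw [← graph_mulOp] at hk
    exact (Γ.mulOp W).mem_graph_snd_inj ((Γ.mulOp W).mem_graph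
      ⟨f, domain_add_mulOp hu hLB hW f.2⟩) hk rfl
  rw [hval]
  have h1 := hkb δ hδ0 (min_le_left _ _)
  have h2 := hder _ _ _ hf hg
  set x := ‖(f : Γ.L2)‖
  set y := ‖B.H₀ f‖
  have hx : 0 ≤ x := norm_nonneg _
  have hy : 0 ≤ y := norm_nonneg _
  have hb0 : 0 ≤ b := Real.sqrt_nonneg _
  have hbs : b ^ 2 = 2 * M / δ + a ^ 2 * (1 + 2 * C₀) := Real.sq_sqrt (by positivity)
  refine le_of_sq_le_sq ?_ (by positivity)
  have h3 : 2 * (x * y) ≤ x ^ 2 + y ^ 2 := by nlinarith [sq_nonneg (x - y)]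
  have h4 : ‖g‖ ^ 2 ≤ y ^ 2 + (1 + 2 * C₀) * x ^ 2 := by linarith
  have e1 : M * (2 / δ * x ^ 2 + 2 * δ * ‖g‖ ^ 2) = 2 * M / δ * x ^ 2 + 2 * M * δ * ‖g‖ ^ 2 := by
    ring
  have h5 : 2 * M * δ * ‖g‖ ^ 2 ≤ a ^ 2 * (y ^ 2 + (1 + 2 * C₀) * x ^ 2) :=
    mul_le_mul hδM h4 (by positivity) (by positivity)
  calc ‖k‖ ^ 2 ≤ a ^ 2 * y ^ 2 + b ^ 2 * x ^ 2 := by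
        rw [hbs]; rw [e1] at h1; linarith
    _ ≤ (a * y + b * x) ^ 2 := by
        have : 0 ≤ a * y * (b * x) := by positivity
        nlinarith

end BoundaryCondition

end MetricGraph

namespace MetricGraph

variable {E V : Type*} {Γ : MetricGraph E V}

/-! ### Compact subsets of the graph -/

lemma isClosed_closedInterval (e : E) : IsClosed (Γ.closedInterval e) :=
  (isClosed_le continuous_const continuous_id).inter
    (isClosed_le ENNReal.continuous_ofReal continuous_const)

lemma continuous_edgeMap (e : E) : Continuous (Γ.edgeMap e) :=
  continuous_iff_coinduced_le.2
    (le_iSup (fun e => TopologicalSpace.coinduced (Γ.edgeMap e) inferInstance) e)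

variable (Γ) in
/-- The part of the closed edge `e` with parameters at most `T`. -/
def segment (e : E) (T : ℝ) : Set Γ.Space := Γ.edgeMap e '' {t | (t : ℝ) ≤ T}

lemma isCompact_segment (e : E) (T : ℝ) : IsCompact (Γ.segment e T) := by
  refine IsCompact.image ?_ (continuous_edgeMap e)
  have h := (isClosed_closedInterval (Γ := Γ) e).isClosedEmbedding_subtypeVal.isCompact_preimage
    (isCompact_Icc (a := (0 : ℝ)) (b := T))
  convert h using 1
  ext t
  exact ⟨fun h => ⟨t.2.1, h⟩, fun h => h.2⟩

lemma edgeMap_of_mem {e : E} {t : Γ.closedInterval e} (ht : (t : ℝ) ∈ Γ.interval e) :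
    Γ.edgeMap e t = Sum.inr ⟨e, t, ht⟩ :=
  (dif_neg ht.1.ne').trans (dif_neg ht.2.ne)

lemma mem_slice_segment {e : E} {t T : ℝ} (ht : t ∈ Γ.interval e) (hT : t ≤ T) :
    t ∈ Γ.slice (Γ.segment e T) e :=
  ⟨ht, ⟨t, interval_subset_closedInterval e ht⟩, hT, edgeMap_of_mem ht⟩

lemma hasCompactSupp_of_finite {f : Γ.L2} {p : E → ℝ → ℂ} (hf : ∀ e, f e =ᵐ[Γ.vol e] p e)
    (hfin : {e | p e ≠ 0}.Finite) (hb : ∀ e, ∃ T, ∀ t ∈ Γ.interval e, T ≤ t → p e t = 0) :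
    Γ.HasCompactSupp f := by
  choose T hT using hb
  refine ⟨⋃ e ∈ {e | p e ≠ 0}, Γ.segment e (T e),
    hfin.isCompact_biUnion fun e _ => isCompact_segment e (T e), fun e => ?_⟩
  filter_upwards [hf e, ae_restrict_mem (Γ.isOpen_interval e).measurableSet] with t ht htm hts
  rw [ht]
  by_contra hne
  obtain ⟨h1, h2⟩ := mem_slice_segment (T := T e) htm
    (not_le.1 fun h => hne (hT e t htm h)).le
  exact hts ⟨h1, mem_biUnion (x := e) (fun h0 => hne (by rw [h0]; rfl)) h2⟩

/-! ### Smooth elements of the domain -/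

lemma finite_ends {s : Set E} (hs : s.Finite) : {k : Γ.EdgeEnd | k.edge ∈ s}.Finite := by
  refine ((hs.image (Sum.inl : E → E ⊕ {e : E // Γ.l e ≠ ∞})).union
    ((hs.preimage Subtype.val_injective.injOn).image
      (Sum.inr : _ → E ⊕ {e : E // Γ.l e ≠ ∞}))).subset ?_
  rintro (e | e) he
  · exact Or.inl ⟨e, he, rfl⟩
  · exact Or.inr ⟨e, he, rfl⟩

lemma finite_bdry_ne_zero {p : E → ℝ → ℂ} (hfin : {e | p e ≠ 0}.Finite) :
    {v | bdry Γ p v ≠ 0}.Finite := by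
  refine ((finite_ends (Γ := Γ) hfin).image EdgeEnd.vertex).subset fun v hv => ?_
  by_contra h
  refine hv ?_
  ext k
  change p k.1.edge k.1.point = 0
  by_contra hk
  exact h ⟨k.1, fun h0 => hk (by rw [h0]; rfl), k.2⟩

variable [∀ v, Fintype (Γ.Ends v)]

namespace BoundaryCondition

variable {B : Γ.BoundaryCondition}

lemma inner_P_eq (v : V) (x y : Γ.BdrySpace v) : ⟪B.P v x, y⟫_ℂ = ⟪x, B.P v y⟫_ℂ :=
  (B.isStarProjection_P v).isSelfAdjoint.isSymmetric x y

lemma Holds.inner_eq_zero {v : V} {b b' : Γ.BdrySpace v} (h : B.Holds v b b') {x : Γ.BdrySpace v}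
    (hx : B.P v x = 0) : ⟪x, B.L v b⟫_ℂ + ⟪x, b'⟫_ℂ = 0 := by
  have h2 : B.L v b + b' = B.P v (B.L v b + b') := sub_eq_zero.1 h.2
  rw [← inner_add_right, h2, ← inner_P_eq, hx, inner_zero_left]

end BoundaryCondition

/-- A smooth function on finitely many edges that satisfies the boundary conditions is in the domain
of `H₀`. -/
lemma IsSmoothFamily.mem_opGraph {B : Γ.BoundaryCondition} {p : E → ℝ → ℂ} (h : IsSmoothFamily p)
    (hB : ∀ v, B.Holds v (bdry Γ p v) (signedBdry Γ (fun e => _root_.deriv (p e)) v)) :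
    (mkL2 p h.memL2, mkL2 _ h.deriv.deriv.neg.memL2) ∈ B.opGraph := by
  have hr := h.isCompactRep.isRep (Γ := Γ)
  have hr' := h.deriv.isCompactRep (Γ := Γ)
  refine ⟨BoundaryCondition.mem_formDomain_of_finite hr.hasDerivL2
    (fun v => by rw [hr.trace_eq_bdry]; exact (hB v).1)
    (by simp only [hr.trace_eq_bdry]; exact finite_bdry_ne_zero h.finite), fun g hg => ?_⟩
  obtain ⟨g', hg'⟩ := hg.1
  obtain ⟨G, hG⟩ := hg'.exists_isRep
  have hs := (hr'.hasSum_inner_deriv hG).neg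
  have hv : ∀ v, -⟪Γ.trace g v, signedBdry Γ (fun e => _root_.deriv (p e)) v⟫_ℂ
      = ⟪Γ.trace g v, B.L v (Γ.trace (mkL2 p h.memL2) v)⟫_ℂ := fun v => by
    have := (hB v).inner_eq_zero (hg.2.2.1 v)
    rw [hr.trace_eq_bdry]
    exact (eq_neg_of_add_eq_zero_left this).symm
  simp only [hv] at hs
  change B.form (mkL2 p h.memL2) g = ⟪g, _⟫_ℂ
  rw [BoundaryCondition.form, hs.tsum_eq, hg'.derivL2_eq, hr.hasDerivL2.derivL2_eq]
  have hneg : mkL2 (Γ := Γ) _ h.deriv.deriv.neg.memL2 = -mkL2 _ h.deriv.deriv.memL2 := by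
    refine L2_ext fun e => ?_
    have h3 : ((-mkL2 (Γ := Γ) _ h.deriv.deriv.memL2 : Γ.L2) e : ℝ → ℂ)
        =ᵐ[Γ.vol e] -(mkL2 (Γ := Γ) _ h.deriv.deriv.memL2 e) := by
      rw [lp.coeFn_neg, Pi.neg_apply]
      exact Lp.coeFn_neg _
    filter_upwards [coe_mkL2 (Γ := Γ) _ h.deriv.deriv.neg.memL2 e,
      coe_mkL2 (Γ := Γ) _ h.deriv.deriv.memL2 e, h3] with t h1 h2 h3
    rw [h1, h3, Pi.neg_apply, h2]
  rw [hneg, inner_neg_right]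
  ring

end MetricGraph

namespace MetricGraph

variable {E V : Type*} {Γ : MetricGraph E V}

/-! ### Functions with prescribed boundary values at a vertex -/

lemma EdgeEnd.sign_mul_sign (k : Γ.EdgeEnd) : k.sign * k.sign = 1 := by
  rcases k with e | e <;> simp [EdgeEnd.sign]

lemma EdgeEnd.conj_sign (k : Γ.EdgeEnd) : conj k.sign = k.sign := by
  rcases k with e | e <;> simp [EdgeEnd.sign]

lemma le_toReal_l {u : ℝ} {e : E} (hLB : ENNReal.ofReal u ≤ Γ.l e) (he : Γ.l e ≠ ∞) :
    u ≤ (Γ.l e).toReal := (ENNReal.ofReal_le_iff_le_toReal he).1 hLB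

lemma EdgeEnd.le_abs_point_sub {u : ℝ} (hLB : ∀ e, ENNReal.ofReal u ≤ Γ.l e) {k k' : Γ.EdgeEnd}
    (hne : k ≠ k') (he : k.edge = k'.edge) : u ≤ |k'.point - k.point| := by
  rcases k with e | ⟨e, h⟩ <;> rcases k' with e' | ⟨e', h'⟩
  · exact absurd (congrArg Sum.inl he) hne
  · have h2 := (le_toReal_l (hLB e') h').trans (le_abs_self _)
    simpa [EdgeEnd.point] using h2
  · have h2 := (le_toReal_l (hLB e) h).trans (le_abs_self _)
    simpa [EdgeEnd.point] using h2
  · exact absurd (congrArg Sum.inr (Subtype.ext he)) hne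

open Classical in
/-- A function on the edge of the edge end `k` with value `c` and derivative `c'` there. -/
noncomputable def endBump (η : ℝ → ℝ) (k : Γ.EdgeEnd) (c c' : ℂ) (e : E) (t : ℝ) : ℂ :=
  if k.edge = e then (c + k.sign * (t - k.point : ℝ) * c') * (η (t - k.point) : ℝ) else 0

/-- `η` is a smooth cutoff function at `0` of radius less than `u`. -/
structure IsCutoff (u : ℝ) (η : ℝ → ℝ) : Prop where
  contDiff : ContDiff ℝ (⊤ : ℕ∞) η
  hasCompactSupport : HasCompactSupport η
  eventually_eq_one : ∀ᶠ t in 𝓝 0, η t = 1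
  eq_zero : ∀ t, u ≤ 2 * |t| → η t = 0

lemma exists_isCutoff {u : ℝ} (hu : 0 < u) : ∃ η, IsCutoff u η := by
  let φ : ContDiffBump (0 : ℝ) := ⟨u / 4, u / 2, by linarith, by linarith⟩
  refine ⟨φ, φ.contDiff, φ.hasCompactSupport, φ.eventuallyEq_one, fun t ht => ?_⟩
  refine φ.zero_of_le_dist ?_
  change u / 2 ≤ dist t 0
  rw [Real.dist_eq, sub_zero]
  linarith

namespace IsCutoff

variable {u : ℝ} {η : ℝ → ℝ}

lemma isSmoothFamily_endBump (hη : IsCutoff u η) (k : Γ.EdgeEnd) (c c' : ℂ) :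
    IsSmoothFamily (endBump η k c c') := by
  have hpos : ∀ e, k.edge = e → endBump η k c c' e
      = fun t => (c + k.sign * (t - k.point : ℝ) * c') * (η (t - k.point) : ℝ) := fun e h =>
    funext fun t => if_pos h
  have hneg : ∀ e, k.edge ≠ e → endBump η k c c' e = 0 := fun e h => funext fun t => if_neg h
  refine ⟨fun e => ?_, fun e => ?_, (finite_singleton k.edge).subset fun e he => ?_⟩
  · by_cases h : k.edge = e
    · rw [hpos e h]
      have h1 : ContDiff ℝ (⊤ : ℕ∞) fun t : ℝ => ((t - k.point : ℝ) : ℂ) :=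
        Complex.ofRealCLM.contDiff.comp (contDiff_id.sub contDiff_const)
      exact (contDiff_const.add ((contDiff_const.mul h1).mul contDiff_const)).mul
        (Complex.ofRealCLM.contDiff.comp (hη.contDiff.comp (contDiff_id.sub contDiff_const)))
    · rw [hneg e h]
      exact contDiff_const
  · by_cases h : k.edge = e
    · rw [hpos e h]
      have := (hη.hasCompactSupport.comp_homeomorph (Homeomorph.subRight k.point)).comp_left
        Complex.ofReal_zero
      exact HasCompactSupport.mul_left this
    · rw [hneg e h]
      exact HasCompactSupport.zero
  · by_contra hne
    exact he (hneg e fun h => hne h.symm)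

lemma endBump_eventuallyEq_self (hη : IsCutoff u η) (k : Γ.EdgeEnd) (c c' : ℂ) :
    endBump η k c c' k.edge =ᶠ[𝓝 k.point] fun t => c + k.sign * (t - k.point : ℝ) * c' := by
  have : Tendsto (fun t : ℝ => t - k.point) (𝓝 k.point) (𝓝 0) := by
    have hc : Continuous fun t : ℝ => t - k.point := by fun_prop
    simpa using hc.tendsto k.point
  filter_upwards [this.eventually hη.eventually_eq_one] with t ht
  rw [endBump, if_pos rfl, ht, Complex.ofReal_one, mul_one]

lemma endBump_eventuallyEq_zero (hu : 0 < u) (hLB : ∀ e, ENNReal.ofReal u ≤ Γ.l e)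
    (hη : IsCutoff u η) {k k' : Γ.EdgeEnd}
    (hne : k ≠ k') (c c' : ℂ) : endBump η k c c' k'.edge =ᶠ[𝓝 k'.point] 0 := by
  by_cases he : k.edge = k'.edge
  · have h1 := EdgeEnd.le_abs_point_sub hLB hne he
    have hc : Continuous fun t : ℝ => |t - k.point| := by fun_prop
    have := hc.continuousAt.eventually_const_lt (show u / 2 < |k'.point - k.point| by linarith)
    filter_upwards [this] with t ht
    rw [endBump, hη.eq_zero _ (by linarith)]
    simp
  · refine Eventually.of_forall fun t => ?_
    rw [endBump, if_neg he]
    rfl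

lemma endBump_apply (hu : 0 < u) (hLB : ∀ e, ENNReal.ofReal u ≤ Γ.l e) (hη : IsCutoff u η)
    (k k' : Γ.EdgeEnd) (c c' : ℂ) [Decidable (k = k')] :
    endBump η k c c' k'.edge k'.point = if k = k' then c else 0 := by
  split_ifs with h
  · subst h
    rw [(hη.endBump_eventuallyEq_self k c c').eq_of_nhds]
    simp
  · exact (hη.endBump_eventuallyEq_zero hu hLB h c c').eq_of_nhds

lemma sign_mul_deriv_endBump (hu : 0 < u) (hLB : ∀ e, ENNReal.ofReal u ≤ Γ.l e)
    (hη : IsCutoff u η) (k k' : Γ.EdgeEnd) (c c' : ℂ) [Decidable (k = k')] :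
    k'.sign * deriv (endBump η k c c' k'.edge) k'.point = if k = k' then c' else 0 := by
  split_ifs with h
  · subst h
    rw [(hη.endBump_eventuallyEq_self k c c').deriv_eq]
    have h1 : HasDerivAt (fun t : ℝ => ((t - k.point : ℝ) : ℂ)) 1 k.point := by
      have := ((hasDerivAt_id k.point).sub_const k.point).ofReal_comp
      simpa using this
    rw [(((h1.const_mul k.sign).mul_const c').const_add c).deriv, mul_one, ← mul_assoc,
      k.sign_mul_sign, one_mul]
  · rw [(hη.endBump_eventuallyEq_zero hu hLB h c c').deriv_eq]
    simp

end IsCutoff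

lemma IsSmoothFamily.sum {ι : Type*} (s : Finset ι) {p : ι → E → ℝ → ℂ}
    (h : ∀ i ∈ s, IsSmoothFamily (p i)) : IsSmoothFamily fun e t => ∑ i ∈ s, p i e t := by
  refine ⟨fun e => ContDiff.sum fun i hi => (h i hi).contDiff e, fun e => ?_,
    (s.finite_toSet.biUnion (t := fun i => {e | p i e ≠ 0}) fun i hi => (h i hi).finite).subset
      fun e he => ?_⟩
  · classical
    induction s using Finset.induction_on with
    | empty => exact HasCompactSupport.zero
    | insert a s ha ih =>
      simp only [Finset.sum_insert ha]
      exact ((h a (Finset.mem_insert_self a s)).hasCompactSupport e).add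
        (ih fun i hi => h i (Finset.mem_insert_of_mem hi))
  · by_contra hne
    refine he (funext fun t => Finset.sum_eq_zero fun i hi => ?_)
    have : p i e = 0 := by
      by_contra h'
      exact hne (mem_biUnion hi h')
    rw [this]
    rfl

variable [∀ v, Fintype (Γ.Ends v)]

/-- At a given vertex all boundary values and derivatives are attained by smooth functions that
vanish near all other vertices. -/
lemma exists_isSmoothFamily_bdry {u : ℝ} (hu : 0 < u) (hLB : ∀ e, ENNReal.ofReal u ≤ Γ.l e) (v : V)
    (b b' : Γ.BdrySpace v) :
    ∃ p : E → ℝ → ℂ, IsSmoothFamily p ∧ bdry Γ p v = b ∧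
      signedBdry Γ (fun e => deriv (p e)) v = b' ∧
      ∀ w, w ≠ v → bdry Γ p w = 0 ∧ signedBdry Γ (fun e => deriv (p e)) w = 0 := by
  classical
  obtain ⟨η, hη⟩ := exists_isCutoff hu
  have hs : ∀ k : Γ.Ends v, IsSmoothFamily (endBump η k.1 (b k) (b' k)) := fun k =>
    hη.isSmoothFamily_endBump k.1 (b k) (b' k)
  have hd : ∀ k' : Γ.EdgeEnd, k'.sign
      * deriv (fun t => ∑ k : Γ.Ends v, endBump η k.1 (b k) (b' k) k'.edge t) k'.point
      = ∑ k : Γ.Ends v, if k.1 = k' then b' k else 0 := by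
    intro k'
    rw [deriv_fun_sum fun k _ =>
      ((hs k).contDiff _).differentiable (by simp) _, Finset.mul_sum]
    exact Finset.sum_congr rfl fun k _ => hη.sign_mul_deriv_endBump hu hLB _ _ _ _
  have hv : ∀ k' : Γ.EdgeEnd, ∑ k : Γ.Ends v, endBump η k.1 (b k) (b' k) k'.edge k'.point
      = ∑ k : Γ.Ends v, if k.1 = k' then b k else 0 := fun k' =>
    Finset.sum_congr rfl fun k _ => hη.endBump_apply hu hLB _ _ _ _
  have hself : ∀ (c : Γ.BdrySpace v) (k' : Γ.Ends v),
      (∑ k : Γ.Ends v, if k.1 = k'.1 then c k else 0) = c k' := by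
    intro c k'
    rw [Finset.sum_eq_single k' (fun k _ hk => if_neg fun h => hk (Subtype.ext h))
      (fun h => absurd (Finset.mem_univ _) h), if_pos rfl]
  have hoth : ∀ (c : Γ.BdrySpace v) {w : V} (k' : Γ.Ends w), w ≠ v →
      (∑ k : Γ.Ends v, if k.1 = k'.1 then c k else 0) = 0 := by
    intro c w k' hw
    refine Finset.sum_eq_zero fun k _ => if_neg fun h => hw ?_
    rw [← k.2, ← k'.2, h]
  refine ⟨fun e t => ∑ k : Γ.Ends v, endBump η k.1 (b k) (b' k) e t,
    IsSmoothFamily.sum _ fun k _ => hs k, ?_, ?_, fun w hw => ⟨?_, ?_⟩⟩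
  · ext k'
    exact (hv k'.1).trans (hself b k')
  · ext k'
    exact (hd k'.1).trans (hself b' k')
  · ext k'
    exact (hv k'.1).trans (hoth b k' hw)
  · ext m
    exact (hd m.1).trans (hoth b' m hw)

/-- A vector pair satisfies the boundary condition as soon as it is symplectically orthogonal to all
pairs that satisfy it. -/
lemma BoundaryCondition.holds_of_forall {B : Γ.BoundaryCondition} {v : V} {x x' : Γ.BdrySpace v}
    (h : ∀ b b', B.Holds v b b' → ⟪x, b'⟫_ℂ = ⟪x', b⟫_ℂ) : B.Holds v x x' := by
  have hPP : ∀ y, B.P v (B.P v y) = B.P v y := fun y =>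
    congrArg (fun T : Γ.BdrySpace v →L[ℂ] Γ.BdrySpace v => T y)
      (B.isStarProjection_P v).isIdempotentElem
  have hL : ∀ y z, ⟪B.L v y, z⟫_ℂ = ⟪y, B.L v z⟫_ℂ := fun y z =>
    (B.isSelfAdjoint_L v).isSymmetric y z
  constructor
  · have h1 := h 0 (B.P v x) ⟨map_zero _, by
      change (B.L v 0 + B.P v x) - B.P v (B.L v 0 + B.P v x) = 0
      rw [map_zero, zero_add, hPP, sub_self]⟩
    rw [inner_zero_right, ← hPP, ← inner_P_eq] at h1
    exact inner_self_eq_zero.1 h1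
  · set z := (1 - B.P v) (B.L v x + x') with hz
    have hz' : z = (B.L v x + x') - B.P v (B.L v x + x') := rfl
    have hPz : B.P v z = 0 := by rw [hz', map_sub, hPP, sub_self]
    have h1 := h z (-B.L v z) ⟨hPz, by rw [add_neg_cancel, map_zero]⟩
    rw [inner_neg_right, ← hL] at h1
    have h2 : ⟪B.L v x + x', z⟫_ℂ = 0 := by
      rw [inner_add_left, ← h1, add_neg_cancel]
    have h3 : ⟪z, z⟫_ℂ = 0 := by
      have h4 : ⟪B.L v x + x' - B.P v (B.L v x + x'), z⟫_ℂ = 0 := by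
        rw [inner_sub_left, inner_P_eq, hPz, inner_zero_right, sub_zero, h2]
      rwa [← hz'] at h4
    exact inner_self_eq_zero.1 h3

end MetricGraph

namespace MetricGraph

variable {E V : Type*} {Γ : MetricGraph E V}

/-! ### Local square integrability -/

variable (Γ) in
/-- The part of the open edge `e` with parameters at most `T`. -/
def initialPart (e : E) (T : ℝ) : Set ℝ := Γ.interval e ∩ Iic T

instance (e : E) (T : ℝ) : IsFiniteMeasure (volume.restrict (Γ.initialPart e T)) := by
  refine ⟨?_⟩
  rw [Measure.restrict_apply_univ]
  exact (measure_mono (t := Icc 0 T) fun t ht => ⟨ht.1.1.le, ht.2⟩).trans_lt measure_Icc_lt_top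

lemma MemL2Loc.memLp {φ : E → ℝ → ℂ} (h : Γ.MemL2Loc φ) (e : E) (T : ℝ) :
    MemLp (φ e) 2 (volume.restrict (Γ.initialPart e T)) := by
  refine ⟨(h.1 e).mono_measure (Measure.restrict_mono inter_subset_left le_rfl), ?_⟩
  have h1 := ENNReal.ne_top_of_tsum_ne_top (h.2 _ (isCompact_segment e T)).ne e
  have h2 : ∫⁻ t in Γ.initialPart e T, ‖φ e t‖ₑ ^ 2 ≠ ∞ :=
    ne_top_of_le_ne_top h1 (lintegral_mono_set fun t ht => mem_slice_segment ht.1 ht.2)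
  rw [← eLpNorm_two_sq] at h2
  rw [lt_top_iff_ne_top]
  intro h'
  rw [h'] at h2
  exact h2 (by simp)

lemma IsUnifLocL2.memLp {u : ℝ} (hu : 0 < u) (hLB : ∀ e, ENNReal.ofReal u ≤ Γ.l e)
    {W : E → ℝ → ℝ} (hW : Γ.IsUnifLocL2 u W) (e : E) (T : ℝ) :
    MemLp (fun t => (W e t : ℂ)) 2 (volume.restrict (Γ.initialPart e T)) := by
  have hm : AEStronglyMeasurable (fun t => (W e t : ℂ)) (Γ.vol e) :=
    Complex.continuous_ofReal.comp_aestronglyMeasurable (hW.1 e)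
  refine ⟨hm.mono_measure (Measure.restrict_mono inter_subset_left le_rfl), ?_⟩
  obtain ⟨M, -, hM⟩ := hW.exists_bound hu hLB
  have hK : IsCompact (Γ.closedInterval e ∩ Icc 0 T) :=
    isCompact_Icc.inter_left (isClosed_closedInterval e)
  have h1 : ∫⁻ t in Γ.closedInterval e ∩ Icc 0 T, ‖W e t‖ₑ ^ 2 ∂Γ.vol e < ∞ := by
    refine hK.induction_on (p := fun A => ∫⁻ t in A, ‖W e t‖ₑ ^ 2 ∂Γ.vol e < ∞) (by simp)
      (fun A A' hA h => (lintegral_mono_set hA).trans_lt h)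
      (fun A A' h h' => (lintegral_union_le _ _ _).trans_lt (ENNReal.add_lt_top.2 ⟨h, h'⟩))
      fun x hx => ⟨Metric.closedBall x u,
        mem_nhdsWithin_of_mem_nhds (Metric.closedBall_mem_nhds x hu),
        (hM e u le_rfl x hx.1).trans_lt ENNReal.ofReal_lt_top⟩
  have h2 : ∫⁻ t in Γ.initialPart e T, ‖(W e t : ℂ)‖ₑ ^ 2 ≠ ∞ := by
    refine ne_top_of_le_ne_top h1.ne ?_
    rw [Measure.restrict_restrict ((isClosed_closedInterval e).inter isClosed_Icc).measurableSet]
    have hsub : Γ.initialPart e T ⊆ (Γ.closedInterval e ∩ Icc 0 T) ∩ Γ.interval e := fun t ht =>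
      ⟨⟨interval_subset_closedInterval e ht.1, ht.1.1.le, ht.2⟩, ht.1⟩
    refine (lintegral_mono_set hsub).trans (lintegral_mono fun t => le_of_eq ?_)
    rw [← ofReal_norm, ← ofReal_norm, Complex.norm_real]
  rw [← eLpNorm_two_sq] at h2
  rw [lt_top_iff_ne_top]
  intro h'
  rw [h'] at h2
  exact h2 (by simp)

lemma restrict_Ioo_le_initialPart {e : E} {a b : ℝ} (ha : a ∈ Γ.closedInterval e)
    (hb : b ∈ Γ.closedInterval e) :
    volume.restrict (Ioo a b) ≤ volume.restrict (Γ.initialPart e b) := by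
  have hsub : Ioo a b ⊆ Γ.initialPart e b := fun _ ht => ⟨Ioo_subset_interval ha hb ht, ht.2.le⟩
  exact Measure.restrict_mono hsub le_rfl

lemma intervalIntegrable_of_initialPart {e : E} {g : ℝ → ℂ}
    (hg : ∀ T, IntegrableOn g (Γ.initialPart e T)) {a b : ℝ} (ha : a ∈ Γ.closedInterval e)
    (hb : b ∈ Γ.closedInterval e) : IntervalIntegrable g volume a b := by
  have key : ∀ a ∈ Γ.closedInterval e, ∀ b ∈ Γ.closedInterval e, a ≤ b →
      IntervalIntegrable g volume a b := fun a ha b hb hab => by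
    rw [intervalIntegrable_iff_integrableOn_Ioo_of_le hab]
    exact Integrable.mono_measure (hg b) (restrict_Ioo_le_initialPart ha hb)
  rcases le_total a b with h | h
  · exact key a ha b hb h
  · exact (key b hb a ha h).symm

lemma IsSmoothFamily.integrableOn_mul {p : E → ℝ → ℂ} (hp : IsSmoothFamily p) {e : E} {g : ℝ → ℂ}
    (hg : ∀ T, IntegrableOn g (Γ.initialPart e T)) :
    IntegrableOn (fun t => p e t * g t) (Γ.interval e) := by
  obtain ⟨T, hT⟩ := hp.exists_forall_ge_eq_zero e
  obtain ⟨C, hC⟩ := (hp.hasCompactSupport e).exists_bound_of_continuous (hp.contDiff e).continuous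
  refine IntegrableOn.of_forall_sdiff_eq_zero (s := Γ.initialPart e T) ?_
    (Γ.isOpen_interval e).measurableSet fun t ht => ?_
  · exact (hg T).bdd_mul (hp.contDiff e).continuous.aestronglyMeasurable
      (Eventually.of_forall hC)
  · rw [hT t (not_le.1 fun h => ht.2 ⟨ht.1, h⟩).le, zero_mul]

/-! ### Primitives of continuous functions -/

lemma IsPrimitiveOn.hasDerivAt {U : Set ℝ} (hU : IsOpen U) {F f : ℝ → ℂ}
    (h : IsPrimitiveOn U F f) (hf : ContinuousOn f U) {t : ℝ} (ht : t ∈ U) :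
    HasDerivAt F (f t) t := by
  have h1 : HasDerivAt (fun x => ∫ s in t..x, f s) (f t) t :=
    intervalIntegral.integral_hasDerivAt_right (h.intervalIntegrable ht ht)
      (hf.stronglyMeasurableAtFilter hU t ht) (hf.continuousAt (hU.mem_nhds ht))
  refine (h1.const_add (F t)).congr_of_eventuallyEq ?_
  filter_upwards [hU.mem_nhds ht] with x hx
  rw [← h.sub_eq ht hx]
  ring

lemma IsPrimitiveOn.contDiffOn {U : Set ℝ} (hU : IsOpen U) {F f : ℝ → ℂ}
    (h : IsPrimitiveOn U F f) (hf : ContinuousOn f U) : ContDiffOn ℝ 1 F U := by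
  rw [show (1 : WithTop ℕ∞) = 0 + 1 by simp, contDiffOn_succ_iff_deriv_of_isOpen hU]
  refine ⟨fun t ht => (h.hasDerivAt hU hf ht).differentiableAt.differentiableWithinAt, by simp, ?_⟩
  rw [contDiffOn_zero]
  exact hf.congr fun t ht => (h.hasDerivAt hU hf ht).deriv

lemma memLp_of_continuousOn_Icc {a b : ℝ} {F : ℝ → ℂ} (hF : ContinuousOn F (Icc a b)) :
    MemLp F ∞ (volume.restrict (Ioo a b)) := by
  obtain ⟨C, hC⟩ := isCompact_Icc.exists_bound_of_continuousOn hF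
  refine memLp_top_of_bound
    ((hF.mono Ioo_subset_Icc_self).aestronglyMeasurable measurableSet_Ioo) C ?_
  filter_upwards [ae_restrict_mem measurableSet_Ioo] with t ht
  exact hC t (Ioo_subset_Icc_self ht)

/-- Regularity of `φ`, given a primitive of a primitive of a square integrable multiple of `φ`. -/
lemma memW22_of_isPrimitiveOn {a b : ℝ} {φ F F' q w : ℝ → ℂ}
    (hF : IsPrimitiveOn (Icc a b) F F') (hF' : IsPrimitiveOn (Icc a b) F' q)
    (hφ : φ =ᵐ[volume.restrict (Ioo a b)] F) (hq : q =ᵐ[volume.restrict (Ioo a b)] fun t => w t * φ t)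
    (hw : MemLp w 2 (volume.restrict (Ioo a b))) : MemW22 a b φ := by
  have m0 := memLp_of_continuousOn_Icc hF.continuousOn
  have m1 := memLp_of_continuousOn_Icc hF'.continuousOn
  have hfin : IsFiniteMeasure (volume.restrict (Ioo a b)) :=
    ⟨by rw [Measure.restrict_apply_univ]; exact measure_Ioo_lt_top⟩
  refine ⟨F', q, (memLp_congr_ae hφ).2 (m0.mono_exponent le_top), m1.mono_exponent le_top, ?_, ?_,
    (hF'.mono Ioo_subset_Icc_self).isWeakDeriv isOpen_Ioo⟩
  · refine (memLp_congr_ae ?_).2 (m0.mul' hw)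
    filter_upwards [hq, hφ] with t h1 h2
    rw [h1, h2]
  · have h1 := isWeakDeriv_iff.1 ((hF.mono Ioo_subset_Icc_self).isWeakDeriv isOpen_Ioo)
    rw [isWeakDeriv_iff]
    intro ψ hψ
    rw [← h1 ψ hψ]
    refine integral_congr_ae ?_
    filter_upwards [hφ] with t ht
    rw [ht]

/-! ### Generalized eigenfunctions -/

section Eigenfunction

variable {u : ℝ} {W : E → ℝ → ℝ} {φ : E → ℝ → ℂ}

lemma integrableOn_conj (hφ : Γ.MemL2Loc φ) (e : E) (T : ℝ) :
    IntegrableOn (fun t => conj (φ e t)) (Γ.initialPart e T) :=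
  ((hφ.memLp e T).star).integrable (by norm_num)

lemma integrableOn_mul_conj (hu : 0 < u) (hLB : ∀ e, ENNReal.ofReal u ≤ Γ.l e)
    (hW : Γ.IsUnifLocL2 u W) (hφ : Γ.MemL2Loc φ) (e : E) (T : ℝ) :
    IntegrableOn (fun t => (W e t : ℂ) * conj (φ e t)) (Γ.initialPart e T) :=
  (hW.memLp hu hLB e T).integrable_mul (hφ.memLp e T).star

variable [∀ v, Fintype (Γ.Ends v)] {B : Γ.BoundaryCondition} {lam : ℂ}

/-- The eigenvalue equation, tested with a smooth element of the domain. -/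
lemma IsGeneralizedEigenfunction.hasSum_integral (hu : 0 < u)
    (hLB : ∀ e, ENNReal.ofReal u ≤ Γ.l e) (hW : Γ.IsUnifLocL2 u W)
    (hφ : IsGeneralizedEigenfunction (B.H₀ + Γ.mulOp W) lam φ) {p : E → ℝ → ℂ}
    (hp : IsSmoothFamily p)
    (hB : ∀ v, B.Holds v (bdry Γ p v) (signedBdry Γ (fun e => deriv (p e)) v)) :
    HasSum (fun e => ∫ t in Γ.interval e, (p e t * ((W e t - lam) * conj (φ e t))
      - deriv (deriv (p e)) t * conj (φ e t))) 0 := by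
  obtain ⟨M, -, hM⟩ := hW.exists_mul_bound hu hLB
  obtain ⟨k, hk, -⟩ := hM _ _ (hp.isCompactRep.isRep (Γ := Γ)).hasDerivL2
  have hg : (mkL2 p hp.memL2, mkL2 _ hp.deriv.deriv.neg.memL2 + k) ∈ (B.H₀ + Γ.mulOp W).graph := by
    rw [mem_graph_add_iff, BoundaryCondition.graph_H₀, graph_mulOp]
    exact ⟨_, k, hp.mem_opGraph hB, hk, rfl⟩
  obtain ⟨y, hy, hHy⟩ := (LinearPMap.mem_graph_iff _).1 hg
  have hcs : Γ.HasCompactSupp (y : Γ.L2) := by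
    rw [hy]
    exact hasCompactSupp_of_finite (fun e => coe_mkL2 p hp.memL2 e) hp.finite
      fun e => (hp.exists_forall_ge_eq_zero e).imp fun T hT t _ => hT t
  have heq := hφ.2.2 y hcs
  rw [hHy, hy] at heq
  set s := hp.finite.toFinset
  have hs : ∀ e, e ∉ s → p e = 0 := fun e he => by simpa [s] using he
  have hz : ∀ e, e ∉ s → deriv (deriv (p e)) = 0 := fun e he => by
    rw [hs e he, Pi.zero_def, deriv_const', deriv_const']
  have t1 : ∀ e, ∫ t in Γ.interval e, (mkL2 _ hp.deriv.deriv.neg.memL2 + k : Γ.L2) e t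
        * conj (φ e t)
      = ∫ t in Γ.interval e, (p e t * (W e t * conj (φ e t))
        - deriv (deriv (p e)) t * conj (φ e t)) := by
    intro e
    refine integral_congr_ae ?_
    filter_upwards [coe_add_ae (mkL2 (Γ := Γ) _ hp.deriv.deriv.neg.memL2) k e,
      coe_mkL2 (Γ := Γ) _ hp.deriv.deriv.neg.memL2 e, coe_mkL2 (Γ := Γ) _ hp.memL2 e, hk e]
      with t h1 h2 h3 h4
    rw [h1, h2, h4, h3]
    ring
  have t2 : ∀ e, ∫ t in Γ.interval e, mkL2 (Γ := Γ) p hp.memL2 e t * conj (φ e t)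
      = ∫ t in Γ.interval e, p e t * conj (φ e t) := by
    intro e
    refine integral_congr_ae ?_
    filter_upwards [coe_mkL2 (Γ := Γ) _ hp.memL2 e] with t h3
    rw [h3]
  simp only [pairing, t1, t2] at heq
  have i1 : ∀ e, IntegrableOn (fun t => p e t * (W e t * conj (φ e t))
      - deriv (deriv (p e)) t * conj (φ e t)) (Γ.interval e) := fun e =>
    Integrable.sub (hp.integrableOn_mul (integrableOn_mul_conj hu hLB hW hφ.1 e))
      (hp.deriv.deriv.integrableOn_mul (integrableOn_conj hφ.1 e))
  have i2 : ∀ e, IntegrableOn (fun t => p e t * conj (φ e t)) (Γ.interval e) := fun e =>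
    hp.integrableOn_mul (integrableOn_conj hφ.1 e)
  have s1 : HasSum (fun e => ∫ t in Γ.interval e, (p e t * (W e t * conj (φ e t))
        - deriv (deriv (p e)) t * conj (φ e t)))
      (∑ e ∈ s, ∫ t in Γ.interval e, (p e t * (W e t * conj (φ e t))
        - deriv (deriv (p e)) t * conj (φ e t))) :=
    hasSum_sum_of_ne_finset_zero fun e he => by
      rw [hz e he, hs e he]
      simp
  have s2 : HasSum (fun e => ∫ t in Γ.interval e, p e t * conj (φ e t))
      (∑ e ∈ s, ∫ t in Γ.interval e, p e t * conj (φ e t)) :=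
    hasSum_sum_of_ne_finset_zero fun e he => by
      rw [hs e he]
      simp
  rw [s1.tsum_eq, s2.tsum_eq] at heq
  have h3 := s1.sub (s2.mul_left lam)
  rw [heq, sub_self] at h3
  refine h3.congr_fun fun e => ?_
  rw [← integral_const_mul, ← integral_sub (i1 e) ((i2 e).const_mul lam)]
  refine integral_congr_ae (Eventually.of_forall fun t => ?_)
  ring

open Classical in
/-- A generalized eigenfunction solves the differential equation on every edge. -/
lemma IsGeneralizedEigenfunction.exists_isPrimitiveOn (hu : 0 < u)
    (hLB : ∀ e, ENNReal.ofReal u ≤ Γ.l e) (hW : Γ.IsUnifLocL2 u W)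
    (hφ : IsGeneralizedEigenfunction (B.H₀ + Γ.mulOp W) lam φ) (e : E) :
    ∃ F F', IsPrimitiveOn (Γ.closedInterval e) F F' ∧
      IsPrimitiveOn (Γ.closedInterval e) F' (fun t => (W e t - lam) * conj (φ e t)) ∧
      (fun t => conj (φ e t)) =ᵐ[Γ.vol e] F := by
  have hq : ∀ T, IntegrableOn (fun t => ((W e t : ℂ) - lam) * conj (φ e t)) (Γ.initialPart e T) :=
    fun T => by
      have := (integrableOn_mul_conj hu hLB hW hφ.1 e T).sub
        ((integrableOn_conj hφ.1 e T).const_mul lam)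
      refine this.congr (Eventually.of_forall fun t => ?_)
      simp only [Pi.sub_apply]
      ring
  refine exists_isPrimitiveOn_of_second_deriv (Γ.isOpen_interval e) (interval_nonempty e)
    (interval_subset_closedInterval e)
    (locallyIntegrableOn_of_intervalIntegrable (Γ.isOpen_interval e) fun a ha b hb =>
      intervalIntegrable_of_initialPart (integrableOn_conj hφ.1 e)
        (interval_subset_closedInterval e ha) (interval_subset_closedInterval e hb))
    (fun a ha b hb => intervalIntegrable_of_initialPart hq ha hb) fun ψ hψ => ?_
  have hp := hψ.isSmoothFamily e
  have hder : ∀ e', deriv ((Pi.single e fun t => (ψ t : ℂ) : E → ℝ → ℂ) e')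
      = (Pi.single e fun t => ((deriv ψ t : ℝ) : ℂ) : E → ℝ → ℂ) e' := by
    intro e'
    by_cases he : e' = e
    · subst he
      rw [Pi.single_eq_same, Pi.single_eq_same]
      exact funext fun t => ((hψ.differentiable t).hasDerivAt.ofReal_comp).deriv
    · rw [Pi.single_eq_of_ne he, Pi.single_eq_of_ne he]
      exact deriv_const' 0
  have hder2 : deriv (fun t => ((deriv ψ t : ℝ) : ℂ)) = fun t => ((deriv (deriv ψ) t : ℝ) : ℂ) :=
    funext fun t => ((hψ.deriv.differentiable t).hasDerivAt.ofReal_comp).deriv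
  have hB : ∀ v, B.Holds v (bdry Γ (Pi.single e fun t => (ψ t : ℂ)) v)
      (signedBdry Γ (fun e' => deriv ((Pi.single e fun t => (ψ t : ℂ) : E → ℝ → ℂ) e')) v) := by
    intro v
    have h0 : signedBdry Γ (Pi.single e fun t => ((deriv ψ t : ℝ) : ℂ)) v = 0 := by
      ext k
      have := congrArg (fun x : Γ.BdrySpace v => x k) (hψ.deriv.bdry_eq_zero (Γ := Γ) v)
      change (Pi.single e fun t => ((deriv ψ t : ℝ) : ℂ) : E → ℝ → ℂ) k.1.edge k.1.point = 0 at this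
      change k.1.sign * (Pi.single e fun t => ((deriv ψ t : ℝ) : ℂ) : E → ℝ → ℂ) k.1.edge k.1.point = 0
      rw [this, mul_zero]
    simp only [hder]
    rw [hψ.bdry_eq_zero, h0]
    exact ⟨map_zero _, by rw [map_zero, add_zero, map_zero]⟩
  have h1 := hφ.hasSum_integral hu hLB hW hp hB
  have h2 := h1.unique (hasSum_single e fun e' he' => by
    rw [Pi.single_eq_of_ne he', Pi.zero_def, deriv_const', deriv_const']
    simp)
  have hd2 : deriv (deriv ((Pi.single e fun t => (ψ t : ℂ) : E → ℝ → ℂ) e))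
      = fun t => ((deriv (deriv ψ) t : ℝ) : ℂ) := by
    rw [hder e, Pi.single_eq_same, hder2]
  rw [hd2, Pi.single_eq_same] at h2
  have i1 := hp.integrableOn_mul (Γ := Γ) hq
  rw [Pi.single_eq_same] at i1
  have i2 : IntegrableOn (fun t => ((deriv (deriv ψ) t : ℝ) : ℂ) * conj (φ e t))
      (Γ.interval e) := by
    refine (hp.deriv.deriv.integrableOn_mul (integrableOn_conj hφ.1 e)).congr
      (Eventually.of_forall fun t => ?_)
    change deriv (deriv ((Pi.single e fun t => (ψ t : ℂ) : E → ℝ → ℂ) e)) t * _ = _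
    rw [hd2]
  rw [integral_sub i1 i2, eq_comm, sub_eq_zero] at h2
  simp only [Complex.real_smul]
  exact h2.symm

end Eigenfunction

end MetricGraph

namespace MetricGraph

variable {E V : Type*} {Γ : MetricGraph E V} {u : ℝ} {W : E → ℝ → ℝ} {φ : E → ℝ → ℂ}
  [∀ v, Fintype (Γ.Ends v)] {B : Γ.BoundaryCondition} {lam : ℂ}

lemma inner_bdry_signedBdry (p q : E → ℝ → ℂ) (v : V) :
    ⟪bdry Γ p v, signedBdry Γ q v⟫_ℂ = ⟪signedBdry Γ p v, bdry Γ q v⟫_ℂ := by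
  rw [PiLp.inner_apply, PiLp.inner_apply]
  refine Finset.sum_congr rfl fun k _ => ?_
  change k.1.sign * q k.1.edge k.1.point * conj (p k.1.edge k.1.point)
    = q k.1.edge k.1.point * conj (k.1.sign * p k.1.edge k.1.point)
  rw [map_mul, k.1.conj_sign]
  ring

/-- Green's formula for a smooth function `p` and twice weakly differentiable functions `F`. -/
lemma IsSmoothFamily.hasSum_green {p : E → ℝ → ℂ} (hp : IsSmoothFamily p) {F F' q : E → ℝ → ℂ}
    (hF : ∀ e, IsPrimitiveOn (Γ.closedInterval e) (F e) (F' e))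
    (hF' : ∀ e, IsPrimitiveOn (Γ.closedInterval e) (F' e) (q e))
    (h : HasSum (fun e => ∫ t in Γ.interval e,
      (p e t * q e t - _root_.deriv (_root_.deriv (p e)) t * F e t)) 0) :
    ∑' v, ⟪bdry Γ (fun e t => conj (F e t)) v, signedBdry Γ (fun e => _root_.deriv (p e)) v⟫_ℂ
      = ∑' v, ⟪bdry Γ (fun e t => conj (F' e t)) v, signedBdry Γ p v⟫_ℂ := by
  have hb := hp.isCompactRep (Γ := Γ)
  have hb' := hp.deriv.isCompactRep (Γ := Γ)
  have k1 := fun e => integral_deriv_mul_add (hb.prim e) (hF' e) (hb.bounded e)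
  have k2 := fun e => integral_deriv_mul_add (hb'.prim e) (hF e) (hb'.bounded e)
  set s := hp.finite.toFinset
  have hs : ∀ e, e ∉ s → p e = 0 := fun e he => by simpa [s] using he
  have hz : ∀ e, e ∉ s → _root_.deriv (p e) = 0 := fun e he => by
    rw [hs e he, Pi.zero_def, deriv_const']
  set β : E → ℂ := fun e => endValue Γ e (fun t => p e t * F' e t) - p e 0 * F' e 0 with hβ
  set β' : E → ℂ := fun e => endValue Γ e (fun t => _root_.deriv (p e) t * F e t)
    - _root_.deriv (p e) 0 * F e 0 with hβ'
  have s1 : HasSum β (∑ e ∈ s, β e) := hasSum_sum_of_ne_finset_zero fun e he => by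
    simp [hβ, hs e he, endValue]
  have s2 : HasSum β' (∑ e ∈ s, β' e) := hasSum_sum_of_ne_finset_zero fun e he => by
    simp [hβ', hz e he, endValue]
  have hsub : ∀ e, β e - β' e = ∫ t in Γ.interval e,
      (p e t * q e t - _root_.deriv (_root_.deriv (p e)) t * F e t) := fun e => by
    rw [hβ, hβ']
    simp only
    rw [← (k1 e).2, ← (k2 e).2, ← integral_sub (k1 e).1 (k2 e).1]
    refine integral_congr_ae (Eventually.of_forall fun t => ?_)
    simp only
    ring
  have heq : ∑ e ∈ s, β e = ∑ e ∈ s, β' e := by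
    rw [← sub_eq_zero]
    exact (s1.sub s2).unique (h.congr_fun fun e => hsub e)
  have b1 := hasSum_boundary (Γ := Γ) hp.finite (fun e t => conj (F' e t))
    (s1.congr_fun fun e => by simp [hβ])
  have b2 := hasSum_boundary (Γ := Γ) hp.deriv.finite (fun e t => conj (F e t))
    (s2.congr_fun fun e => by simp [hβ'])
  rw [b1.tsum_eq, b2.tsum_eq, heq]

/-- Generalized eigenfunctions are locally in `W^{2,2}` and satisfy the boundary conditions. -/
lemma IsGeneralizedEigenfunction.regularity (hu : 0 < u)
    (hLB : ∀ e, ENNReal.ofReal u ≤ Γ.l e) (hW : Γ.IsUnifLocL2 u W)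
    (hφ : IsGeneralizedEigenfunction (B.H₀ + Γ.mulOp W) lam φ) :
    Γ.LocallyW22 φ ∧ ∃ ψ : E → ℝ → ℂ, (∀ e, ψ e =ᵐ[Γ.vol e] φ e) ∧
      (∀ e, ContDiffOn ℝ 1 (ψ e) (Γ.interval e)) ∧ ∀ v, B.SatisfiedBy ψ v := by
  choose F F' hF hF' hae using fun e => hφ.exists_isPrimitiveOn hu hLB hW e
  have hψ : ∀ e, φ e =ᵐ[Γ.vol e] fun t => conj (F e t) := fun e => by
    filter_upwards [hae e] with t ht
    rw [← ht, Complex.conj_conj]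
  have hP := fun e => (hF e).star
  have hP' := fun e => (hF' e).star
  refine ⟨fun e a b ha hb hab => ?_, fun e t => conj (F e t), fun e => (hψ e).symm, fun e => ?_,
    fun v => ⟨bdry Γ (fun e t => conj (F e t)) v, signedBdry Γ (fun e t => conj (F' e t)) v,
      fun k => ?_, fun k => ?_, ?_⟩⟩
  · have hsub : Icc a b ⊆ Γ.closedInterval e := Set.OrdConnected.out inferInstance ha hb
    have hle : volume.restrict (Ioo a b) ≤ Γ.vol e :=
      Measure.restrict_mono (Ioo_subset_interval ha hb) le_rfl
    refine memW22_of_isPrimitiveOn (w := fun t => (W e t : ℂ) - conj lam) ((hP e).mono hsub)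
      ((hP' e).mono hsub) ((Measure.absolutelyContinuous_of_le hle).ae_le (hψ e))
      (Eventually.of_forall fun t => ?_) ?_
    · simp
    · have hfin : IsFiniteMeasure (volume.restrict (Ioo a b)) :=
        ⟨by rw [Measure.restrict_apply_univ]; exact measure_Ioo_lt_top⟩
      exact ((hW.memLp hu hLB e b).mono_measure (restrict_Ioo_le_initialPart ha hb)).sub
        (memLp_const _)
  · exact ((hP e).mono (interval_subset_closedInterval e)).contDiffOn (Γ.isOpen_interval e)
      ((hP' e).continuousOn.mono (interval_subset_closedInterval e))
  · exact tendsto_approach (F := fun e t => conj (F e t)) k.1 (hP _).continuousOn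
  · have h1 : Tendsto (fun t => k.1.sign * conj (F' k.1.edge t)) k.1.approach
        (𝓝 (k.1.sign * conj (F' k.1.edge k.1.point))) :=
      (tendsto_approach (F := fun e t => conj (F' e t)) k.1 (hP' _).continuousOn).const_mul _
    refine h1.congr' ?_
    filter_upwards [interval_mem_approach k.1] with t ht
    rw [(((hP k.1.edge).mono (interval_subset_closedInterval _)).hasDerivAt (Γ.isOpen_interval _)
      ((hP' _).continuousOn.mono (interval_subset_closedInterval _)) ht).deriv]
  · refine BoundaryCondition.holds_of_forall fun b b' hbb => ?_
    obtain ⟨p, hp, hpb, hpb', hpw⟩ := exists_isSmoothFamily_bdry (Γ := Γ) hu hLB v b b'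
    have hB : ∀ w, B.Holds w (bdry Γ p w) (signedBdry Γ (fun e => deriv (p e)) w) := by
      intro w
      by_cases hw : w = v
      · subst hw
        rwa [hpb, hpb']
      · rw [(hpw w hw).1, (hpw w hw).2]
        exact ⟨map_zero _, by rw [map_zero, add_zero, map_zero]⟩
    have hsum := hφ.hasSum_integral hu hLB hW hp hB
    have hg := hp.hasSum_green hF hF' (hsum.congr_fun fun e => by
      refine integral_congr_ae ?_
      filter_upwards [hae e] with t ht
      rw [← ht])
    rw [tsum_eq_single v fun w hw => by rw [(hpw w hw).2, inner_zero_right],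
      tsum_eq_single v fun w hw => by
        rw [inner_bdry_signedBdry, (hpw w hw).1, inner_zero_right],
      inner_bdry_signedBdry (fun e t => conj (F' e t)), hpb, hpb'] at hg
    exact hg

end MetricGraph

namespace MetricGraph

variable {E V : Type*} {Γ : MetricGraph E V}

/-! ### Multiplication by bounded functions -/

lemma memL2_congr {f : Γ.L2} {p : E → ℝ → ℂ} (h : ∀ e, f e =ᵐ[Γ.vol e] p e) : Γ.MemL2 p := by
  refine ⟨fun e => (Lp.memLp (f e)).1.congr (h e), ?_⟩
  have h1 := (memL2_coe f).2
  have h2 : ∀ e, ∫⁻ t, ‖p e t‖ₑ ^ 2 ∂Γ.vol e = ∫⁻ t, ‖f e t‖ₑ ^ 2 ∂Γ.vol e := fun e =>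
    lintegral_congr_ae (by filter_upwards [h e] with t ht; rw [ht])
  simpa only [h2] using h1

lemma mkL2_eq {f : Γ.L2} {p : E → ℝ → ℂ} (hp : Γ.MemL2 p) (h : ∀ e, f e =ᵐ[Γ.vol e] p e) :
    mkL2 p hp = f := L2_ext fun e => (coe_mkL2 p hp e).trans (h e).symm

lemma exists_mem_mulGraph {χ : E → ℝ → ℝ} (hχ : ∀ e, Continuous (χ e)) {C : ℝ}
    (hC : ∀ e t, |χ e t| ≤ C) (f : Γ.L2) : ∃ k, (f, k) ∈ Γ.mulGraph χ := by
  have hm : Γ.MemL2 fun e t => (χ e t : ℂ) * f e t := by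
    refine ⟨fun e => (Complex.continuous_ofReal.comp (hχ e)).aestronglyMeasurable.mul
      (Lp.memLp (f e)).1, ?_⟩
    have h1 : ∀ e, ∫⁻ t, ‖(χ e t : ℂ) * f e t‖ₑ ^ 2 ∂Γ.vol e
        ≤ ENNReal.ofReal C ^ 2 * ∫⁻ t, ‖f e t‖ₑ ^ 2 ∂Γ.vol e := fun e => by
      rw [← lintegral_const_mul' _ _ (by finiteness)]
      refine lintegral_mono fun t => ?_
      rw [enorm_mul, mul_pow]
      gcongr
      rw [← ofReal_norm, Complex.norm_real]
      exact ENNReal.ofReal_le_ofReal (hC e t)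
    refine ne_top_of_le_ne_top ?_ (ENNReal.tsum_le_tsum h1)
    rw [ENNReal.tsum_mul_left]
    exact ENNReal.mul_ne_top (by finiteness) (memL2_coe f).2
  exact ⟨mkL2 _ hm, fun e => coe_mkL2 _ hm e⟩

/-- Dominated convergence for multiplication operators. -/
lemma tendsto_of_mem_mulGraph {χ : ℕ → E → ℝ → ℝ} (hχ : ∀ n e, Continuous (χ n e)) {C c : ℝ}
    (hC : ∀ n e t, |χ n e t| ≤ C) (hlim : ∀ e t, Tendsto (fun n => χ n e t) atTop (𝓝 c))
    {f : Γ.L2} {k : ℕ → Γ.L2} (hk : ∀ n, (f, k n) ∈ Γ.mulGraph (χ n)) :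
    Tendsto k atTop (𝓝 ((c : ℂ) • f)) := by
  have hC0 : ∀ n e t, ‖((χ n e t - c : ℝ) : ℂ)‖ₑ ^ 2 ≤ ENNReal.ofReal (C + |c|) ^ 2 := by
    intro n e t
    gcongr
    rw [← ofReal_norm, Complex.norm_real]
    exact ENNReal.ofReal_le_ofReal ((abs_sub _ _).trans (by gcongr; exact hC n e t))
  have hnorm : ∀ n, ‖k n - (c : ℂ) • f‖ₑ ^ 2
      = ∑' e, ∫⁻ t, ‖((χ n e t - c : ℝ) : ℂ)‖ₑ ^ 2 * ‖f e t‖ₑ ^ 2 ∂Γ.vol e := by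
    intro n
    rw [sub_eq_add_neg, ← neg_smul, enorm_sq_eq]
    refine tsum_congr fun e => lintegral_congr_ae ?_
    filter_upwards [coe_add_ae (k n) (-(c : ℂ) • f) e, coe_smul_ae (-(c : ℂ)) f e, hk n e]
      with t h1 h2 h3
    rw [h1, h2, h3, ← mul_pow, ← enorm_mul]
    congr 2
    push_cast
    ring
  have hfin : ∑' e, ENNReal.ofReal (C + |c|) ^ 2 * ∫⁻ t, ‖f e t‖ₑ ^ 2 ∂Γ.vol e ≠ ∞ := by
    rw [ENNReal.tsum_mul_left]
    exact ENNReal.mul_ne_top (by finiteness) (memL2_coe f).2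
  have hedge : ∀ e, Tendsto (fun n => ∫⁻ t, ‖((χ n e t - c : ℝ) : ℂ)‖ₑ ^ 2 * ‖f e t‖ₑ ^ 2 ∂Γ.vol e)
      atTop (𝓝 0) := by
    intro e
    have hm := (Lp.memLp (f e)).1.enorm.pow_const 2
    have h0 : ∫⁻ t, (0 : ℝ≥0∞) ∂Γ.vol e = 0 := by simp
    rw [← h0]
    refine tendsto_lintegral_of_dominated_convergence'
      (fun t => ENNReal.ofReal (C + |c|) ^ 2 * ‖f e t‖ₑ ^ 2) (fun n => ?_) (fun n => ?_) ?_ ?_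
    · have h1 : Continuous fun t => ((χ n e t - c : ℝ) : ℂ) :=
        Complex.continuous_ofReal.comp ((hχ n e).sub continuous_const)
      exact (h1.aestronglyMeasurable.enorm.pow_const 2).mul hm
    · exact Eventually.of_forall fun t => mul_le_mul_left (hC0 n e t) _
    · rw [lintegral_const_mul' _ _ (by finiteness)]
      exact ENNReal.mul_ne_top (by finiteness) (ENNReal.ne_top_of_tsum_ne_top (memL2_coe f).2 e)
    · refine Eventually.of_forall fun t => ?_
      have h1 : Tendsto (fun n => ‖((χ n e t - c : ℝ) : ℂ)‖ₑ ^ 2) atTop (𝓝 0) := by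
        have h2 : Tendsto (fun n => χ n e t - c) atTop (𝓝 0) := by
          simpa using (hlim e t).sub_const c
        have h3 := (((ENNReal.continuous_pow 2).comp Complex.continuous_ofReal.enorm).tendsto 0).comp h2
        simpa [Function.comp_def] using h3
      have := ENNReal.Tendsto.mul_const (b := ‖f e t‖ₑ ^ 2) h1 (Or.inr (by finiteness))
      simpa using this
  have hsum : Tendsto (fun n => ‖k n - (c : ℂ) • f‖ₑ ^ 2) atTop (𝓝 0) := by
    simp only [hnorm]
    let _ : MeasurableSpace E := ⊤
    have : MeasurableSingletonClass E := ⟨fun _ => trivial⟩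
    have h0 : ∫⁻ e : E, (0 : ℝ≥0∞) ∂Measure.count = 0 := by simp
    simp only [← lintegral_count]
    rw [← h0]
    refine tendsto_lintegral_of_dominated_convergence
      (fun e => ENNReal.ofReal (C + |c|) ^ 2 * ∫⁻ t, ‖f e t‖ₑ ^ 2 ∂Γ.vol e)
      (fun n => measurable_from_top) (fun n => Eventually.of_forall fun e => ?_) ?_
      (Eventually.of_forall hedge)
    · dsimp only
      rw [← lintegral_const_mul' _ _ (by finiteness)]
      exact lintegral_mono fun t => mul_le_mul_left (hC0 n e t) _
    · rw [lintegral_count]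
      exact hfin
  rw [tendsto_iff_norm_sub_tendsto_zero]
  have h1 : Tendsto (fun n => (‖k n - (c : ℂ) • f‖ₑ ^ 2).toReal) atTop (𝓝 0) := by
    have := (ENNReal.tendsto_toReal ENNReal.zero_ne_top).comp hsum
    rwa [ENNReal.toReal_zero] at this
  have h2 := h1.sqrt
  simp only [ENNReal.toReal_pow, toReal_enorm, Real.sqrt_zero] at h2
  exact h2.congr fun n => Real.sqrt_sq (norm_nonneg _)

/-! ### Cutting off elements of the domain -/

/-- A smooth cutoff function `χ` that is constant near the vertices, where it has the values `a`. -/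
structure IsVertexCutoff (Γ : MetricGraph E V) (C : ℝ) (χ : E → ℝ → ℝ) (a : V → ℝ) : Prop where
  contDiff : ∀ e, ContDiff ℝ (⊤ : ℕ∞) (χ e)
  abs_le : ∀ e t, |χ e t| ≤ C
  abs_deriv_le : ∀ e t, |deriv (χ e) t| ≤ C
  abs_deriv_deriv_le : ∀ e t, |deriv (deriv (χ e)) t| ≤ C
  apply_point : ∀ k : Γ.EdgeEnd, χ k.edge k.point = a k.vertex
  deriv_point : ∀ k : Γ.EdgeEnd, deriv (χ k.edge) k.point = 0
  abs_vertex_le : ∀ v, |a v| ≤ 1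
  finite : {e | χ e ≠ 0}.Finite
  bounded : ∀ e, ∃ T, ∀ t ∈ Γ.interval e, T ≤ t → χ e t = 0
  bounded_deriv : ∀ e, ∃ T, ∀ t, T ≤ t → deriv (χ e) t = 0 ∧ deriv (deriv (χ e)) t = 0

lemma isPrimitiveOn_ofReal {s : Set ℝ} {χ : ℝ → ℝ} (h : ContDiff ℝ (⊤ : ℕ∞) χ) :
    IsPrimitiveOn s (fun t => (χ t : ℂ)) (fun t => (deriv χ t : ℝ)) := by
  have h1 : ContDiff ℝ 1 fun t => (χ t : ℂ) :=
    (Complex.ofRealCLM.contDiff.comp h).of_le (by simp)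
  have h2 : deriv (fun t => (χ t : ℂ)) = fun t => ((deriv χ t : ℝ) : ℂ) := funext fun t =>
    ((h.differentiable (by simp) t).hasDerivAt.ofReal_comp).deriv
  rw [← h2]
  exact IsPrimitiveOn.of_contDiff h1

namespace IsVertexCutoff

variable {C : ℝ} {χ : E → ℝ → ℝ} {a : V → ℝ}

lemma contDiff_deriv (h : IsVertexCutoff Γ C χ a) (e : E) : ContDiff ℝ (⊤ : ℕ∞) (deriv (χ e)) :=
  ContDiff.deriv' ((h.contDiff e).of_le (by simp))

lemma isRep (h : IsVertexCutoff Γ C χ a) {f f' m₀ m₁ m₀' : Γ.L2} {F : E → ℝ → ℂ}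
    (hF : IsRep f f' F) (h₀ : (f, m₀) ∈ Γ.mulGraph χ)
    (h₁ : (f, m₁) ∈ Γ.mulGraph fun e => deriv (χ e)) (h₀' : (f', m₀') ∈ Γ.mulGraph χ) :
    IsRep m₀ (m₁ + m₀') fun e t => (χ e t : ℂ) * F e t := by
  refine ⟨fun e => ?_, fun e => ?_⟩
  · refine ((isPrimitiveOn_ofReal (h.contDiff e)).mul (hF.prim e)).congr_deriv fun x hx y hy =>
      ae_uIoc_of_ae_vol ?_ hx hy
    filter_upwards [coe_add_ae m₁ m₀' e, h₁ e, h₀' e, hF.ae_eq e] with t e1 e2 e3 e4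
    rw [e1, e2, e3, e4]
  · filter_upwards [h₀ e, hF.ae_eq e] with t e1 e2
    rw [e1, e2]

lemma trace_eq (h : IsVertexCutoff Γ C χ a) {f f' m₀ m₁ m₀' : Γ.L2}
    (hf : Γ.HasDerivL2 f f') (h₀ : (f, m₀) ∈ Γ.mulGraph χ)
    (h₁ : (f, m₁) ∈ Γ.mulGraph fun e => deriv (χ e)) (h₀' : (f', m₀') ∈ Γ.mulGraph χ) (v : V) :
    Γ.trace m₀ v = (a v : ℂ) • Γ.trace f v := by
  obtain ⟨F, hF⟩ := hf.exists_isRep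
  rw [(h.isRep hF h₀ h₁ h₀').trace_eq_bdry, hF.trace_eq_bdry]
  ext k
  change (χ k.1.edge k.1.point : ℂ) * F k.1.edge k.1.point = a v * F k.1.edge k.1.point
  rw [h.apply_point, k.2]

variable [∀ v, Fintype (Γ.Ends v)] {B : Γ.BoundaryCondition}

lemma summable_inner_smul (h : IsVertexCutoff Γ C χ a)
    {A : ∀ v, Γ.BdrySpace v →L[ℂ] Γ.BdrySpace v} {x : ∀ v, Γ.BdrySpace v}
    (hx : Summable fun v => (⟪A v (x v), x v⟫_ℂ).re) :
    Summable fun v => (⟪A v ((a v : ℂ) • x v), (a v : ℂ) • x v⟫_ℂ).re := by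
  refine Summable.of_norm_bounded hx.norm fun v => ?_
  rw [map_smul, inner_smul_left, inner_smul_right, Complex.conj_ofReal, Complex.re_ofReal_mul,
    Complex.re_ofReal_mul, norm_mul, norm_mul, Real.norm_eq_abs]
  have h1 := h.abs_vertex_le v
  calc |a v| * (|a v| * ‖(⟪A v (x v), x v⟫_ℂ).re‖)
      ≤ 1 * (1 * ‖(⟪A v (x v), x v⟫_ℂ).re‖) := by gcongr
    _ = _ := by ring

lemma mem_formDomain (h : IsVertexCutoff Γ C χ a) {f f' m₀ m₁ m₀' : Γ.L2}
    (hf : f ∈ B.formDomain) (hf' : Γ.HasDerivL2 f f') (h₀ : (f, m₀) ∈ Γ.mulGraph χ)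
    (h₁ : (f, m₁) ∈ Γ.mulGraph fun e => deriv (χ e)) (h₀' : (f', m₀') ∈ Γ.mulGraph χ) :
    m₀ ∈ B.formDomain := by
  obtain ⟨F, hF⟩ := hf'.exists_isRep
  have hr := h.isRep hF h₀ h₁ h₀'
  have ht := h.trace_eq hf' h₀ h₁ h₀'
  obtain ⟨-, -, hP, hpos, hneg⟩ := hf
  refine ⟨⟨_, hr.hasDerivL2⟩, hr.hasTraces, fun v => by rw [ht, map_smul, hP, smul_zero], ?_, ?_⟩
  · simp only [ht]
    exact h.summable_inner_smul (A := fun v => (B.L v)⁺) hpos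
  · simp only [ht]
    exact h.summable_inner_smul (A := fun v => (B.L v)⁻) hneg

/-- Integration by parts against `χ' f`, which vanishes at the vertices. -/
lemma inner_add_inner_eq_zero (h : IsVertexCutoff Γ C χ a) {f f' g g' m₁ m₂ m₁' : Γ.L2}
    (hf : Γ.HasDerivL2 f f') (hg : Γ.HasDerivL2 g g')
    (h₁ : (f, m₁) ∈ Γ.mulGraph fun e => deriv (χ e))
    (h₂ : (f, m₂) ∈ Γ.mulGraph fun e => deriv (deriv (χ e)))
    (h₁' : (f', m₁') ∈ Γ.mulGraph fun e => deriv (χ e)) :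
    ⟪g, m₂ + m₁'⟫_ℂ + ⟪g', m₁⟫_ℂ = 0 := by
  obtain ⟨F, hF⟩ := hf.exists_isRep
  obtain ⟨G, hG⟩ := hg.exists_isRep
  set p : E → ℝ → ℂ := fun e t => ((deriv (χ e) t : ℝ) : ℂ) * F e t with hp
  set p' : E → ℝ → ℂ := fun e t => ((deriv (deriv (χ e)) t : ℝ) : ℂ) * F e t
    + ((deriv (χ e) t : ℝ) : ℂ) * f' e t with hp'
  have ep : ∀ e, m₁ e =ᵐ[Γ.vol e] p e := fun e => by
    filter_upwards [h₁ e, hF.ae_eq e] with t e1 e2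
    rw [e1, e2]
  have ep' : ∀ e, (m₂ + m₁' : Γ.L2) e =ᵐ[Γ.vol e] p' e := fun e => by
    filter_upwards [coe_add_ae m₂ m₁' e, h₂ e, h₁' e, hF.ae_eq e] with t e1 e2 e3 e4
    rw [e1, e2, e3, e4]
  have hc : IsCompactRep Γ p p' := by
    refine ⟨fun e => (isPrimitiveOn_ofReal (h.contDiff_deriv e)).mul (hF.prim e), memL2_congr ep,
      memL2_congr ep', h.finite.subset fun e he h0 => he ?_, fun e => ?_⟩
    · funext t
      rw [hp]
      simp only
      rw [h0, Pi.zero_def, deriv_const']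
      simp
    · obtain ⟨T, hT⟩ := h.bounded_deriv e
      refine ⟨T, fun t ht => ?_⟩
      simp [hp, hp', hT t ht]
  have hb : ∀ v, signedBdry Γ p v = 0 := fun v => by
    ext k
    change k.1.sign * (((deriv (χ k.1.edge) k.1.point : ℝ) : ℂ) * F k.1.edge k.1.point) = 0
    rw [h.deriv_point]
    simp
  have hs := hc.hasSum_inner_deriv hG
  simp only [hb, inner_zero_right, mkL2_eq _ ep, mkL2_eq _ ep'] at hs
  exact neg_eq_zero.1 (hs.unique hasSum_zero)

/-- Cutting off an element of the domain of `H₀`. -/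
lemma mem_opGraph (hχ : IsVertexCutoff Γ C χ a) {f f' h m₀ m₁ m₂ m₁' mh : Γ.L2}
    (hf : (f, h) ∈ B.opGraph) (hf' : Γ.HasDerivL2 f f') (h₀ : (f, m₀) ∈ Γ.mulGraph χ)
    (h₁ : (f, m₁) ∈ Γ.mulGraph fun e => deriv (χ e))
    (h₂ : (f, m₂) ∈ Γ.mulGraph fun e => deriv (deriv (χ e)))
    (h₁' : (f', m₁') ∈ Γ.mulGraph fun e => deriv (χ e)) (hh : (h, mh) ∈ Γ.mulGraph χ) :
    (m₀, mh - (m₁' + m₁') - m₂) ∈ B.opGraph := by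
  have hex := fun g => exists_mem_mulGraph (Γ := Γ) (fun e => (hχ.contDiff e).continuous)
    hχ.abs_le g
  have hex' := fun g => exists_mem_mulGraph (Γ := Γ) (fun e => (hχ.contDiff_deriv e).continuous)
    hχ.abs_deriv_le g
  obtain ⟨m₀', h₀'⟩ := hex f'
  obtain ⟨F, hF⟩ := hf'.exists_isRep
  have hm₀ := hχ.isRep hF h₀ h₁ h₀'
  refine ⟨hχ.mem_formDomain hf.1 hf' h₀ h₁ h₀', fun g hg => ?_⟩
  obtain ⟨g', hg'⟩ := hg.1
  obtain ⟨G, hG⟩ := hg'.exists_isRep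
  obtain ⟨n₀, k₀⟩ := hex g
  obtain ⟨n₀', k₀'⟩ := hex g'
  obtain ⟨n₁, k₁⟩ := hex' g
  have hn₀ := hχ.isRep hG k₀ k₁ k₀'
  have e1 := hf.2 n₀ (hχ.mem_formDomain hg hg' k₀ k₁ k₀')
  have e2 := hχ.inner_add_inner_eq_zero hf' hg' h₁ h₂ h₁'
  have e3 : ∀ v, ⟪Γ.trace n₀ v, B.L v (Γ.trace f v)⟫_ℂ
      = ⟪Γ.trace g v, B.L v (Γ.trace m₀ v)⟫_ℂ := fun v => by
    rw [hχ.trace_eq hg' k₀ k₁ k₀', hχ.trace_eq hf' h₀ h₁ h₀', map_smul, inner_smul_left,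
      inner_smul_right, Complex.conj_ofReal]
  simp only [BoundaryCondition.form, hn₀.hasDerivL2.derivL2_eq, hf'.derivL2_eq, e3] at e1
  change B.form m₀ g = ⟪g, mh - (m₁' + m₁') - m₂⟫_ℂ
  rw [BoundaryCondition.form, hm₀.hasDerivL2.derivL2_eq, hg'.derivL2_eq]
  have i1 : ⟪n₁, f'⟫_ℂ = ⟪g, m₁'⟫_ℂ := (inner_mul_symm h₁' k₁).symm
  have i2 : ⟪n₀', f'⟫_ℂ = ⟪g', m₀'⟫_ℂ := (inner_mul_symm h₀' k₀').symm
  have i3 : ⟪n₀, h⟫_ℂ = ⟪g, mh⟫_ℂ := (inner_mul_symm hh k₀).symm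
  rw [inner_add_left, i1, i2, i3] at e1
  rw [inner_add_right] at e2
  rw [inner_add_right, inner_sub_right, inner_sub_right, inner_add_right]
  linear_combination e1 + e2

end IsVertexCutoff

end MetricGraph

namespace MetricGraph

variable {E V : Type*} {Γ : MetricGraph E V}

/-! ### Cutoff functions for finite sets of vertices -/

variable (Γ) in
open Classical in
/-- The cutoff function for a set `A` of vertices: it is `1` at the vertices in `A` and `0` at the
other ones, and on an edge of infinite length it is cut off at distance `N`. -/
noncomputable def vertexCutoff (η : ℝ → ℝ) (A : Set V) (N : ℝ) (e : E) : ℝ → ℝ :=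
  if h : Γ.l e = ∞ then
    if Γ.i e ∈ A then fun t => η (N⁻¹ * t) else fun _ => 0
  else if Γ.i e ∈ A then
    if Γ.j ⟨e, h⟩ ∈ A then fun _ => 1 else fun t => η t
  else if Γ.j ⟨e, h⟩ ∈ A then fun t => η ((Γ.l e).toReal - t) else fun _ => 0

lemma exists_vertexCutoff_eq (η : ℝ → ℝ) (A : Set V) {N : ℝ} (hN : 1 ≤ N) (e : E) :
    ∃ α β c d : ℝ, |α| ≤ 1 ∧ |β| ≤ 1 ∧ |c| ≤ 1 ∧
      Γ.vertexCutoff η A N e = fun t => α + β * η (c * t + d) := by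
  have hN' : |N⁻¹| ≤ 1 := by
    rw [abs_of_nonneg (by positivity)]
    exact inv_le_one_of_one_le₀ hN
  unfold vertexCutoff
  split_ifs
  · exact ⟨0, 1, N⁻¹, 0, by simp, by simp, hN', by simp⟩
  · exact ⟨0, 0, 0, 0, by simp, by simp, by simp, by simp⟩
  · exact ⟨1, 0, 0, 0, by simp, by simp, by simp, by simp⟩
  · exact ⟨0, 1, 1, 0, by simp, by simp, by simp, by simp⟩
  · exact ⟨0, 1, -1, (Γ.l e).toReal, by simp, by simp, by simp, by
      funext t
      rw [zero_add, one_mul]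
      congr 1
      ring⟩
  · exact ⟨0, 0, 0, 0, by simp, by simp, by simp, by simp⟩

lemma deriv_add_mul_comp {η : ℝ → ℝ} (h : Differentiable ℝ η) (α β c d : ℝ) :
    deriv (fun t => α + β * η (c * t + d)) = fun t => 0 + (β * c) * deriv η (c * t + d) := by
  funext t
  have h1 : HasDerivAt (fun t => c * t + d) c t := by
    simpa using ((hasDerivAt_id t).const_mul c).add_const d
  have h2 := (((h (c * t + d)).hasDerivAt.comp t h1).const_mul β).const_add α
  rw [zero_add]
  refine (h2.deriv).trans ?_
  ring

namespace IsCutoff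

variable {u : ℝ} {η : ℝ → ℝ}

lemma contDiff_deriv (hη : IsCutoff u η) : ContDiff ℝ (⊤ : ℕ∞) (deriv η) :=
  ContDiff.deriv' (hη.contDiff.of_le (by simp))

lemma exists_bound (hη : IsCutoff u η) :
    ∃ C, 0 ≤ C ∧ ∀ t, |η t| ≤ C ∧ |deriv η t| ≤ C ∧ |deriv (deriv η) t| ≤ C := by
  obtain ⟨C₀, h₀⟩ := hη.hasCompactSupport.exists_bound_of_continuous hη.contDiff.continuous
  obtain ⟨C₁, h₁⟩ := hη.hasCompactSupport.deriv.exists_bound_of_continuous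
    hη.contDiff_deriv.continuous
  obtain ⟨C₂, h₂⟩ := hη.hasCompactSupport.deriv.deriv.exists_bound_of_continuous
    (hη.contDiff_deriv.continuous_deriv (by simp))
  refine ⟨max C₀ (max C₁ C₂), (norm_nonneg _).trans ((h₀ 0).trans (le_max_left _ _)), fun t =>
    ⟨(h₀ t).trans (le_max_left _ _), (h₁ t).trans ?_, (h₂ t).trans ?_⟩⟩
  · exact (le_max_left _ _).trans (le_max_right _ _)
  · exact (le_max_right _ _).trans (le_max_right _ _)

lemma eventuallyEq_zero (hη : IsCutoff u η) {t : ℝ} (ht : u < 2 * |t|) : η =ᶠ[𝓝 t] 0 := by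
  have hc : Continuous fun t : ℝ => 2 * |t| := by fun_prop
  filter_upwards [hc.continuousAt.eventually_const_lt ht] with s hs
  exact hη.eq_zero s hs.le

lemma deriv_eq_zero (hη : IsCutoff u η) {t : ℝ} (ht : u < 2 * |t|) :
    deriv η t = 0 ∧ deriv (deriv η) t = 0 := by
  have h1 := (hη.eventuallyEq_zero ht).deriv
  have h0 : deriv (0 : ℝ → ℝ) = 0 := deriv_const' 0
  rw [h0] at h1
  exact ⟨h1.eq_of_nhds, by rw [h1.deriv_eq, h0, Pi.zero_apply]⟩

/-- The cutoff function is locally constant near the vertices. -/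
lemma vertexCutoff_eventuallyEq (hu : 0 < u) (hLB : ∀ e, ENNReal.ofReal u ≤ Γ.l e)
    (hη : IsCutoff u η) (A : Set V) (N : ℝ) (k : Γ.EdgeEnd) :
    Γ.vertexCutoff η A N k.edge =ᶠ[𝓝 k.point] fun _ => A.indicator 1 k.vertex := by
  have hone : ∀ {g : ℝ → ℝ} {x : ℝ}, Continuous g → g x = 0 →
      (fun t => η (g t)) =ᶠ[𝓝 x] fun _ => 1 := by
    intro g x hg hx
    have := hg.tendsto x
    rw [hx] at this
    exact this.eventually hη.eventually_eq_one
  have hzero : ∀ {g : ℝ → ℝ} {x : ℝ}, Continuous g → u < 2 * |g x| →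
      (fun t => η (g t)) =ᶠ[𝓝 x] fun _ => 0 := by
    intro g x hg hx
    exact (hg.tendsto x).eventually (hη.eventuallyEq_zero hx)
  rcases k with e | ⟨e, he⟩
  · change Γ.vertexCutoff η A N e =ᶠ[𝓝 0] fun _ => A.indicator 1 (Γ.i e)
    unfold vertexCutoff
    split_ifs with h1 h2 h2 h3 h3
    · simpa [indicator_of_mem h2] using hone (g := fun t => N⁻¹ * t) (x := 0) (by fun_prop) (by simp)
    · simp [indicator_of_notMem h2]
    · simp [indicator_of_mem h2]
    · simpa [indicator_of_mem h2] using hone (g := fun t => t) (x := 0) (by fun_prop) rfl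
    · have hl := le_toReal_l (hLB e) h1
      have := hzero (g := fun t => (Γ.l e).toReal - t) (x := 0) (by fun_prop) (by
        rw [sub_zero, abs_of_pos (by linarith)]
        linarith)
      simpa [indicator_of_notMem h2] using this
    · simp [indicator_of_notMem h2]
  · change Γ.vertexCutoff η A N e =ᶠ[𝓝 (Γ.l e).toReal] fun _ => A.indicator 1 (Γ.j ⟨e, he⟩)
    unfold vertexCutoff
    rw [dif_neg he]
    split_ifs with h2 h3 h3
    · simp [indicator_of_mem h3]
    · have hl := le_toReal_l (hLB e) he
      have := hzero (g := fun t => t) (x := (Γ.l e).toReal) (by fun_prop) (by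
        rw [abs_of_pos (by linarith)]
        linarith)
      simpa [indicator_of_notMem h3] using this
    · simpa [indicator_of_mem h3] using hone (g := fun t => (Γ.l e).toReal - t)
        (x := (Γ.l e).toReal) (by fun_prop) (by simp)
    · simp [indicator_of_notMem h3]

lemma finite_vertexCutoff [∀ v, Fintype (Γ.Ends v)] (η : ℝ → ℝ) {A : Set V} (hA : A.Finite)
    (N : ℝ) : {e | Γ.vertexCutoff η A N e ≠ 0}.Finite := by
  refine (hA.biUnion (t := fun v => range fun k : Γ.Ends v => k.1.edge)
    fun v _ => finite_range _).subset fun e he => ?_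
  by_contra h
  have hi : Γ.i e ∉ A := fun hi => h (mem_biUnion hi ⟨⟨Sum.inl e, rfl⟩, rfl⟩)
  have hj : ∀ h', Γ.j ⟨e, h'⟩ ∉ A := fun h' hj =>
    h (mem_biUnion hj ⟨⟨Sum.inr ⟨e, h'⟩, rfl⟩, rfl⟩)
  refine he ?_
  unfold vertexCutoff
  by_cases hl : Γ.l e = ∞
  · rw [dif_pos hl, if_neg hi]
    rfl
  · rw [dif_neg hl, if_neg hi, if_neg (hj hl)]
    rfl

lemma exists_isVertexCutoff [∀ v, Fintype (Γ.Ends v)] (hu : 0 < u)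
    (hLB : ∀ e, ENNReal.ofReal u ≤ Γ.l e) (hη : IsCutoff u η) :
    ∃ C, ∀ (A : Set V) (N : ℝ), A.Finite → 1 ≤ N →
      IsVertexCutoff Γ C (Γ.vertexCutoff η A N) (A.indicator 1) := by
  obtain ⟨C, hC0, hC⟩ := hη.exists_bound
  have hd := hη.contDiff.differentiable (by simp)
  have hd' := hη.contDiff_deriv.differentiable (by simp)
  have habs : ∀ {α β x : ℝ}, |α| ≤ 1 → |β| ≤ 1 → |x| ≤ C → |α + β * x| ≤ 1 + C := by
    intro α β x hα hβ hx
    refine (abs_add_le _ _).trans (add_le_add hα ?_)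
    rw [abs_mul]
    calc |β| * |x| ≤ 1 * C := by gcongr
      _ = C := one_mul _
  have hmul : ∀ {β c : ℝ}, |β| ≤ 1 → |c| ≤ 1 → |β * c| ≤ 1 := by
    intro β c hβ hc
    rw [abs_mul]
    exact mul_le_one₀ hβ (abs_nonneg _) hc
  refine ⟨1 + C, fun A N hA hN => ⟨fun e => ?_, fun e t => ?_, fun e t => ?_, fun e t => ?_,
    fun k => ?_, fun k => ?_, fun v => ?_, finite_vertexCutoff η hA N, fun e => ?_, fun e => ?_⟩⟩
  · obtain ⟨α, β, c, d, hα, hβ, hc, h⟩ := exists_vertexCutoff_eq (Γ := Γ) η A hN e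
    rw [h]
    exact contDiff_const.add (contDiff_const.mul
      (hη.contDiff.comp ((contDiff_const.mul contDiff_id).add contDiff_const)))
  · obtain ⟨α, β, c, d, hα, hβ, hc, h⟩ := exists_vertexCutoff_eq (Γ := Γ) η A hN e
    rw [h]
    exact habs hα hβ (hC _).1
  · obtain ⟨α, β, c, d, hα, hβ, hc, h⟩ := exists_vertexCutoff_eq (Γ := Γ) η A hN e
    rw [h, deriv_add_mul_comp hd]
    exact habs (by simp) (hmul hβ hc) (hC _).2.1
  · obtain ⟨α, β, c, d, hα, hβ, hc, h⟩ := exists_vertexCutoff_eq (Γ := Γ) η A hN e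
    rw [h, deriv_add_mul_comp hd, deriv_add_mul_comp hd']
    exact habs (by simp) (hmul (hmul hβ hc) hc) (hC _).2.2
  · exact (hη.vertexCutoff_eventuallyEq hu hLB A N k).eq_of_nhds
  · rw [(hη.vertexCutoff_eventuallyEq hu hLB A N k).deriv_eq, deriv_const]
  · by_cases hv : v ∈ A
    · simp [indicator_of_mem hv]
    · simp [indicator_of_notMem hv]
  · by_cases hl : Γ.l e = ∞
    · refine ⟨N * u, fun t _ ht => ?_⟩
      unfold vertexCutoff
      rw [dif_pos hl]
      split_ifs with hi
      · refine hη.eq_zero _ ?_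
        have hN0 : 0 < N := by linarith
        have h1 : u ≤ N⁻¹ * t := by
          rw [inv_mul_eq_div, le_div_iff₀ hN0]
          linarith
        linarith [le_abs_self (N⁻¹ * t)]
      · rfl
    · refine ⟨(Γ.l e).toReal, fun t ht ht' => ?_⟩
      rw [interval_eq_of_ne_top hl] at ht
      exact absurd ht.2 (not_lt.2 ht')
  · obtain ⟨α, β, c, d, -, -, -, h⟩ := exists_vertexCutoff_eq (Γ := Γ) η A hN e
    rw [h, deriv_add_mul_comp hd, deriv_add_mul_comp hd']
    by_cases hc : c = 0
    · exact ⟨0, fun t _ => by simp [hc]⟩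
    · refine ⟨(u + |d|) / |c|, fun t ht => ?_⟩
      rw [div_le_iff₀ (abs_pos.2 hc)] at ht
      have h1 : u < 2 * |c * t + d| := by
        have h2 : |c * t| ≤ |c * t + d| + |d| := by
          have := abs_sub (c * t + d) d
          rwa [add_sub_cancel_right] at this
        have h3 : t * |c| ≤ |c * t| := by
          rw [abs_mul, mul_comm]
          gcongr
          exact le_abs_self t
        linarith
      simp [(hη.deriv_eq_zero h1).1, (hη.deriv_eq_zero h1).2]

lemma vertexCutoff_eventuallyEq_one (hη : IsCutoff u η) {A : ℕ → Set V}
    (hA : ∀ v, ∀ᶠ n in atTop, v ∈ A n) (e : E) (t : ℝ) :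
    ∀ᶠ n : ℕ in atTop, Γ.vertexCutoff η (A n) (n + 1) e =ᶠ[𝓝 t] fun _ => 1 := by
  by_cases hl : Γ.l e = ∞
  · have h1 : Tendsto (fun n : ℕ => ((n : ℝ) + 1)⁻¹ * t) atTop (𝓝 0) := by
      have := (tendsto_one_div_add_atTop_nhds_zero_nat (𝕜 := ℝ)).mul_const t
      simpa using this
    filter_upwards [hA (Γ.i e), h1.eventually (eventually_eventually_nhds.2 hη.eventually_eq_one)]
      with n hi hn
    unfold vertexCutoff
    rw [dif_pos hl, if_pos hi]
    have hc : Continuous fun s : ℝ => ((n : ℝ) + 1)⁻¹ * s := by fun_prop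
    exact (hc.tendsto t).eventually hn
  · filter_upwards [hA (Γ.i e), hA (Γ.j ⟨e, hl⟩)] with n hi hj
    unfold vertexCutoff
    rw [dif_neg hl, if_pos hi, if_pos hj]

end IsCutoff

lemma exists_finite_exhaustion (V : Type*) [Countable V] :
    ∃ A : ℕ → Set V, (∀ n, (A n).Finite) ∧ ∀ v, ∀ᶠ n in atTop, v ∈ A n := by
  obtain ⟨g, hg⟩ := exists_injective_nat V
  refine ⟨fun n => g ⁻¹' Iio n, fun n => (finite_Iio n).preimage hg.injOn, fun v => ?_⟩
  filter_upwards [eventually_gt_atTop (g v)] with n hn using hn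

/-- A sequence of cutoff functions that converges to `1` with bounded derivatives. -/
lemma exists_isVertexCutoff_seq [Countable V] [∀ v, Fintype (Γ.Ends v)] {u : ℝ} (hu : 0 < u)
    (hLB : ∀ e, ENNReal.ofReal u ≤ Γ.l e) :
    ∃ (C : ℝ) (χ : ℕ → E → ℝ → ℝ) (a : ℕ → V → ℝ), (∀ n, IsVertexCutoff Γ C (χ n) (a n)) ∧
      ∀ e t, Tendsto (fun n => χ n e t) atTop (𝓝 1) ∧
        Tendsto (fun n => deriv (χ n e) t) atTop (𝓝 0) ∧
        Tendsto (fun n => deriv (deriv (χ n e)) t) atTop (𝓝 0) := by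
  obtain ⟨η, hη⟩ := exists_isCutoff hu
  obtain ⟨A, hAf, hA⟩ := exists_finite_exhaustion V
  obtain ⟨C, hC⟩ := hη.exists_isVertexCutoff hu hLB
  refine ⟨C, fun n => Γ.vertexCutoff η (A n) (n + 1), fun n => (A n).indicator 1,
    fun n => hC _ _ (hAf n) (by simp), fun e t => ?_⟩
  have h := hη.vertexCutoff_eventuallyEq_one (Γ := Γ) hA e t
  have h0 : deriv (fun _ : ℝ => (1 : ℝ)) = fun _ => 0 := deriv_const' 1
  refine ⟨tendsto_const_nhds.congr' ?_, tendsto_const_nhds.congr' ?_,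
    tendsto_const_nhds.congr' ?_⟩
  · filter_upwards [h] with n hn using hn.eq_of_nhds.symm
  · filter_upwards [h] with n hn
    rw [hn.deriv_eq, deriv_const]
  · filter_upwards [h] with n hn
    rw [hn.deriv.deriv_eq, h0, deriv_const]

/-! ### The core -/

lemma hasCore_of_tendsto {A : Γ.L2 →ₗ.[ℂ] Γ.L2} (hA : A.IsClosed) {S : Submodule ℂ Γ.L2}
    (hS : S ≤ A.domain)
    (h : ∀ f g, (f, g) ∈ A.graph → ∃ (x y : ℕ → Γ.L2), (∀ n, x n ∈ S ∧ (x n, y n) ∈ A.graph) ∧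
      Tendsto x atTop (𝓝 f) ∧ Tendsto y atTop (𝓝 g)) : A.HasCore S := by
  refine ⟨hS, LinearPMap.eq_of_eq_graph ?_⟩
  have hle : A.domRestrict S ≤ A := LinearPMap.domRestrict_le
  have hcl := hA.isClosable.leIsClosable hle
  rw [← hcl.graph_closure_eq_closure_graph]
  refine le_antisymm (Submodule.topologicalClosure_minimal _ (LinearPMap.le_graph_of_le hle) hA) ?_
  rintro ⟨f, g⟩ hfg
  obtain ⟨x, y, hxy, hx, hy⟩ := h f g hfg
  refine mem_closure_of_tendsto (hx.prodMk_nhds hy) (Eventually.of_forall fun n => ?_)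
  obtain ⟨z, hz, hz'⟩ := (LinearPMap.mem_graph_iff _).1 (hxy n).2
  refine (LinearPMap.mem_graph_iff _).2 ⟨⟨x n, (hxy n).1, hS (hxy n).1⟩, rfl, ?_⟩
  rw [← hz']
  exact LinearPMap.domRestrict_apply hz.symm

variable [∀ v, Fintype (Γ.Ends v)] {B : Γ.BoundaryCondition}

lemma BoundaryCondition.hasCore [Countable V] {u : ℝ} (hu : 0 < u)
    (hLB : ∀ e, ENNReal.ofReal u ≤ Γ.l e) {S : ℝ} (hS : 0 < S) (hUB : ∀ v, ‖(B.L v)⁺‖ ≤ S)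
    {W : E → ℝ → ℝ} (hW : Γ.IsUnifLocL2 u W) :
    (B.H₀ + Γ.mulOp W).HasCore (compactDomain B.H₀) := by
  refine hasCore_of_tendsto (isSelfAdjoint_add_mulOp hu hLB hS hUB hW).isClosed
    (fun f hf => ⟨hf.1, domain_add_mulOp hu hLB hW hf.1⟩) fun f y hfy => ?_
  rw [mem_graph_add_iff, graph_H₀, graph_mulOp] at hfy
  obtain ⟨h, w, hh, hw, rfl⟩ := hfy
  obtain ⟨f', hf'⟩ := hh.1.1
  obtain ⟨C, χ, a, hχ, hlim⟩ := exists_isVertexCutoff_seq (Γ := Γ) hu hLB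
  have c0 : ∀ n e, Continuous (χ n e) := fun n e => ((hχ n).contDiff e).continuous
  have c1 : ∀ n e, Continuous (deriv (χ n e)) := fun n e => ((hχ n).contDiff_deriv e).continuous
  have c2 : ∀ n e, Continuous (deriv (deriv (χ n e))) := fun n e =>
    ((hχ n).contDiff_deriv e).continuous_deriv (by simp)
  choose m₀ h₀ using fun n => exists_mem_mulGraph (c0 n) (hχ n).abs_le f
  choose m₁ h₁ using fun n => exists_mem_mulGraph (c1 n) (hχ n).abs_deriv_le f
  choose m₂ h₂ using fun n => exists_mem_mulGraph (c2 n) (hχ n).abs_deriv_deriv_le f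
  choose m₁' h₁' using fun n => exists_mem_mulGraph (c1 n) (hχ n).abs_deriv_le f'
  choose mh hmh using fun n => exists_mem_mulGraph (c0 n) (hχ n).abs_le h
  choose mw hmw using fun n => exists_mem_mulGraph (c0 n) (hχ n).abs_le w
  have t₀ := tendsto_of_mem_mulGraph c0 (fun n => (hχ n).abs_le) (fun e t => (hlim e t).1) h₀
  have th := tendsto_of_mem_mulGraph c0 (fun n => (hχ n).abs_le) (fun e t => (hlim e t).1) hmh
  have tw := tendsto_of_mem_mulGraph c0 (fun n => (hχ n).abs_le) (fun e t => (hlim e t).1) hmw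
  have t₂ := tendsto_of_mem_mulGraph c2 (fun n => (hχ n).abs_deriv_deriv_le)
    (fun e t => (hlim e t).2.2) h₂
  have t₁' := tendsto_of_mem_mulGraph c1 (fun n => (hχ n).abs_deriv_le)
    (fun e t => (hlim e t).2.1) h₁'
  simp only [Complex.ofReal_one, Complex.ofReal_zero, one_smul, zero_smul] at t₀ th tw t₂ t₁'
  have hop := fun n => (hχ n).mem_opGraph hh hf' (h₀ n) (h₁ n) (h₂ n) (h₁' n) (hmh n)
  refine ⟨m₀, fun n => mh n - (m₁' n + m₁' n) - m₂ n + mw n, fun n => ⟨⟨?_, ?_⟩, ?_⟩, t₀, ?_⟩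
  · have := hop n
    rw [← graph_H₀] at this
    exact LinearPMap.mem_domain_of_mem_graph this
  · refine hasCompactSupp_of_finite (p := fun e t => (χ n e t : ℂ) * f e t) (h₀ n)
      ((hχ n).finite.subset fun e he h0 => he ?_) fun e => ?_
    · funext t
      simp [h0]
    · obtain ⟨T, hT⟩ := (hχ n).bounded e
      exact ⟨T, fun t ht ht' => by simp [hT t ht ht']⟩
  · rw [mem_graph_add_iff, graph_H₀, graph_mulOp]
    refine ⟨_, mw n, hop n, fun e => ?_, rfl⟩
    filter_upwards [hmw n e, hw e, h₀ n e] with t e1 e2 e3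
    rw [e1, e2, e3]
    ring
  · have := ((th.sub (t₁'.add t₁')).sub t₂).add tw
    simpa using this

end MetricGraph

theorem mainTheorem3 {E V : Type*} [Countable E] [Countable V] (Γ : MetricGraph E V)
    -- every vertex has finite degree
    [∀ v, Fintype (Γ.Ends v)]
    -- the edge lengths are bounded below by `u`
    (u : ℝ) (hu : 0 < u) (hLB : ∀ e, ENNReal.ofReal u ≤ Γ.l e)
    (B : Γ.BoundaryCondition)
    -- the norms of the positive parts of the `L_v` are bounded
    (S : ℝ) (hS : 0 < S) (hUB : ∀ v, ‖(B.L v)⁺‖ ≤ S)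
    (W : E → ℝ → ℝ) (hW : Γ.IsUnifLocL2 u W) :
    -- (i)
    (MetricGraph.InfinitesimallyBounded (Γ.mulOp W) B.H₀ ∧
      IsSelfAdjoint B.H₀ ∧
      (B.H₀ + Γ.mulOp W).domain = B.H₀.domain ∧
      IsSelfAdjoint (B.H₀ + Γ.mulOp W)) ∧
    -- (ii)
    (MetricGraph.InvSqrtBoundedToLinfty B.H₀ ∧
      MetricGraph.InvSqrtBoundedToLinfty (B.H₀ + Γ.mulOp W)) ∧
    -- (iii)
    (B.H₀ + Γ.mulOp W).HasCore (MetricGraph.compactDomain B.H₀) ∧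
    -- (iv)
    (∀ (lam : ℂ) (φ : E → ℝ → ℂ),
      MetricGraph.IsGeneralizedEigenfunction (B.H₀ + Γ.mulOp W) lam φ →
        Γ.LocallyW22 φ ∧
        ∃ ψ : E → ℝ → ℂ, (∀ e, ψ e =ᵐ[Γ.vol e] φ e) ∧
          (∀ e, ContDiffOn ℝ 1 (ψ e) (Γ.interval e)) ∧
          ∀ v, B.SatisfiedBy ψ v) := by
  have hz := MetricGraph.isUnifLocL2_zero (Γ := Γ) u
  have h0 := MetricGraph.BoundaryCondition.H₀_add_mulOp_zero (B := B)
  refine ⟨⟨MetricGraph.BoundaryCondition.infinitesimallyBounded hu hLB hS hUB hW, ?_, ?_,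
    MetricGraph.BoundaryCondition.isSelfAdjoint_add_mulOp hu hLB hS hUB hW⟩,
    ⟨?_, MetricGraph.BoundaryCondition.invSqrtBoundedToLinfty hu hLB hS hUB hW⟩,
    MetricGraph.BoundaryCondition.hasCore hu hLB hS hUB hW,
    fun lam φ hφ => hφ.regularity hu hLB hW⟩
  · rw [← h0]
    exact MetricGraph.BoundaryCondition.isSelfAdjoint_add_mulOp hu hLB hS hUB hz
  · exact inf_eq_left.2 (MetricGraph.BoundaryCondition.domain_add_mulOp hu hLB hW)
  · rw [← h0]
    exact MetricGraph.BoundaryCondition.invSqrtBoundedToLinfty hu hLB hS hUB hz
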